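/- **Setting.** Let $d\in\{2,3\}$, $p\in\mathbb N_0$, $0<\alpha\le\beta<\infty$, $\gamma\in\mathbb R$, and let $\Omega\subset\mathbb R^d$ be bounded and open with $\operatorname{int}(\overline\Omega)=\Omega$ (for instance a polygonal/polyhedral Lipschitz domain). Let $A\colon\Omega\to\mathbb R^{d\times d}$ be measurable, symmetric and satisfy $\alpha|\eta|^2\le (A(x)\eta)\cdot\eta\le\beta|\eta|^2$ for a.e. $x\in\Omega$ and all $\eta\in\mathbb R^d$; write $a_\omega(u,v)=\int_\omega (A\nabla u)\cdot\nabla v\,dx$, $\|u\|_{a,\omega}=a_\omega(u,u)^{1/2}$, and let $\mathcal A_\omega^{-1}f\in H^1_0(\omega)$ be the solution of $a_\omega(\mathcal A_\omega^{-1}f,v)=(f,v)_{L^2(\omega)}$ for all $v\in H^1_0(\omega)$. (For closed $\omega$, $H^1_0(\omega)$ means $H^1_0$ of its interior.) Let $\mathcal T_H$ be a finite conforming mesh of $\Omega$ into closed quadrilaterals ($d=2$) or hexahedra ($d=3$), i.e. images $T=F_T([0,1]^d)$ under injective multilinear maps, with $H=\max_T\operatorname{diam}T$, that is shape regular, $\operatorname{diam}(T)\,|x-y|\le\gamma|F_T(x)-F_T(y)|$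 for $x,y\in[0,1]^d$, and quasi-uniform, $H\le\gamma\operatorname{diam}(T)$ for all $T$. Let $\mathcal N_H$ be the set of all vertices, $\Lambda_z$ the (mapped) multilinear hat function of $z\in\mathcal N_H$, $\omega_z=\operatorname{supp}\Lambda_z$, $\mathsf N^0(\omega)=\omega$, $\mathsf N^{k+1}(\omega)=\bigcup\{T\in\mathcal T_H: T\cap\mathsf N^k(\omega)\ne\emptyset\}$, $\omega_z^\ell=\mathsf N^\ell(\omega_z)$, $\omega_T^m=\mathsf N^m(T)$ and $\tilde\omega_T^m=\omega_T^m\cap\omega_z^\ell$. Let $\mathcal P(\omega)$ be the functions which on each $T\in\mathcal T_H$ are polynomials of coordinate degree $\le p$ and which vanish outside $\omega$, $\Pi_H$ the $L^2$-projection onto $\mathcal P(\mathcal T_H)=\mathcal P(\overline\Omega)$, and $J=(p+1)^d=\dim\mathcal P(T)$. *Local $n$-width.* With $\mathcal V_{H,z}^\ell=\operatorname{span}\{\mathcal A^{-1}_{\omega_z^\ell}q: q\in\mathcal P(\omega_z^\ell)\}$ put $$d_n(H,\ell)=\max_{z\in\mathcal N_H}\ \inf_{\substack{Q\subset H^1_0(\omega_z)\\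 \dim Q=n}}\ \sup_{0\ne v\in\mathcal V_{H,z}^\ell}\ \inf_{w\in Q}\frac{\|\Lambda_zv-w\|_{a,\omega_z}}{\|v\|_{a,\omega_z^\ell}}.$$ *Patch-local singular values and source terms.* For $z\in\mathcal N_H$ and $T\subset\omega_z^\ell$ let $Y_{z,T}$ be the space of $A$-harmonic functions $\operatorname{tr}^{-1}_{\tilde\omega_T^m}\operatorname{tr}_{\tilde\omega_T^m}\big(H^1_0(\omega_z^\ell)|_{\tilde\omega_T^m}\big)\subset H^1(\tilde\omega_T^m)$, let $K_{z,T}=J\cdot\#\{T'\in\mathcal T_H:T'\subset\tilde\omega_T^m\}$, and let $\Pi_H v=\sum_{k=1}^{K_{z,T}}\tilde\sigma_k\,(v,w_k)_{H^1(\tilde\omega_T^m)}\,q_k$ $(v\in Y_{z,T})$ be any singular value decomposition of $\Pi_H|_{Y_{z,T}}$, with $\tilde\sigma_1\ge\dots\ge\tilde\sigma_{K_{z,T}}\ge0$ and $q_1,\dots,q_{K_{z,T}}$ an $L^2$-orthonormal basis of $\mathcal P(\tilde\omega_T^m)$. The source terms are $\tilde g_{T,j}^m=q_{K_{z,T}-J+j}$,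 $j=1,\dots,J$, and $\tilde\sigma(H,\ell,m)=\max_{z\in\mathcal N_H}\max_{T\subset\omega_z^\ell}\tilde\sigma_{K_{z,T}-J+1}$. *Local Riesz stability.* For every $z\in\mathcal N_H$ the functions $\tilde g_{T,j}^m$, $T\subset\omega_z^\ell$, $j=1,\dots,J$, form a Riesz basis of $\mathcal P(\omega_z^\ell)$ with a constant $\tilde C_{\mathrm r}=\tilde C_{\mathrm r}(H,\ell,m)>0$ independent of $z$: they span it, and for all real $(c_{T,j})$ $$\tilde C_{\mathrm r}^{-1}\sum_{T\subset\omega_z^\ell,\,j}c_{T,j}^2\le\Big\|\sum_{T\subset\omega_z^\ell,\,j}c_{T,j}\tilde g_{T,j}^m\Big\|_{L^2(\omega_z^\ell)}^2\le\tilde C_{\mathrm r}\sum_{T\subset\omega_z^\ell,\,j}c_{T,j}^2 .$$ **Theorem (Bound on $d_n$).** There are a constant $C>0$ and an integer $K_0\ge1$, depending only on $d,p,\gamma,\alpha,\beta,\Omega$ (in particular independent of $H,\ell,m$), such that for all $A$, $\mathcal T_H$ as above, all $\ell$, all $m=1,\dots,\ell-1$ for which local Riesz stability holds, and all $n\ge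 K_0m^d$ (in particular for $n=K_0m^d\approx m^d$), $$d_n(H,\ell)\le C\,\ell\,m^{d/2}\,H^{-1}\,\tilde C_{\mathrm r}^{1/2}(H,\ell,m)\,\tilde\sigma(H,\ell,m).$$ -/

import Mathlib

open MeasureTheory
open scoped ENNReal

noncomputable section

namespace SLGFEM

/-- `ℝᵈ` with the Euclidean norm. -/
abbrev E (d : ℕ) : Type := EuclideanSpace ℝ (Fin d)

/-! ### Function spaces

All functions on subdomains are extended by zero to `ℝᵈ`.  An `H¹` function is stored as the pair
consisting of the function and its weak gradient. -/

/-- `L²(ℝᵈ)`. -/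
abbrev L2 (d : ℕ) : Type := Lp ℝ 2 (volume : Measure (E d))

/-- The Hilbert space `L²(ℝᵈ) × L²(ℝᵈ; ℝᵈ)` with norm `‖(u, g)‖² = ‖u‖² + ‖g‖²`.  For the pair
`(u, ∇u)` of an `H¹(ω)` function, extended by zero, this is the `H¹(ω)` norm. -/
abbrev H1Pair (d : ℕ) : Type :=
  WithLp 2 (Lp ℝ 2 (volume : Measure (E d)) × Lp (E d) 2 (volume : Measure (E d)))

/-- The pairs `(φ, ∇φ)` with `φ ∈ C_c^∞(int ω)`. -/
def testPairs {d : ℕ} (ω : Set (E d)) : Set (H1Pair d) :=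
  {u | ∃ φ : E d → ℝ, ContDiff ℝ ((⊤ : ℕ∞) : WithTop ℕ∞) φ ∧ HasCompactSupport φ ∧
    tsupport φ ⊆ interior ω ∧ u.fst =ᵐ[volume] φ ∧ u.snd =ᵐ[volume] gradient φ}

/-- `H¹₀(ω)` (that is, `H¹₀` of the interior of `ω`): the closure of the test functions in the
`H¹` norm. -/
def H10 {d : ℕ} (ω : Set (E d)) : Submodule ℝ (H1Pair d) :=
  (Submodule.span ℝ (testPairs ω)).topologicalClosure

/-- `r` is the restriction of the `H¹` function `u` to `ω` (extended by zero). -/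
def IsRestriction {d : ℕ} (ω : Set (E d)) (u r : H1Pair d) : Prop :=
  r.fst =ᵐ[volume] ω.indicator u.fst ∧ r.snd =ᵐ[volume] ω.indicator u.snd

/-! ### The elliptic problem -/

/-- `A` is (a representative of) an admissible coefficient on `Ω`: measurable, symmetric and
uniformly elliptic with constants `α`, `β`. -/
structure IsCoefficient {d : ℕ} (Ω : Set (E d)) (α β : ℝ)
    (A : E d → Matrix (Fin d) (Fin d) ℝ) : Prop where
  measurable : AEStronglyMeasurable A (volume.restrict Ω)
  symm : ∀ᵐ x ∂(volume.restrict Ω), (A x).IsSymm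
  elliptic : ∀ᵐ x ∂(volume.restrict Ω), ∀ η : E d,
    α * ‖η‖ ^ 2 ≤ inner ℝ (Matrix.toEuclideanLin (A x) η) η ∧
    inner ℝ (Matrix.toEuclideanLin (A x) η) η ≤ β * ‖η‖ ^ 2

/-- `∫_ω (A g) · h dx` for vector fields `g`, `h`; with `g = ∇u`, `h = ∇v` this is `a_ω(u, v)`. -/
def energyForm {d : ℕ} (A : E d → Matrix (Fin d) (Fin d) ℝ) (ω : Set (E d))
    (g h : E d → E d) : ℝ :=
  ∫ x in ω, inner ℝ (Matrix.toEuclideanLin (A x) (g x)) (h x)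

/-- `(∫_ω (A g) · g dx)^{1/2}`; with `g = ∇u` this is the energy norm `‖u‖_{a,ω}`. -/
def energyNorm {d : ℕ} (A : E d → Matrix (Fin d) (Fin d) ℝ) (ω : Set (E d))
    (g : E d → E d) : ℝ :=
  √(energyForm A ω g g)

/-- `u = 𝒜_ω⁻¹ f`: `u` is the weak solution in `H¹₀(ω)` with source term `f`. -/
def IsSolution {d : ℕ} (A : E d → Matrix (Fin d) (Fin d) ℝ) (ω : Set (E d))
    (f : L2 d) (u : H1Pair d) : Prop :=
  u ∈ H10 ω ∧ ∀ v ∈ H10 ω, energyForm A ω u.snd v.snd = ∫ x in ω, f x * v.fst x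

/-- `y = tr⁻¹ tr r` is the `A`-harmonic function on `ω` with the same trace on `∂ω` as `r`
(functions in `H¹(ω)` have the same trace iff they differ by an element of `H¹₀(ω)`). -/
def IsHarmonicExtension {d : ℕ} (A : E d → Matrix (Fin d) (Fin d) ℝ) (ω : Set (E d))
    (r y : H1Pair d) : Prop :=
  y - r ∈ H10 ω ∧ ∀ v ∈ H10 ω, energyForm A ω y.snd v.snd = 0

/-- The space `tr_ω⁻¹ tr_ω (H¹₀(D)|_ω)` of `A`-harmonic functions on `ω`. -/
def harmonicSpace {d : ℕ} (A : E d → Matrix (Fin d) (Fin d) ℝ) (D ω : Set (E d)) :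
    Set (H1Pair d) :=
  {y | ∃ u ∈ H10 D, ∃ r, IsRestriction ω u r ∧ IsHarmonicExtension A ω r y}

/-! ### Quadrilateral (hexahedral) meshes -/

/-- The reference element `[0,1]ᵈ`. -/
def refCube (d : ℕ) : Set (E d) := {y | ∀ i, y i ∈ Set.Icc (0 : ℝ) 1}

/-- The multilinear nodal function on `[0,1]ᵈ` of the vertex `v ∈ {0,1}ᵈ`. -/
def refShape {d : ℕ} (v : Fin d → Bool) (y : E d) : ℝ :=
  ∏ i, if v i then y i else 1 - y i

/-- The multilinear map taking the vertices of `[0,1]ᵈ` to the prescribed points. -/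
def multilinearMap {d : ℕ} (vert : (Fin d → Bool) → E d) (y : E d) : E d :=
  ∑ v, refShape v y • vert v

/-- Coordinate of `F(y)` with respect to the vertex `z`, where `F = multilinearMap vert`: the
multilinear function of `y` that is `1` at the vertices mapped to `z` and `0` at the others. -/
def nodalCoord {d : ℕ} (vert : (Fin d → Bool) → E d) (z y : E d) : ℝ :=
  open Classical in ∑ v, if vert v = z then refShape v y else 0

/-- A finite conforming mesh of `Ω` by closed quadrilaterals (hexahedra for `d = 3`), each being
the image of `[0,1]ᵈ` under an injective multilinear map. -/
structure QuadMesh (d : ℕ) (Ω : Set (E d)) where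
  /-- number of elements -/
  N : ℕ
  /-- the vertices of the elements -/
  vert : Fin N → (Fin d → Bool) → E d
  injOn : ∀ T, Set.InjOn (multilinearMap (vert T)) (refCube d)
  cover : ⋃ T, multilinearMap (vert T) '' refCube d = closure Ω
  disjoint : ∀ T T', T ≠ T' → Disjoint (interior (multilinearMap (vert T) '' refCube d))
    (interior (multilinearMap (vert T') '' refCube d))
  /-- No hanging nodes: a point common to two elements has the same coordinates with respect to
  the mesh vertices in both of them, so elements only meet in common vertices, edges, faces. -/
  conforming : ∀ T T', ∀ y ∈ refCube d, ∀ y' ∈ refCube d,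
    multilinearMap (vert T) y = multilinearMap (vert T') y' →
    ∀ z, nodalCoord (vert T) z y = nodalCoord (vert T') z y'

namespace QuadMesh

variable {d : ℕ} {Ω : Set (E d)} (M : QuadMesh d Ω)

/-- The element `T` as a closed set. -/
def elem (T : Fin M.N) : Set (E d) := multilinearMap (M.vert T) '' refCube d

/-- The mesh size `H`, the maximal element diameter. -/
def meshSize : ℝ := ⨆ T, Metric.diam (M.elem T)

/-- Shape regularity with constant `γ`: after scaling by the element diameters, the inverses of the
element maps are Lipschitz with constant `γ`.  (The element maps themselves, scaled in the same
way, are always Lipschitz with a constant depending only on `d`.) -/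
def ShapeRegular (γ : ℝ) : Prop :=
  ∀ T, ∀ x ∈ refCube d, ∀ y ∈ refCube d, Metric.diam (M.elem T) * dist x y ≤
    γ * dist (multilinearMap (M.vert T) x) (multilinearMap (M.vert T) y)

/-- Quasi-uniformity with constant `γ`: all element diameters are comparable to `H`. -/
def QuasiUniform (γ : ℝ) : Prop := ∀ T, M.meshSize ≤ γ * Metric.diam (M.elem T)

/-- The set `𝒩_H` of all (interior and boundary) vertices of the mesh. -/
def nodes : Set (E d) := {z | ∃ T v, M.vert T v = z}

/-- The hat function `Λ_z`: on each element it is the (mapped) multilinear function with nodal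
values `δ_{yz}`.  By conformity it does not depend on the choice of the element containing `x`.
It is extended by zero outside the closure of `Ω`. -/
def hat (z x : E d) : ℝ :=
  open Classical in
  if h : ∃ q : Fin M.N × E d, q.2 ∈ refCube d ∧ multilinearMap (M.vert q.1) q.2 = x then
    nodalCoord (M.vert h.choose.1) z h.choose.2
  else 0

/-- The `k`-th order patch `N^k(ω)`. -/
def patch : ℕ → Set (E d) → Set (E d)
  | 0, ω => ω
  | k + 1, ω => ⋃ T ∈ {T | (M.elem T ∩ patch k ω).Nonempty}, M.elem T

/-- `ω_z = supp Λ_z`. -/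
def nodeSupp (z : E d) : Set (E d) := tsupport (M.hat z)

/-- The node patch `ω_z^ℓ = N^ℓ(ω_z)`. -/
def nodePatch (ℓ : ℕ) (z : E d) : Set (E d) := M.patch ℓ (M.nodeSupp z)

/-- `ω̃_T^m = ω_T^m ∩ ω_z^ℓ` with the element patch `ω_T^m = N^m(T)`. -/
def localPatch (ℓ m : ℕ) (z : E d) (T : Fin M.N) : Set (E d) :=
  M.patch m (M.elem T) ∩ M.nodePatch ℓ z

/-- The elements contained in `ω`. -/
def elemsIn (ω : Set (E d)) : Finset (Fin M.N) :=
  open Classical in Finset.univ.filter fun T => M.elem T ⊆ ω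

/-- `𝒫(ω)`: the functions that are polynomials of coordinate degree at most `p` on each element and
vanish outside `ω`. -/
def polySpace (p : ℕ) (ω : Set (E d)) : Set (L2 d) :=
  {q | (∀ T, ∃ P : MvPolynomial (Fin d) ℝ, (∀ i, P.degreeOf i ≤ p) ∧
      q =ᵐ[volume.restrict (M.elem T)] fun x => MvPolynomial.eval (fun i => x i) P) ∧
    q =ᵐ[volume.restrict ωᶜ] 0}

/-- `w = Π_H v`: `w` is the `L²`-orthogonal projection of `v` onto `𝒫(𝒯_H)`. -/
def IsL2Projection (p : ℕ) (v w : L2 d) : Prop :=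
  w ∈ M.polySpace p (closure Ω) ∧ ∀ r ∈ M.polySpace p (closure Ω), inner ℝ w r = inner ℝ v r

/-! ### Local approximation spaces and widths -/

/-- `𝒱_{H,z}^ℓ = span {𝒜_{ω_z^ℓ}⁻¹ q : q ∈ 𝒫(ω_z^ℓ)}`. -/
def localSpace (A : E d → Matrix (Fin d) (Fin d) ℝ) (p ℓ : ℕ) (z : E d) :
    Submodule ℝ (H1Pair d) :=
  Submodule.span ℝ {u | ∃ q ∈ M.polySpace p (M.nodePatch ℓ z), IsSolution A (M.nodePatch ℓ z) q u}

/-- The weak gradient `Λ_z ∇v + v ∇Λ_z` of `Λ_z v`. -/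
def hatMulGrad (z : E d) (v : H1Pair d) (x : E d) : E d :=
  M.hat z x • v.snd x + v.fst x • gradient (M.hat z) x

/-- The local Kolmogorov width `d_n^z(H,ℓ)`: infimum over the `n`-dimensional subspaces
`Q ⊆ H¹₀(ω_z)`, supremum over `0 ≠ v ∈ 𝒱_{H,z}^ℓ`, infimum over `w ∈ Q` of
`‖Λ_z v - w‖_{a,ω_z} / ‖v‖_{a,ω_z^ℓ}`. -/
def localWidth (A : E d → Matrix (Fin d) (Fin d) ℝ) (p n ℓ : ℕ) (z : E d) : ℝ≥0∞ :=
  ⨅ (Q : Submodule ℝ (H1Pair d)) (_ : Q ≤ H10 (M.nodeSupp z) ∧ FiniteDimensional ℝ Q ∧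
      Module.finrank ℝ Q = n),
    ⨆ (v : H1Pair d) (_ : v ∈ M.localSpace A p ℓ z ∧ v ≠ 0),
      ⨅ (w : H1Pair d) (_ : w ∈ Q),
        ENNReal.ofReal (energyNorm A (M.nodeSupp z) (fun x => M.hatMulGrad z v x - w.snd x) /
          energyNorm A (M.nodePatch ℓ z) v.snd)

/-- `d_n(H,ℓ)`, the maximum of the local widths over all nodes. -/
def width (A : E d → Matrix (Fin d) (Fin d) ℝ) (p n ℓ : ℕ) : ℝ≥0∞ :=
  ⨆ z ∈ M.nodes, M.localWidth A p n ℓ z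

/-! ### Patch-local singular values and source terms -/

/-- `J = dim 𝒫(T)`, the dimension of the polynomials in `d` variables of coordinate degree at most
`p`. -/
def polyDim (d p : ℕ) : ℕ := (p + 1) ^ d

/-- `K = J · #{T' : T' ⊆ ω̃_T^m}`. -/
def svdRank (p ℓ m : ℕ) (z : E d) (T : Fin M.N) : ℕ :=
  polyDim d p * (M.elemsIn (M.localPatch ℓ m z T)).card

/-- `(σ_k, q_k, w_k)`, `k < K`, is a singular value decomposition
`Π_H v = ∑_k σ_k (v, w_k)_{H¹(ω)} q_k` of `Π_H` restricted to the space
`Y = tr_ω⁻¹ tr_ω (H¹₀(ω_z^ℓ)|_ω)` of harmonic functions, where `ω = ω̃_T^m`.  The indices run from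
`0` to `K - 1`, the singular values decrease, the left singular vectors `q_k` form an orthonormal
basis of `𝒫(ω)`.  The right singular vectors are orthonormal vectors in the (Hilbert space closure
of) `Y`; those that belong to vanishing singular values play no role and are left free, since `Y`
may have dimension less than `K`. -/
structure IsLocalSVD (A : E d → Matrix (Fin d) (Fin d) ℝ) (p ℓ m : ℕ) (z : E d) (T : Fin M.N)
    (σ : ℕ → ℝ) (q : ℕ → L2 d) (w : ℕ → H1Pair d) : Prop where
  nonneg : ∀ k < M.svdRank p ℓ m z T, 0 ≤ σ k
  antitone : ∀ i j, i ≤ j → j < M.svdRank p ℓ m z T → σ j ≤ σ i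
  left_mem : ∀ k < M.svdRank p ℓ m z T, q k ∈ M.polySpace p (M.localPatch ℓ m z T)
  left_orthonormal : ∀ i < M.svdRank p ℓ m z T, ∀ j < M.svdRank p ℓ m z T,
    inner ℝ (q i) (q j) = if i = j then 1 else 0
  right_mem : ∀ k < M.svdRank p ℓ m z T, σ k ≠ 0 →
    w k ∈ closure (harmonicSpace A (M.nodePatch ℓ z) (M.localPatch ℓ m z T))
  right_orthonormal : ∀ i < M.svdRank p ℓ m z T, ∀ j < M.svdRank p ℓ m z T, σ i ≠ 0 → σ j ≠ 0 →
    inner ℝ (w i) (w j) = if i = j then 1 else 0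
  expansion : ∀ v ∈ harmonicSpace A (M.nodePatch ℓ z) (M.localPatch ℓ m z T),
    M.IsL2Projection p v.fst
      (∑ k ∈ Finset.range (M.svdRank p ℓ m z T), (σ k * inner ℝ v (w k)) • q k)

/-- The source terms `g̃_{T,j}^m`, `j < J`: the left singular vectors that belong to the `J` smallest
singular values. -/
def sourceTerm (p ℓ m : ℕ) (z : E d) (T : Fin M.N) (q : ℕ → L2 d) (j : ℕ) : L2 d :=
  q (M.svdRank p ℓ m z T - polyDim d p + j)

/-- `σ̃(H,ℓ,m)`: the maximum, over the nodes `z` and the elements `T ⊆ ω_z^ℓ`, of the `J`-th smallest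
singular value `σ̃_{K-J+1}` (which has index `K - J` when counting from `0`). -/
def sigmaTilde (p ℓ m : ℕ) (σ : E d → Fin M.N → ℕ → ℝ) : ℝ :=
  sSup {s | ∃ z ∈ M.nodes, ∃ T ∈ M.elemsIn (M.nodePatch ℓ z),
    s = σ z T (M.svdRank p ℓ m z T - polyDim d p)}

/-- Local Riesz stability with constant `Cr`: for every node `z`, the source terms
`{g̃_{T,j}^m : T ⊆ ω_z^ℓ, j < J}` are a Riesz basis of `𝒫(ω_z^ℓ)`. -/
def LocalRieszStable (p ℓ m : ℕ) (q : E d → Fin M.N → ℕ → L2 d) (Cr : ℝ) : Prop :=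
  ∀ z ∈ M.nodes,
    (Submodule.span ℝ {g | ∃ T ∈ M.elemsIn (M.nodePatch ℓ z), ∃ j < polyDim d p,
        g = M.sourceTerm p ℓ m z T (q z T) j} : Set (L2 d)) = M.polySpace p (M.nodePatch ℓ z) ∧
    ∀ c : Fin M.N → ℕ → ℝ,
      Cr⁻¹ * ∑ T ∈ M.elemsIn (M.nodePatch ℓ z), ∑ j ∈ Finset.range (polyDim d p), c T j ^ 2 ≤
        ‖∑ T ∈ M.elemsIn (M.nodePatch ℓ z), ∑ j ∈ Finset.range (polyDim d p),
          c T j • M.sourceTerm p ℓ m z T (q z T) j‖ ^ 2 ∧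
      ‖∑ T ∈ M.elemsIn (M.nodePatch ℓ z), ∑ j ∈ Finset.range (polyDim d p),
          c T j • M.sourceTerm p ℓ m z T (q z T) j‖ ^ 2 ≤
        Cr * ∑ T ∈ M.elemsIn (M.nodePatch ℓ z), ∑ j ∈ Finset.range (polyDim d p), c T j ^ 2

end QuadMesh

end SLGFEM

end

noncomputable section

namespace SLGFEM

open Filter Topology

variable {d : ℕ}

/-! ### Pairs of `L²` functions -/

/-! Write D for the node patch of order ℓ around z. By Riesz stability every v in the local space
solves the problem on D with a source f = ∑ c_{T,j} g_{T,j}. Solving instead with each g_{T,j} on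
the small patch of T gives local responses φ_{T,j}, and e = v - ∑ c_{T,j} φ_{T,j} is the
localization error. The competitor for Λ_z v is Λ_z ∑ c_{T,j} φ_{T,j}. Only the T whose patch meets
the support of Λ_z contribute to it; a packing argument bounds their number by a constant times m^d,
with J responses for each, so a space of dimension of order m^d suffices.

The error is tested with itself. Let y_T be the harmonic function on the patch of T with the trace
of e. Then a(φ_{T,j}, e) = (g_{T,j}, e) - (g_{T,j}, y_T) by `energyForm_localized`. Summed up, the
terms (g_{T,j}, e) cancel against a(v, e) = (f, e), and a(e, e) = ∑ c_{T,j} (g_{T,j}, y_T) remains.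
Since g_{T,j} is one of the last J left singular vectors of the projection on the space containing
y_T, this pairing is at most the J-th smallest singular value times the norm of y_T
(`IsLocalSVD.abs_inner_le`). Stability of harmonic extension, the Cauchy–Schwarz inequality and the
overlap of order m^d of the patches bound ‖∇e‖ by a constant times σ̃ m^{d/2} |c|
(`localization_error_le`).

Riesz stability bounds |c| by Cr^{1/2} ‖f‖, and the inverse estimate `exists_inverse_estimate`
bounds ‖f‖ by a constant times H⁻¹ ‖∇v‖. Passing from e to Λ_z e costs a factor 1/H on e itself,
which Friedrichs' inequality on D, of radius at most (ℓ + 1) H, turns into the factor ℓ.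
`localWidth_le` puts these estimates together.

Two supporting facts need real analysis: multiplication by Λ_z maps H¹₀(D) into H¹₀(ω_z)
(`exists_hatMul`, through Lipschitz functions and weak limits), and the constants depend on the mesh
only through γ (expanding element maps, packing of inscribed balls, scaling of polynomials). -/

lemma exists_pair {f : E d → ℝ} {g : E d → E d} (hf : MemLp f 2 volume) (hg : MemLp g 2 volume) :
    ∃ u : H1Pair d, u.fst =ᵐ[volume] f ∧ u.snd =ᵐ[volume] g :=
  ⟨WithLp.toLp 2 (hf.toLp f, hg.toLp g), hf.coeFn_toLp, hg.coeFn_toLp⟩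

lemma pair_ext {u v : H1Pair d} (h1 : u.fst =ᵐ[volume] v.fst) (h2 : u.snd =ᵐ[volume] v.snd) :
    u = v := by
  have h1' : u.fst = v.fst := Lp.ext h1
  have h2' : u.snd = v.snd := Lp.ext h2
  apply WithLp.ofLp_injective
  exact Prod.ext h1' h2'

lemma norm_snd_le (u : H1Pair d) : ‖u.snd‖ ≤ ‖u‖ := by
  have := WithLp.prod_norm_sq_eq_of_L2 u
  exact abs_le_of_sq_le_sq' (by nlinarith [sq_nonneg ‖u.fst‖]) (norm_nonneg _) |>.2

lemma norm_pair_le (u : H1Pair d) : ‖u‖ ≤ ‖u.fst‖ + ‖u.snd‖ := by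
  have := WithLp.prod_norm_sq_eq_of_L2 u
  refine abs_le_of_sq_le_sq' ?_ (by positivity) |>.2
  nlinarith [norm_nonneg u.fst, norm_nonneg u.snd]

lemma ae_pair_add (u v : H1Pair d) : (∀ᵐ x, (u + v).fst x = u.fst x + v.fst x) ∧
    ∀ᵐ x, (u + v).snd x = u.snd x + v.snd x :=
  ⟨Lp.coeFn_add u.fst v.fst, Lp.coeFn_add u.snd v.snd⟩

lemma ae_pair_sub (u v : H1Pair d) : (∀ᵐ x, (u - v).fst x = u.fst x - v.fst x) ∧
    ∀ᵐ x, (u - v).snd x = u.snd x - v.snd x :=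
  ⟨Lp.coeFn_sub u.fst v.fst, Lp.coeFn_sub u.snd v.snd⟩

lemma ae_pair_smul (c : ℝ) (u : H1Pair d) : (∀ᵐ x, (c • u).fst x = c * u.fst x) ∧
    ∀ᵐ x, (c • u).snd x = c • u.snd x :=
  ⟨Lp.coeFn_smul c u.fst, Lp.coeFn_smul c u.snd⟩

lemma ae_pair_zero : (∀ᵐ x, (0 : H1Pair d).fst x = 0) ∧ ∀ᵐ x, (0 : H1Pair d).snd x = 0 :=
  ⟨Lp.coeFn_zero ℝ 2 volume, Lp.coeFn_zero (E d) 2 volume⟩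

/-! ### Multiplication of pairs by bounded functions -/

/-- Multiplication by a bounded function. -/
def mulLp {F : Type*} [NormedAddCommGroup F] [NormedSpace ℝ F]
    (f : Lp ℝ ∞ (volume : Measure (E d))) :
    Lp F 2 (volume : Measure (E d)) →L[ℝ] Lp F 2 (volume : Measure (E d)) :=
  (ContinuousLinearMap.lsmul ℝ ℝ).holderL volume ∞ 2 2 f

lemma coeFn_mulLp {F : Type*} [NormedAddCommGroup F] [NormedSpace ℝ F]
    (f : Lp ℝ ∞ (volume : Measure (E d))) (u : Lp F 2 (volume : Measure (E d))) :
    mulLp f u =ᵐ[volume] fun x => f x • u x := by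
  simpa [mulLp] using (ContinuousLinearMap.lsmul ℝ ℝ).coeFn_holder (r := 2) f u

/-- Multiplication of a scalar `L²` function by a bounded vector field. -/
def mulVecLp (G : Lp (E d) ∞ (volume : Measure (E d))) :
    L2 d →L[ℝ] Lp (E d) 2 (volume : Measure (E d)) :=
  (ContinuousLinearMap.lsmul ℝ ℝ).flip.holderL volume ∞ 2 2 G

lemma coeFn_mulVecLp (G : Lp (E d) ∞ (volume : Measure (E d))) (u : L2 d) :
    mulVecLp G u =ᵐ[volume] fun x => u x • G x := by
  simpa [mulVecLp] using (ContinuousLinearMap.lsmul ℝ ℝ).flip.coeFn_holder (r := 2) G u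

/-- The map `(u, g) ↦ (Λ u, Λ g + u G)`. -/
def mulPair (Λ : Lp ℝ ∞ (volume : Measure (E d))) (G : Lp (E d) ∞ (volume : Measure (E d))) :
    H1Pair d →L[ℝ] H1Pair d :=
  (WithLp.prodContinuousLinearEquiv 2 ℝ (L2 d)
      (Lp (E d) 2 (volume : Measure (E d)))).symm.toContinuousLinearMap ∘L
    ((mulLp Λ ∘L WithLp.fstL 2 ℝ _ _).prod
      (mulLp Λ ∘L WithLp.sndL 2 ℝ _ _ + mulVecLp G ∘L WithLp.fstL 2 ℝ _ _))

lemma mulPair_fst (Λ : Lp ℝ ∞ (volume : Measure (E d)))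
    (G : Lp (E d) ∞ (volume : Measure (E d))) (u : H1Pair d) :
    ∀ᵐ x, (mulPair Λ G u).fst x = Λ x * u.fst x :=
  coeFn_mulLp Λ u.fst

lemma mulPair_snd (Λ : Lp ℝ ∞ (volume : Measure (E d)))
    (G : Lp (E d) ∞ (volume : Measure (E d))) (u : H1Pair d) :
    ∀ᵐ x, (mulPair Λ G u).snd x = Λ x • u.snd x + u.fst x • G x := by
  have h : (mulPair Λ G u).snd = mulLp Λ u.snd + mulVecLp G u.fst := rfl
  rw [h]
  filter_upwards [Lp.coeFn_add (mulLp Λ u.snd) (mulVecLp G u.fst), coeFn_mulLp Λ u.snd,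
    coeFn_mulVecLp G u.fst] with x h1 h2 h3
  rw [h1, Pi.add_apply, h2, h3]

open Classical in
/-- The indicator function of `ω` (if `ω` is measurable). -/
def indLp (ω : Set (E d)) : Lp ℝ ∞ (volume : Measure (E d)) :=
  if h : MeasurableSet ω then
    (memLp_top_of_bound (f := ω.indicator fun _ => (1 : ℝ))
      ((measurable_const.indicator h).aestronglyMeasurable) 1 (Eventually.of_forall fun x => by
        by_cases hx : x ∈ ω <;> simp [hx])).toLp _
  else 0

lemma coeFn_indLp {ω : Set (E d)} (h : MeasurableSet ω) :
    indLp ω =ᵐ[volume] ω.indicator fun _ => (1 : ℝ) := by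
  rw [indLp, dif_pos h]
  exact MemLp.coeFn_toLp _

/-- Restriction of a pair to `ω`, extended by zero. -/
def restrictPair (ω : Set (E d)) : H1Pair d →L[ℝ] H1Pair d := mulPair (indLp ω) 0

lemma restrictPair_spec {ω : Set (E d)} (h : MeasurableSet ω) (u : H1Pair d) :
    IsRestriction ω u (restrictPair ω u) := by
  constructor
  · filter_upwards [mulPair_fst (indLp ω) 0 u, coeFn_indLp h] with x h1 h2
    rw [restrictPair, h1, h2]
    by_cases hx : x ∈ ω <;> simp [hx]
  · filter_upwards [mulPair_snd (indLp ω) 0 u, coeFn_indLp h, Lp.coeFn_zero (E d) ∞ volume]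
      with x h1 h2 h3
    rw [restrictPair, h1, h2, h3]
    by_cases hx : x ∈ ω <;> simp [hx]

/-- Vanishing outside ω becomes a fixed-point equation of a continuous map, hence a closed condition
that passes from test functions to their closure. -/
lemma restrictPair_eq_self_iff {ω : Set (E d)} (h : MeasurableSet ω) (u : H1Pair d) :
    restrictPair ω u = u ↔ ∀ᵐ x, x ∉ ω → u.fst x = 0 ∧ u.snd x = 0 := by
  obtain ⟨h1, h2⟩ := restrictPair_spec h u
  constructor
  · intro he
    rw [he] at h1 h2
    filter_upwards [h1, h2] with x hx1 hx2 hx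
    rw [hx1, hx2]
    simp [hx]
  · intro he
    apply pair_ext
    · filter_upwards [h1, he] with x hx1 hx
      rw [hx1]
      by_cases hxω : x ∈ ω
      · simp [hxω]
      · simp [hxω, hx hxω]
    · filter_upwards [h2, he] with x hx1 hx
      rw [hx1]
      by_cases hxω : x ∈ ω
      · simp [hxω]
      · simp [hxω, hx hxω]

/-! ### Test functions and `H¹₀` -/

lemma gradient_eq_zero_of_notMem_tsupport {φ : E d → ℝ} {x : E d} (hx : x ∉ tsupport φ) :
    gradient φ x = 0 := by
  have : fderiv ℝ φ x = 0 := by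
    by_contra h
    exact hx (support_fderiv_subset ℝ h)
  simp [gradient, this]

lemma continuous_gradient {φ : E d → ℝ} (h : ContDiff ℝ 1 φ) : Continuous (gradient φ) :=
  (InnerProductSpace.toDual ℝ (E d)).symm.continuous.comp (h.continuous_fderiv one_ne_zero)

lemma hasCompactSupport_gradient {φ : E d → ℝ} (h : HasCompactSupport φ) :
    HasCompactSupport (gradient φ) :=
  HasCompactSupport.intro h fun _ hx => gradient_eq_zero_of_notMem_tsupport hx

lemma norm_gradient (φ : E d → ℝ) (x : E d) : ‖gradient φ x‖ = ‖fderiv ℝ φ x‖ := by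
  simp [gradient]

lemma gradient_add {f g : E d → ℝ} {x : E d} (hf : DifferentiableAt ℝ f x)
    (hg : DifferentiableAt ℝ g x) :
    gradient (f + g) x = gradient f x + gradient g x := by
  simp only [gradient]
  rw [fderiv_add hf hg, map_add]

lemma gradient_const_smul (c : ℝ) {f : E d → ℝ} {x : E d} (hf : DifferentiableAt ℝ f x) :
    gradient (c • f) x = c • gradient f x := by
  simp only [gradient]
  rw [fderiv_const_smul hf, map_smul]

lemma gradient_mul {f g : E d → ℝ} {x : E d} (hf : DifferentiableAt ℝ f x)
    (hg : DifferentiableAt ℝ g x) :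
    gradient (fun x => f x * g x) x = f x • gradient g x + g x • gradient f x := by
  simp only [gradient]
  rw [fderiv_fun_mul hf hg, map_add, map_smul, map_smul]

lemma inner_gradient {f : E d → ℝ} (x v : E d) :
    inner ℝ (gradient f x) v = fderiv ℝ f x v := by
  simp [gradient]

lemma testFunction_memLp {φ : E d → ℝ} (h1 : ContDiff ℝ ((⊤ : ℕ∞) : WithTop ℕ∞) φ)
    (h2 : HasCompactSupport φ) : MemLp φ 2 volume ∧ MemLp (gradient φ) 2 volume :=
  ⟨h1.continuous.memLp_of_hasCompactSupport h2,
    (continuous_gradient (h1.of_le (by exact_mod_cast le_top))).memLp_of_hasCompactSupport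
      (hasCompactSupport_gradient h2)⟩

lemma exists_testPair {ω : Set (E d)} {φ : E d → ℝ} (h1 : ContDiff ℝ ((⊤ : ℕ∞) : WithTop ℕ∞) φ)
    (h2 : HasCompactSupport φ) (h3 : tsupport φ ⊆ interior ω) :
    ∃ u ∈ testPairs ω, u.fst =ᵐ[volume] φ ∧ u.snd =ᵐ[volume] gradient φ := by
  obtain ⟨u, hu1, hu2⟩ := exists_pair (testFunction_memLp h1 h2).1 (testFunction_memLp h1 h2).2
  exact ⟨u, ⟨φ, h1, h2, h3, hu1, hu2⟩, hu1, hu2⟩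

/-- Test pairs are stable under linear combinations, so H¹₀ is the closure of a plain set, and
closed properties need to be checked on single test functions only. -/
lemma span_testPairs (ω : Set (E d)) :
    (Submodule.span ℝ (testPairs ω) : Set (H1Pair d)) = testPairs ω := by
  let S : Submodule ℝ (H1Pair d) :=
    { carrier := testPairs ω
      add_mem' := by
        rintro u v ⟨φ, a1, a2, a3, a4, a5⟩ ⟨ψ, b1, b2, b3, b4, b5⟩
        refine ⟨φ + ψ, a1.add b1, a2.add b2, ?_, ?_, ?_⟩
        · exact (tsupport_add φ ψ).trans (Set.union_subset a3 b3)
        · filter_upwards [(ae_pair_add u v).1, a4, b4] with x h1 h2 h3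
          rw [h1, h2, h3, Pi.add_apply]
        · filter_upwards [(ae_pair_add u v).2, a5, b5] with x h1 h2 h3
          rw [h1, h2, h3, gradient_add (a1.differentiable (by simp) x)
            (b1.differentiable (by simp) x)]
      zero_mem' := by
        refine ⟨0, contDiff_const, HasCompactSupport.zero, by simp, ?_, ?_⟩
        · filter_upwards [ae_pair_zero.1] with x h1
          rw [h1, Pi.zero_apply]
        · filter_upwards [ae_pair_zero.2] with x h1
          rw [h1]
          simp [gradient]
      smul_mem' := by
        rintro c u ⟨φ, a1, a2, a3, a4, a5⟩
        refine ⟨c • φ, contDiff_const.smul a1, a2.smul_left (f := fun _ => c),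
          (closure_mono (Function.support_const_smul_subset c φ)).trans a3, ?_, ?_⟩
        · filter_upwards [(ae_pair_smul c u).1, a4] with x h1 h2
          rw [h1, h2, Pi.smul_apply, smul_eq_mul]
        · filter_upwards [(ae_pair_smul c u).2, a5] with x h1 h2
          rw [h1, h2, gradient_const_smul c (a1.differentiable (by simp) x)] }
  have : Submodule.span ℝ (testPairs ω) = S :=
    (Submodule.span_eq S : Submodule.span ℝ (S : Set (H1Pair d)) = S)
  rw [this]
  rfl

lemma coe_H10 (ω : Set (E d)) : (H10 ω : Set (H1Pair d)) = closure (testPairs ω) := by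
  rw [H10, Submodule.topologicalClosure_coe, span_testPairs]

lemma isClosed_H10 (ω : Set (E d)) : IsClosed (H10 ω : Set (H1Pair d)) :=
  Submodule.isClosed_topologicalClosure _

instance (ω : Set (E d)) : CompleteSpace (H10 ω) := (isClosed_H10 ω).completeSpace_coe

lemma testPairs_subset_H10 (ω : Set (E d)) : testPairs ω ⊆ H10 ω := by
  rw [coe_H10]; exact subset_closure

lemma H10_subset_of_isClosed {ω : Set (E d)} {S : Set (H1Pair d)} (hS : IsClosed S)
    (h : testPairs ω ⊆ S) : (H10 ω : Set (H1Pair d)) ⊆ S := by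
  rw [coe_H10]; exact closure_minimal h hS

lemma H10_mono {ω ω' : Set (E d)} (h : ω ⊆ ω') : H10 ω ≤ H10 ω' := by
  refine H10_subset_of_isClosed (isClosed_H10 ω') (Set.Subset.trans ?_ (testPairs_subset_H10 ω'))
  rintro u ⟨φ, h1, h2, h3, h4⟩
  exact ⟨φ, h1, h2, h3.trans (interior_mono h), h4⟩

lemma ae_eq_zero_of_mem_H10 {ω : Set (E d)} {u : H1Pair d} (hu : u ∈ H10 ω) :
    ∀ᵐ x, x ∉ interior ω → u.fst x = 0 ∧ u.snd x = 0 := by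
  rw [← restrictPair_eq_self_iff isOpen_interior.measurableSet]
  refine H10_subset_of_isClosed (S := {u | restrictPair (interior ω) u = u})
    (isClosed_eq (restrictPair (interior ω)).continuous continuous_id) ?_ hu
  rintro v ⟨φ, -, -, h3, h4, h5⟩
  simp only [Set.mem_ofPred_eq]
  rw [restrictPair_eq_self_iff isOpen_interior.measurableSet]
  filter_upwards [h4, h5] with x h6 h7 hx
  have hx' : x ∉ tsupport φ := fun h => hx (h3 h)
  exact ⟨h6.trans (image_eq_zero_of_notMem_tsupport hx'),
    h7.trans (gradient_eq_zero_of_notMem_tsupport hx')⟩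

/-- Friedrichs' inequality. -/
lemma friedrichs (hd : 0 < d) {ω : Set (E d)} {c : E d} {R : ℝ} (hω : ω ⊆ Metric.closedBall c R)
    {u : H1Pair d} (hu : u ∈ H10 ω) : ‖u.fst‖ ≤ 2 * R * ‖u.snd‖ := by
  refine H10_subset_of_isClosed (S := {u : H1Pair d | ‖u.fst‖ ≤ 2 * R * ‖u.snd‖})
    (isClosed_le (WithLp.fstL 2 ℝ _ _).continuous.norm
      (continuous_const.mul (WithLp.sndL 2 ℝ _ _).continuous.norm)) ?_ hu
  rintro u ⟨φ, h1, h2, h3, h4, h5⟩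
  simp only [Set.mem_ofPred_eq]
  let i : Fin d := ⟨0, hd⟩
  let e : E d := EuclideanSpace.single i 1
  let g : E d → ℝ := fun x => x i - c i
  have hgd : ∀ x, HasFDerivAt g (EuclideanSpace.proj i : E d →L[ℝ] ℝ) x := fun x =>
    ((EuclideanSpace.proj i : E d →L[ℝ] ℝ).hasFDerivAt).sub_const _
  have hgc : Continuous g := by fun_prop
  have hφd : Differentiable ℝ φ := h1.differentiable (by simp)
  have hφ' : Continuous fun x => fderiv ℝ φ x e :=
    (h1.continuous_fderiv (by simp)).clm_apply continuous_const
  have hsupp : ∀ x, φ x ≠ 0 → ‖g x‖ ≤ R := by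
    intro x hx
    have hx1 : x ∈ Metric.closedBall c R :=
      hω (interior_subset (h3 (subset_tsupport φ hx)))
    rw [mem_closedBall_iff_norm] at hx1
    exact (PiLp.norm_apply_le (x - c) i).trans hx1
  have hd2 : ∀ x, fderiv ℝ (fun x => φ x * φ x) x e = 2 * (φ x * fderiv ℝ φ x e) := by
    intro x
    rw [fderiv_fun_mul (hφd x) (hφd x)]
    simp only [add_apply, smul_apply, smul_eq_mul]
    ring
  -- The factor x_i - c_i is bounded by R only where φ ≠ 0. Replacing it by 0 elsewhere does not
  -- change products with φ.
  have hpt : ∀ x, ‖(if φ x = 0 then 0 else g x) * fderiv ℝ φ x e‖ ≤ R * ‖gradient φ x‖ := by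
    intro x
    rw [norm_mul, norm_gradient]
    have h6 : ‖fderiv ℝ φ x e‖ ≤ ‖fderiv ℝ φ x‖ := by
      simpa [e] using (fderiv ℝ φ x).le_opNorm e
    by_cases hx : φ x = 0
    · simp only [hx, if_true, norm_zero, zero_mul]
      by_cases hx2 : x ∈ tsupport φ
      · have := Metric.nonempty_closedBall.1 ⟨x, hω (interior_subset (h3 hx2))⟩
        positivity
      · have : fderiv ℝ φ x = 0 := by
          by_contra h
          exact hx2 (support_fderiv_subset ℝ h)
        simp [this]
    · simp only [hx, if_false]
      exact mul_le_mul (hsupp x hx) h6 (norm_nonneg _) ((norm_nonneg _).trans (hsupp x hx))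
  have hb2 : MemLp (fun x => (if φ x = 0 then 0 else g x) * fderiv ℝ φ x e) 2 volume :=
    MemLp.of_le_mul (c := R) (testFunction_memLp h1 h2).2
      ((Measurable.ite (h1.continuous.measurable (measurableSet_singleton 0))
        measurable_const hgc.measurable).mul hφ'.measurable).aestronglyMeasurable
      (Eventually.of_forall hpt)
  let b : L2 d := hb2.toLp _
  have hbn : ‖b‖ ≤ R * ‖u.snd‖ := by
    refine Lp.norm_le_mul_norm_of_ae_le_mul ?_
    filter_upwards [hb2.coeFn_toLp, h5] with x h6 h7
    rw [h6, h7]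
    exact hpt x
  -- Since ∂_i (x_i - c_i) = 1, integration by parts gives ∫ φ² = -2 ∫ φ (x_i - c_i) ∂_i φ.
  have key : inner ℝ u.fst u.fst = -2 * inner ℝ u.fst b := by
    have e1 : ∫ x, φ x * φ x * fderiv ℝ g x e = -∫ x, fderiv ℝ (fun x => φ x * φ x) x e * g x := by
      apply integral_mul_fderiv_eq_neg_fderiv_mul_of_integrable
      · simp_rw [hd2]
        refine Continuous.integrable_of_hasCompactSupport
          ((continuous_const.mul (h1.continuous.mul hφ')).mul hgc) ?_
        exact ((h2.mul_right (f' := fun x => fderiv ℝ φ x e)).mul_left (f := fun _ => 2)).mul_right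
      · have : ∀ x, fderiv ℝ g x e = 1 := fun x => by rw [(hgd x).fderiv]; simp [e]
        simp_rw [this, mul_one]
        exact Continuous.integrable_of_hasCompactSupport (h1.continuous.mul h1.continuous)
          h2.mul_right
      · exact Continuous.integrable_of_hasCompactSupport
          ((h1.continuous.mul h1.continuous).mul hgc) (h2.mul_right.mul_right)
      · exact fun x _ => (hφd x).mul (hφd x)
      · exact fun x _ => (hgd x).differentiableAt
    have : ∀ x, fderiv ℝ g x e = 1 := fun x => by rw [(hgd x).fderiv]; simp [e]
    simp_rw [this, mul_one, hd2] at e1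
    rw [L2.inner_def, L2.inner_def]
    calc ∫ x, inner ℝ (u.fst x) (u.fst x) = ∫ x, φ x * φ x := by
          apply integral_congr_ae
          filter_upwards [h4] with x h6
          rw [h6]; simp [pow_two]
      _ = -∫ x, 2 * (φ x * fderiv ℝ φ x e) * g x := e1
      _ = -2 * ∫ x, inner ℝ (u.fst x) (b x) := by
          rw [neg_mul, ← integral_const_mul]
          congr 1
          apply integral_congr_ae
          filter_upwards [h4, hb2.coeFn_toLp] with x h6 h7
          rw [h6, h7]
          by_cases hx : φ x = 0
          · simp [hx]
          · simp [hx]; ring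
  rw [real_inner_self_eq_norm_sq] at key
  have h8 := abs_real_inner_le_norm u.fst b
  have h9 : ‖u.fst‖ ^ 2 ≤ 2 * (‖u.fst‖ * ‖b‖) := by
    rw [key]; nlinarith [neg_abs_le (inner ℝ u.fst b)]
  by_cases h0 : ‖u.fst‖ = 0
  · rw [h0]; nlinarith [norm_nonneg b]
  · have h10 : 0 < ‖u.fst‖ := lt_of_le_of_ne (norm_nonneg _) (Ne.symm h0)
    have : ‖u.fst‖ ≤ 2 * ‖b‖ := by
      by_contra hcon
      push Not at hcon
      nlinarith
    linarith

/-! ### The energy form -/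

/-- Ellipticity bounds only the quadratic form. Symmetry makes the form a semi-inner product, and
its Cauchy–Schwarz inequality carries the bound to pairs of vectors. -/
lemma abs_inner_toEuclideanLin_le {M : Matrix (Fin d) (Fin d) ℝ} (hM : M.IsSymm) {α β : ℝ}
    (hα : 0 ≤ α) (hβ : 0 ≤ β)
    (h : ∀ η : E d, α * ‖η‖ ^ 2 ≤ inner ℝ (Matrix.toEuclideanLin M η) η ∧
      inner ℝ (Matrix.toEuclideanLin M η) η ≤ β * ‖η‖ ^ 2) (η ξ : E d) :
    |inner ℝ (Matrix.toEuclideanLin M η) ξ| ≤ β * ‖η‖ * ‖ξ‖ := by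
  let B : LinearMap.BilinForm ℝ (E d) := (innerₗ (E d)) ∘ₗ (Matrix.toEuclideanLin M)
  have hBapp : ∀ x y, B x y = inner ℝ (Matrix.toEuclideanLin M x) y := fun _ _ => rfl
  have hsymm : (Matrix.toEuclideanLin M).IsSymmetric := by
    rw [Matrix.isSymmetric_toEuclideanLin_iff]
    rw [Matrix.IsHermitian, Matrix.conjTranspose_eq_transpose_of_trivial]
    exact hM
  have hB : LinearMap.IsSymm B := ⟨fun x y => by
    simp only [hBapp, RingHom.id_apply]
    rw [hsymm x y, real_inner_comm]⟩
  have hpos : ∀ x, 0 ≤ B x x := fun x => (by positivity : 0 ≤ α * ‖x‖ ^ 2).trans (h x).1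
  have := LinearMap.BilinForm.apply_sq_le_of_symm B hpos hB η ξ
  rw [← hBapp]
  refine abs_le_of_sq_le_sq ?_ (by positivity)
  calc B η ξ ^ 2 ≤ B η η * B ξ ξ := this
    _ ≤ (β * ‖η‖ ^ 2) * (β * ‖ξ‖ ^ 2) :=
      mul_le_mul (h η).2 (h ξ).2 (hpos ξ) (by positivity)
    _ = (β * ‖η‖ * ‖ξ‖) ^ 2 := by ring

/-- Inclusion up to a null set is the right hypothesis: closed patches lie in the closure of Ω,
which may exceed Ω by part of the boundary. -/
lemma IsCoefficient.mono {Ω ω : Set (E d)} {α β : ℝ} {A : E d → Matrix (Fin d) (Fin d) ℝ}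
    (hA : IsCoefficient Ω α β A) (h : ω ≤ᵐ[volume] Ω) : IsCoefficient ω α β A := by
  have hle : volume.restrict ω ≤ volume.restrict Ω := Measure.restrict_mono_ae h
  exact ⟨hA.measurable.mono_measure hle, ae_mono hle hA.symm, ae_mono hle hA.elliptic⟩

section energy

variable {ω : Set (E d)} {α β : ℝ} {A : E d → Matrix (Fin d) (Fin d) ℝ}

lemma IsCoefficient.ae_bound (hA : IsCoefficient ω α β A) (hα : 0 ≤ α) (hβ : 0 ≤ β) :
    ∀ᵐ x ∂(volume.restrict ω), ∀ η ξ : E d,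
      |inner ℝ (Matrix.toEuclideanLin (A x) η) ξ| ≤ β * ‖η‖ * ‖ξ‖ := by
  filter_upwards [hA.symm, hA.elliptic] with x h1 h2
  exact abs_inner_toEuclideanLin_le h1 hα hβ h2

lemma energyForm_congr {g g' h h' : E d → E d} (hg : g =ᵐ[volume] g') (hh : h =ᵐ[volume] h') :
    energyForm A ω g h = energyForm A ω g' h' := by
  apply integral_congr_ae
  filter_upwards [ae_restrict_of_ae hg, ae_restrict_of_ae hh] with x h1 h2
  rw [h1, h2]

lemma IsCoefficient.aestronglyMeasurable (hA : IsCoefficient ω α β A) {g h : E d → E d}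
    (hg : AEStronglyMeasurable g volume) (hh : AEStronglyMeasurable h volume) :
    AEStronglyMeasurable (fun x => inner ℝ (Matrix.toEuclideanLin (A x) (g x)) (h x))
      (volume.restrict ω) := by
  obtain ⟨k, hk⟩ : ∃ k : Matrix (Fin d) (Fin d) ℝ × E d × E d → ℝ,
    k = fun t => (inner ℝ (Matrix.toEuclideanLin t.1 t.2.1) t.2.2 : ℝ) := ⟨_, rfl⟩
  have hc : Continuous k := by
    have : Continuous fun t : Matrix (Fin d) (Fin d) ℝ × E d × E d =>
        Matrix.toEuclideanLin t.1 t.2.1 := by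
      simp only [Matrix.toEuclideanLin, Matrix.toLpLin_apply]
      fun_prop
    rw [hk]
    exact this.inner continuous_snd.snd
  have h2 : AEStronglyMeasurable (fun x => (g x, h x)) (volume.restrict ω) :=
    hg.restrict.prodMk hh.restrict
  have hm : AEStronglyMeasurable (fun x => (A x, g x, h x)) (volume.restrict ω) :=
    hA.measurable.prodMk h2
  refine (hc.comp_aestronglyMeasurable hm).congr (Eventually.of_forall fun x => ?_)
  rw [hk]

lemma IsCoefficient.integrable (hA : IsCoefficient ω α β A) (hα : 0 ≤ α) (hβ : 0 ≤ β)
    {g h : E d → E d} (hg : MemLp g 2 volume) (hh : MemLp h 2 volume) :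
    Integrable (fun x => inner ℝ (Matrix.toEuclideanLin (A x) (g x)) (h x))
      (volume.restrict ω) := by
  have : Integrable (fun x => β * (‖g x‖ * ‖h x‖)) (volume.restrict ω) :=
    ((hg.norm.integrable_mul hh.norm).const_mul β).restrict
  refine this.mono' (hA.aestronglyMeasurable hg.1 hh.1) ?_
  filter_upwards [hA.ae_bound hα hβ] with x hx
  rw [Real.norm_eq_abs, ← mul_assoc]
  exact hx _ _

lemma integral_norm_mul_norm_le (g h : Lp (E d) 2 (volume : Measure (E d))) :
    ∫ x, ‖g x‖ * ‖h x‖ ≤ ‖g‖ * ‖h‖ := by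
  have h1 : MemLp (fun x => ‖g x‖) 2 volume := (Lp.memLp g).norm
  have h2 : MemLp (fun x => ‖h x‖) 2 volume := (Lp.memLp h).norm
  have h3 := real_inner_le_norm (h1.toLp _) (h2.toLp _)
  rw [L2.inner_def, Lp.norm_toLp, Lp.norm_toLp, eLpNorm_norm, eLpNorm_norm] at h3
  refine le_trans (le_of_eq (integral_congr_ae ?_)) h3
  filter_upwards [h1.coeFn_toLp, h2.coeFn_toLp] with x h4 h5
  rw [h4, h5]
  simp [mul_comm]

lemma IsCoefficient.abs_energyForm_le (hA : IsCoefficient ω α β A) (hα : 0 ≤ α) (hβ : 0 ≤ β)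
    (g h : Lp (E d) 2 (volume : Measure (E d))) :
    |energyForm A ω g h| ≤ β * ‖g‖ * ‖h‖ := by
  have hint : Integrable (fun x => β * (‖g x‖ * ‖h x‖)) volume :=
    (((Lp.memLp g).norm.integrable_mul (Lp.memLp h).norm)).const_mul β
  calc |energyForm A ω g h| ≤ ∫ x in ω, β * (‖g x‖ * ‖h x‖) := by
        rw [← Real.norm_eq_abs, energyForm]
        refine norm_integral_le_of_norm_le hint.restrict ?_
        filter_upwards [hA.ae_bound hα hβ] with x hx
        rw [Real.norm_eq_abs, ← mul_assoc]
        exact hx _ _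
    _ ≤ ∫ x, β * (‖g x‖ * ‖h x‖) :=
        setIntegral_le_integral hint (Eventually.of_forall fun x => by positivity)
    _ ≤ β * ‖g‖ * ‖h‖ := by
        rw [integral_const_mul, mul_assoc]
        exact mul_le_mul_of_nonneg_left (integral_norm_mul_norm_le g h) hβ

lemma IsCoefficient.energyForm_symm (hA : IsCoefficient ω α β A) (g h : E d → E d) :
    energyForm A ω g h = energyForm A ω h g := by
  apply integral_congr_ae
  filter_upwards [hA.symm] with x hx
  have hsymm : (Matrix.toEuclideanLin (A x)).IsSymmetric := by
    rw [Matrix.isSymmetric_toEuclideanLin_iff]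
    rw [Matrix.IsHermitian, Matrix.conjTranspose_eq_transpose_of_trivial]
    exact hx
  rw [hsymm, real_inner_comm]

/-- The energy form as a bounded bilinear form on `L²` vector fields. -/
def IsCoefficient.energyL (hA : IsCoefficient ω α β A) (hα : 0 ≤ α) (hβ : 0 ≤ β) :
    Lp (E d) 2 (volume : Measure (E d)) →L[ℝ] Lp (E d) 2 (volume : Measure (E d)) →L[ℝ] ℝ :=
  LinearMap.mkContinuous₂
    (LinearMap.mk₂ ℝ (fun g h => energyForm A ω g h)
      (fun g g' h => by
        rw [energyForm_congr (Lp.coeFn_add g g') (ae_eq_refl _)]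
        simp only [energyForm, Pi.add_apply, map_add, inner_add_left]
        exact integral_add (hA.integrable hα hβ (Lp.memLp _) (Lp.memLp _))
          (hA.integrable hα hβ (Lp.memLp _) (Lp.memLp _)))
      (fun c g h => by
        rw [energyForm_congr (Lp.coeFn_smul c g) (ae_eq_refl _)]
        simp only [energyForm, Pi.smul_apply, map_smul, inner_smul_left, RCLike.conj_to_real]
        exact integral_const_mul _ _)
      (fun g h h' => by
        rw [energyForm_congr (ae_eq_refl _) (Lp.coeFn_add h h')]
        simp only [energyForm, Pi.add_apply, inner_add_right]
        exact integral_add (hA.integrable hα hβ (Lp.memLp _) (Lp.memLp _))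
          (hA.integrable hα hβ (Lp.memLp _) (Lp.memLp _)))
      (fun c g h => by
        rw [energyForm_congr (ae_eq_refl _) (Lp.coeFn_smul c h)]
        simp only [energyForm, Pi.smul_apply, inner_smul_right]
        exact integral_const_mul _ _))
    β (fun g h => hA.abs_energyForm_le hα hβ g h)

lemma IsCoefficient.energyL_apply (hA : IsCoefficient ω α β A) (hα : 0 ≤ α) (hβ : 0 ≤ β)
    (g h : Lp (E d) 2 (volume : Measure (E d))) :
    hA.energyL hα hβ g h = energyForm A ω g h := rfl

lemma norm_sq_eq_integral {F : Type*} [NormedAddCommGroup F] [InnerProductSpace ℝ F]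
    (g : Lp F 2 (volume : Measure (E d))) : ‖g‖ ^ 2 = ∫ x, ‖g x‖ ^ 2 := by
  rw [← real_inner_self_eq_norm_sq, L2.inner_def]
  simp

lemma integrable_norm_sq {F : Type*} [NormedAddCommGroup F] [InnerProductSpace ℝ F]
    (g : Lp F 2 (volume : Measure (E d))) : Integrable (fun x => ‖g x‖ ^ 2) volume :=
  (Lp.memLp g).integrable_norm_pow two_ne_zero

lemma IsCoefficient.le_energyForm_self (hA : IsCoefficient ω α β A) (hα : 0 ≤ α) (hβ : 0 ≤ β)
    (g : Lp (E d) 2 (volume : Measure (E d))) (hg : ∀ᵐ x, x ∉ ω → g x = 0) :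
    α * ‖g‖ ^ 2 ≤ energyForm A ω g g := by
  have h1 : ∫ x, ‖g x‖ ^ 2 = ∫ x in ω, ‖g x‖ ^ 2 := by
    refine (setIntegral_eq_integral_of_ae_compl_eq_zero ?_).symm
    filter_upwards [hg] with x hx hxω
    simp [hx hxω]
  rw [norm_sq_eq_integral, h1, ← integral_const_mul]
  refine integral_mono_ae ((integrable_norm_sq g).const_mul α).restrict
    (hA.integrable hα hβ (Lp.memLp _) (Lp.memLp _)) ?_
  filter_upwards [hA.elliptic] with x hx
  exact (hx _).1

lemma IsCoefficient.energyNorm_le (hA : IsCoefficient ω α β A) (hα : 0 ≤ α) (hβ : 0 ≤ β)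
    (g : Lp (E d) 2 (volume : Measure (E d))) : energyNorm A ω g ≤ √β * ‖g‖ := by
  rw [energyNorm, ← Real.sqrt_sq (norm_nonneg g), ← Real.sqrt_mul hβ]
  apply Real.sqrt_le_sqrt
  have := (le_abs_self _).trans (hA.abs_energyForm_le hα hβ g g)
  rwa [mul_assoc, ← pow_two] at this

lemma IsCoefficient.norm_le_energyNorm (hA : IsCoefficient ω α β A) (hα : 0 ≤ α) (hβ : 0 ≤ β)
    (g : Lp (E d) 2 (volume : Measure (E d))) (hg : ∀ᵐ x, x ∉ ω → g x = 0) :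
    √α * ‖g‖ ≤ energyNorm A ω g := by
  rw [energyNorm, ← Real.sqrt_sq (norm_nonneg g), ← Real.sqrt_mul hα]
  exact Real.sqrt_le_sqrt (hA.le_energyForm_self hα hβ g hg)

/-! ### Solvability in `H¹₀` -/

lemma snd_eq_zero_of_mem_H10 {u : H1Pair d} (hu : u ∈ H10 ω) : ∀ᵐ x, x ∉ ω → u.snd x = 0 := by
  filter_upwards [ae_eq_zero_of_mem_H10 hu] with x hx hxω
  exact (hx fun h => hxω (interior_subset h)).2

lemma fst_eq_zero_of_mem_H10 {u : H1Pair d} (hu : u ∈ H10 ω) : ∀ᵐ x, x ∉ ω → u.fst x = 0 := by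
  filter_upwards [ae_eq_zero_of_mem_H10 hu] with x hx hxω
  exact (hx fun h => hxω (interior_subset h)).1

lemma norm_le_of_mem_H10 (hd : 0 < d) {c : E d} {R : ℝ} (hω : ω ⊆ Metric.closedBall c R)
    {u : H1Pair d} (hu : u ∈ H10 ω) : ‖u‖ ≤ (2 * R + 1) * ‖u.snd‖ := by
  have := norm_pair_le u
  have := friedrichs hd hω hu
  linarith

/-- Lax–Milgram: the functional is represented by a vector, to which the inverse of the operator of
B is applied. -/
lemma _root_.IsCoercive.exists_forall_eq {V : Type*} [NormedAddCommGroup V]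
    [InnerProductSpace ℝ V] [CompleteSpace V] {B : V →L[ℝ] V →L[ℝ] ℝ} (hB : IsCoercive B)
    (f : V →L[ℝ] ℝ) : ∃ s, ∀ v, B s v = f v := by
  refine ⟨hB.continuousLinearEquivOfBilin.symm ((InnerProductSpace.toDual ℝ V).symm f),
    fun v => ?_⟩
  rw [← hB.continuousLinearEquivOfBilin_apply, ContinuousLinearEquiv.apply_symm_apply,
    InnerProductSpace.toDual_symm_apply]

/-- Solvability of the elliptic problem for a bounded right-hand side. -/
lemma IsCoefficient.exists_solution (hd : 0 < d) (hA : IsCoefficient ω α β A) (hα : 0 < α)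
    (hβ : 0 ≤ β) {c : E d} {R : ℝ} (hR : 0 ≤ R) (hω : ω ⊆ Metric.closedBall c R)
    (f : H1Pair d →L[ℝ] ℝ) :
    ∃ s ∈ H10 ω, ∀ v ∈ H10 ω, energyForm A ω s.snd v.snd = f v := by
  let P : H10 ω →L[ℝ] Lp (E d) 2 (volume : Measure (E d)) :=
    WithLp.sndL 2 ℝ _ _ ∘L (H10 ω).subtypeL
  obtain ⟨B, hB⟩ : ∃ B : H10 ω →L[ℝ] H10 ω →L[ℝ] ℝ, ∀ u v : H10 ω, B u v =
      energyForm A ω (u : H1Pair d).snd (v : H1Pair d).snd :=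
    ⟨(hA.energyL hα.le hβ).bilinearComp P P, fun _ _ => rfl⟩
  -- Friedrichs' inequality bounds the H¹ norm by 2 R + 1 times that of the gradient, whence the
  -- coercivity constant.
  have hcoer : IsCoercive B := by
    refine ⟨α / (2 * R + 1) ^ 2, by positivity, fun u => ?_⟩
    have h1 := norm_le_of_mem_H10 hd hω u.2
    have h2 := hA.le_energyForm_self hα.le hβ _ (snd_eq_zero_of_mem_H10 u.2)
    rw [hB]
    refine le_trans ?_ h2
    have h3 : ‖u‖ * ‖u‖ ≤ ((2 * R + 1) * ‖(u : H1Pair d).snd‖) ^ 2 := by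
      rw [pow_two]
      exact mul_le_mul h1 h1 (norm_nonneg _) (by positivity)
    rw [div_mul_eq_mul_div, div_mul_eq_mul_div, div_le_iff₀ (by positivity), mul_assoc]
    calc α * (‖u‖ * ‖u‖) ≤ α * ((2 * R + 1) * ‖(u : H1Pair d).snd‖) ^ 2 :=
          mul_le_mul_of_nonneg_left h3 hα.le
      _ = _ := by ring
  obtain ⟨s, hs⟩ := hcoer.exists_forall_eq (f ∘L (H10 ω).subtypeL)
  exact ⟨s, s.2, fun v hv => (hB s ⟨v, hv⟩).symm.trans (hs ⟨v, hv⟩)⟩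

lemma IsCoefficient.exists_isSolution (hd : 0 < d) (hA : IsCoefficient ω α β A) (hα : 0 < α)
    (hβ : 0 ≤ β) {c : E d} {R : ℝ} (hR : 0 ≤ R) (hω : ω ⊆ Metric.closedBall c R) (f : L2 d) :
    ∃ s, IsSolution A ω f s := by
  obtain ⟨s, hs, h⟩ := hA.exists_solution hd hα hβ hR hω
    (innerSL ℝ f ∘L WithLp.fstL 2 ℝ _ _)
  refine ⟨s, hs, fun v hv => (h v hv).trans ?_⟩
  change inner ℝ f v.fst = _
  rw [L2.inner_def]
  have : ∫ x, inner ℝ (f x) (v.fst x) = ∫ x in ω, inner ℝ (f x) (v.fst x) := by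
    refine (setIntegral_eq_integral_of_ae_compl_eq_zero ?_).symm
    filter_upwards [fst_eq_zero_of_mem_H10 hv] with x hx hxω
    rw [hx hxω, inner_zero_right]
  rw [this]
  simp [mul_comm]

/-- Subtract from r its energy projection s onto H¹₀(ω). Testing the equation of s with s bounds
‖∇s‖ by (β / α) ‖∇r‖. The constant involves ω only through the enclosing radius R, so one constant
serves all patches. -/
lemma IsCoefficient.exists_isHarmonicExtension (hd : 0 < d) (hA : IsCoefficient ω α β A)
    (hα : 0 < α) (hβ : 0 ≤ β) {c : E d} {R : ℝ} (hR : 0 ≤ R) (hω : ω ⊆ Metric.closedBall c R)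
    (r : H1Pair d) :
    ∃ y, IsHarmonicExtension A ω r y ∧ ‖y‖ ≤ (1 + (2 * R + 1) * (β / α)) * ‖r‖ := by
  obtain ⟨s, hs, h⟩ := hA.exists_solution hd hα hβ hR hω
    (hA.energyL hα.le hβ r.snd ∘L WithLp.sndL 2 ℝ _ _)
  replace h : ∀ v ∈ H10 ω, energyForm A ω s.snd v.snd = energyForm A ω r.snd v.snd := h
  refine ⟨r - s, ⟨by simpa using (H10 ω).neg_mem hs, fun v hv => ?_⟩, ?_⟩
  · rw [← hA.energyL_apply hα.le hβ, WithLp.sub_snd, map_sub, sub_apply,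
      hA.energyL_apply, hA.energyL_apply, h v hv, sub_self]
  · have h1 : α * ‖s.snd‖ ^ 2 ≤ β * ‖r.snd‖ * ‖s.snd‖ := by
      refine (hA.le_energyForm_self hα.le hβ _ (snd_eq_zero_of_mem_H10 hs)).trans ?_
      rw [h s hs]
      exact (le_abs_self _).trans (hA.abs_energyForm_le hα.le hβ _ _)
    have h2 : ‖s.snd‖ ≤ β / α * ‖r.snd‖ := by
      rw [div_mul_eq_mul_div, le_div_iff₀ hα]
      by_contra hcon
      push Not at hcon
      have : 0 < ‖s.snd‖ := by
        by_contra h0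
        have h0' : ‖s.snd‖ = 0 := le_antisymm (not_lt.1 h0) (norm_nonneg _)
        rw [h0', zero_mul] at hcon
        exact absurd hcon (not_lt.2 (by positivity))
      nlinarith
    have h3 := norm_le_of_mem_H10 hd hω hs
    have h4 : ‖s‖ ≤ (2 * R + 1) * (β / α * ‖r‖) :=
      h3.trans (mul_le_mul_of_nonneg_left (h2.trans
        (mul_le_mul_of_nonneg_left (norm_snd_le r) (by positivity))) (by positivity))
    calc ‖r - s‖ ≤ ‖r‖ + ‖s‖ := norm_sub_le _ _
      _ ≤ ‖r‖ + (2 * R + 1) * (β / α * ‖r‖) := by linarith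
      _ = _ := by ring

end energy

/-! ### Lipschitz functions in `H¹₀` -/

/-- A vector that is weakly approximated by bounded vectors of a closed subspace belongs to it. -/
lemma mem_of_weak_approx {V : Type*} [NormedAddCommGroup V] [InnerProductSpace ℝ V]
    [CompleteSpace V] {S : Submodule ℝ V} (hS : IsClosed (S : Set V)) {D : Set V} (hD : Dense D)
    {u : V} {M : ℝ}
    (h : ∀ ψ ∈ D, ∀ ε > 0, ∃ v ∈ S, ‖v‖ ≤ M ∧ |inner ℝ (v - u) ψ| ≤ ε) : u ∈ S := by
  have : CompleteSpace S := hS.completeSpace_coe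
  -- A closed subspace is its double orthogonal complement, so it suffices that u is orthogonal to
  -- every z ⊥ S. Such z are replaced by nearby elements of D; the bound M controls the error
  -- uniformly in v.
  rw [← Submodule.orthogonal_orthogonal S, Submodule.mem_orthogonal]
  intro z hz
  rw [real_inner_comm]
  by_contra hne
  obtain ⟨ε, hε, hε2⟩ : ∃ ε > 0, ε * (‖u‖ + |M| + 1) < |inner ℝ u z| := by
    refine ⟨|inner ℝ u z| / (2 * (‖u‖ + |M| + 1)), by positivity, ?_⟩
    have h0 : 0 < |inner ℝ u z| := abs_pos.2 hne
    have h1 : 0 < ‖u‖ + |M| + 1 := by positivity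
    rw [div_mul_eq_mul_div, div_lt_iff₀ (by positivity)]
    nlinarith [mul_pos h0 h1]
  obtain ⟨ψ, hψ, hψz⟩ := hD.exists_dist_lt z hε
  obtain ⟨v, hv, hvM, hvψ⟩ := h ψ hψ ε hε
  have e0 : inner ℝ v z = 0 := (Submodule.mem_orthogonal S z).1 hz v hv
  have e1 : inner ℝ u z = inner ℝ u (z - ψ) - inner ℝ (v - u) ψ - inner ℝ v (z - ψ) := by
    simp only [inner_sub_right, inner_sub_left, e0]; ring
  have hd : ‖z - ψ‖ ≤ ε := by rw [← dist_eq_norm]; exact hψz.le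
  have b1 : |inner ℝ u (z - ψ)| ≤ ‖u‖ * ε :=
    (abs_real_inner_le_norm _ _).trans (mul_le_mul_of_nonneg_left hd (norm_nonneg _))
  have b2 : |inner ℝ v (z - ψ)| ≤ |M| * ε :=
    (abs_real_inner_le_norm _ _).trans
      (mul_le_mul (hvM.trans (le_abs_self M)) hd (norm_nonneg _) (abs_nonneg _))
  have : |inner ℝ u z| ≤ ‖u‖ * ε + ε + |M| * ε := by
    rw [e1]
    refine (abs_sub _ _).trans (add_le_add ((abs_sub _ _).trans (add_le_add b1 hvψ)) b2)
  linarith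

/-- Integration by parts of Lipschitz functions against a smooth vector field. -/
lemma exists_integral_gradient_eq {ψ : E d → E d} (h1 : ContDiff ℝ ((⊤ : ℕ∞) : WithTop ℕ∞) ψ)
    (h2 : HasCompactSupport ψ) :
    ∃ D : E d → ℝ, Continuous D ∧ HasCompactSupport D ∧ ∀ (f : E d → ℝ) (K : NNReal),
      LipschitzWith K f → ∫ x, inner ℝ (gradient f x) (ψ x) = ∫ x, D x * f x := by
  let e : Fin d → E d := fun i => EuclideanSpace.single i 1
  have hc1 : ∀ i, ContDiff ℝ ((⊤ : ℕ∞) : WithTop ℕ∞) fun x => ψ x i := fun i =>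
    (EuclideanSpace.proj i : E d →L[ℝ] ℝ).contDiff.comp h1
  have hc2 : ∀ i, HasCompactSupport fun x => ψ x i := fun i =>
    h2.comp_left (g := fun y : E d => y i) rfl
  have hline : ∀ i x, lineDeriv ℝ (fun x => ψ x i) x (-e i) =
      fderiv ℝ (fun x => ψ x i) x (-e i) := fun i x =>
    ((hc1 i).differentiable (by simp) x).lineDeriv_eq_fderiv
  have hDc : ∀ i, Continuous fun x => fderiv ℝ (fun x => ψ x i) x (-e i) := fun i =>
    ((hc1 i).continuous_fderiv (by simp)).clm_apply continuous_const
  have hDs : ∀ i, HasCompactSupport fun x => fderiv ℝ (fun x => ψ x i) x (-e i) := fun i =>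
    (hc2 i).fderiv_apply (𝕜 := ℝ) (-e i)
  -- This is minus the divergence of ψ. It is fixed before f, so the same D serves a function and
  -- its approximations.
  refine ⟨fun x => ∑ i, fderiv ℝ (fun x => ψ x i) x (-e i), by fun_prop, ?_, ?_⟩
  · refine HasCompactSupport.intro h2 fun x hx => Finset.sum_eq_zero fun i _ => ?_
    have hx' : x ∉ tsupport fun x => ψ x i := fun h =>
      hx (closure_mono (fun y hy => by
        intro h0; exact hy (by simp [h0])) h)
    have : fderiv ℝ (fun x => ψ x i) x = 0 := by
      by_contra h
      exact hx' (support_fderiv_subset ℝ h)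
    simp [this]
  · intro f K hf
    have hlip : ∀ i, ∃ C : NNReal, LipschitzWith C fun x => ψ x i := fun i =>
      ((hc1 i).of_le (m := 1) (by exact_mod_cast le_top)).lipschitzWith_of_hasCompactSupport
        (hc2 i) one_ne_zero
    calc ∫ x, inner ℝ (gradient f x) (ψ x) = ∫ x, ∑ i, lineDeriv ℝ f x (e i) * ψ x i := by
          apply integral_congr_ae
          -- By Rademacher's theorem the gradient is almost everywhere the vector of line
          -- derivatives, for which integration by parts is available.
          filter_upwards [hf.ae_differentiableAt (μ := volume)] with x hx
          rw [PiLp.inner_apply]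
          refine Finset.sum_congr rfl fun i _ => ?_
          have : fderiv ℝ f x (e i) = gradient f x i := by
            rw [← inner_gradient, EuclideanSpace.inner_single_right]
            simp
          rw [hx.lineDeriv_eq_fderiv, this]
          simp [mul_comm]
      _ = ∑ i, ∫ x, lineDeriv ℝ f x (e i) * ψ x i := by
          refine integral_finsetSum _ fun i _ => ?_
          have hi : Integrable (fun x => ψ x i) volume :=
            (hc1 i).continuous.integrable_of_hasCompactSupport (hc2 i)
          refine hi.bdd_mul (c := K * ‖e i‖)
            (measurable_lineDeriv hf.continuous).aestronglyMeasurable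
            (Eventually.of_forall fun x => ?_)
          exact norm_lineDeriv_le_of_lipschitz ℝ hf
      _ = ∑ i, ∫ x, fderiv ℝ (fun x => ψ x i) x (-e i) * f x := by
          refine Finset.sum_congr rfl fun i _ => ?_
          obtain ⟨C, hC⟩ := hlip i
          rw [hf.integral_lineDeriv_mul_eq hC (hc2 i)]
          simp_rw [hline]
      _ = ∫ x, (∑ i, fderiv ℝ (fun x => ψ x i) x (-e i)) * f x := by
          simp_rw [Finset.sum_mul]
          refine (integral_finsetSum _ fun i _ => ?_).symm
          exact ((hDc i).mul hf.continuous).integrable_of_hasCompactSupport (hDs i).mul_right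

/-- A Lipschitz function that vanishes outside an open set can be approximated uniformly by
test functions with the same Lipschitz constant. -/
lemma exists_testFunction_approx {f : E d → ℝ} {K : NNReal} (hf : LipschitzWith K f)
    (hfc : HasCompactSupport f) {U : Set (E d)} (hU : IsOpen U) (h0 : ∀ x ∉ U, f x = 0)
    {ε : ℝ} (hε : 0 < ε) :
    ∃ φ : E d → ℝ, ContDiff ℝ ((⊤ : ℕ∞) : WithTop ℕ∞) φ ∧ HasCompactSupport φ ∧
      tsupport φ ⊆ U ∧ tsupport φ ⊆ Metric.cthickening 1 (tsupport f) ∧ LipschitzWith K φ ∧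
      ∀ x, |φ x - f x| ≤ ε := by
  -- Soft thresholding: τ is 1-Lipschitz, moves values by at most ε / 2 and kills those of modulus
  -- at most ε / 2. Hence τ ∘ f keeps the Lipschitz constant, and its closed support lies inside U,
  -- which leaves room for mollification.
  let τ : ℝ → ℝ := fun t => t - max (-(ε / 2)) (min t (ε / 2))
  have hτ1 : ∀ s t, |τ s - τ t| ≤ |s - t| := by
    intro s t
    simp only [τ]
    rcases max_cases (-(ε / 2)) (min s (ε / 2)) with ⟨a1, a2⟩ | ⟨a1, a2⟩ <;>
    rcases max_cases (-(ε / 2)) (min t (ε / 2)) with ⟨b1, b2⟩ | ⟨b1, b2⟩ <;>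
    rcases min_cases s (ε / 2) with ⟨c1, c2⟩ | ⟨c1, c2⟩ <;>
    rcases min_cases t (ε / 2) with ⟨e1, e2⟩ | ⟨e1, e2⟩ <;>
    rw [a1, b1] <;> (try rw [c1]) <;> (try rw [e1]) <;> rw [c1] at a2 <;> rw [e1] at b2 <;>
    rw [abs_le] <;> constructor <;>
    (rcases abs_cases (s - t) with ⟨g1, g2⟩ | ⟨g1, g2⟩) <;> linarith
  have hτ2 : ∀ t, |τ t - t| ≤ ε / 2 := by
    intro t
    simp only [τ]
    rw [abs_le]
    constructor
    · have : max (-(ε / 2)) (min t (ε / 2)) ≤ ε / 2 := max_le (by linarith) (min_le_right _ _)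
      linarith
    · have := le_max_left (-(ε / 2)) (min t (ε / 2))
      linarith
  have hτ3 : ∀ t, |t| ≤ ε / 2 → τ t = 0 := by
    intro t ht
    obtain ⟨h1, h2⟩ := abs_le.1 ht
    simp only [τ]
    rw [min_eq_left h2, max_eq_right h1, sub_self]
  let g : E d → ℝ := fun x => τ (f x)
  have hgL : LipschitzWith K g := LipschitzWith.of_dist_le_mul fun x y =>
    (hτ1 _ _).trans (hf.dist_le_mul x y)
  have hgs : Function.support g ⊆ {x | ε / 2 ≤ |f x|} := by
    intro x hx
    by_contra hcon
    exact hx (hτ3 _ (le_of_lt (not_le.1 hcon)))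
  have hgt : tsupport g ⊆ {x | ε / 2 ≤ |f x|} :=
    closure_minimal hgs (isClosed_le continuous_const hf.continuous.abs)
  have hgU : tsupport g ⊆ U := by
    intro x hx
    by_contra hxU
    have := hgt hx
    rw [Set.mem_ofPred_eq, h0 x hxU, abs_zero] at this
    linarith
  have hgf : tsupport g ⊆ tsupport f := by
    refine closure_mono fun x hx => ?_
    intro hfx
    have := hgs hx
    rw [Set.mem_ofPred_eq, hfx, abs_zero] at this
    linarith
  have hgc : HasCompactSupport g := IsCompact.of_isClosed_subset hfc (isClosed_tsupport _) hgf
  obtain ⟨δ, hδ, hδU⟩ := hgc.isCompact.exists_cthickening_subset_open hU hgU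
  -- The mollification radius: δ keeps the support in U, 1 keeps it in the unit thickening, and the
  -- last entry makes the mollification error at most ε / 2.
  let r : ℝ := min (min δ 1) (ε / (2 * (K + 1)))
  have hr : 0 < r := by positivity
  let η : ContDiffBump (0 : E d) := ⟨r / 2, r, by positivity, by linarith⟩
  let φ : E d → ℝ := convolution (η.normed volume) g (ContinuousLinearMap.lsmul ℝ ℝ) volume
  have hφs : tsupport φ ⊆ Metric.cthickening r (tsupport g) := by
    refine closure_minimal ?_ Metric.isClosed_cthickening
    refine (support_convolution_subset _).trans ?_
    rintro x ⟨a, ha, b, hb, rfl⟩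
    rw [η.support_normed_eq] at ha
    refine Metric.mem_cthickening_of_dist_le _ b _ _ (subset_tsupport g hb) ?_
    simp only [dist_eq_norm, add_sub_cancel_right]
    exact (mem_ball_zero_iff.1 ha).le
  have hφc : HasCompactSupport φ :=
    IsCompact.of_isClosed_subset hgc.isCompact.cthickening (isClosed_tsupport _) hφs
  have hint : ∀ x, Integrable (fun t => η.normed volume t * g (x - t)) volume := fun x =>
    Continuous.integrable_of_hasCompactSupport
      (η.continuous_normed.mul (hgL.continuous.comp (by fun_prop)))
      (η.hasCompactSupport_normed.mul_right)
  have hφdef : ∀ x, φ x = ∫ t, η.normed volume t * g (x - t) := fun x => rfl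
  refine ⟨φ, ?_, hφc, ?_, ?_, ?_, ?_⟩
  · exact η.hasCompactSupport_normed.contDiff_convolution_left _ η.contDiff_normed
      hgL.continuous.locallyIntegrable
  · exact hφs.trans ((Metric.cthickening_mono ((min_le_left _ _).trans (min_le_left _ _)) _).trans
      hδU)
  · exact hφs.trans ((Metric.cthickening_mono ((min_le_left _ _).trans (min_le_right _ _)) _).trans
      (Metric.cthickening_subset_of_subset _ hgf))
  · refine LipschitzWith.of_dist_le_mul fun x y => ?_
    rw [Real.dist_eq, hφdef, hφdef, ← integral_sub (hint x) (hint y)]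
    have hη : Integrable (fun t => η.normed volume t * (K * dist x y)) volume :=
      (η.integrable_normed).mul_const _
    calc |∫ t, (η.normed volume t * g (x - t) - η.normed volume t * g (y - t))|
        ≤ ∫ t, η.normed volume t * (K * dist x y) := by
          rw [← Real.norm_eq_abs]
          refine norm_integral_le_of_norm_le hη (Eventually.of_forall fun t => ?_)
          rw [← mul_sub, norm_mul, Real.norm_of_nonneg (η.nonneg_normed t)]
          refine mul_le_mul_of_nonneg_left ?_ (η.nonneg_normed t)
          have := hgL.dist_le_mul (x - t) (y - t)
          rwa [dist_sub_right] at this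
      _ = K * dist x y := by
          rw [integral_mul_const, η.integral_normed, one_mul]
  · intro x
    have h3 : dist (φ x) (g x) ≤ ε / 2 := by
      refine η.dist_normed_convolution_le hgL.continuous.aestronglyMeasurable fun y hy => ?_
      have hy' : dist y x ≤ ε / (2 * (K + 1)) := (Metric.mem_ball.1 hy).le.trans (min_le_right _ _)
      calc dist (g y) (g x) ≤ K * dist y x := hgL.dist_le_mul _ _
        _ ≤ (K + 1) * (ε / (2 * (K + 1))) := by
          refine mul_le_mul (by linarith) hy' dist_nonneg (by positivity)
        _ = ε / 2 := by
          have : (K : ℝ) + 1 ≠ 0 := by positivity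
          field_simp
    calc |φ x - f x| = |(φ x - g x) + (g x - f x)| := by ring_nf
      _ ≤ |φ x - g x| + |g x - f x| := abs_add_le _ _
      _ ≤ ε := by
        have := hτ2 (f x)
        rw [Real.dist_eq] at h3
        simp only [g] at h3 ⊢
        linarith

lemma measurable_gradient (f : E d → ℝ) : Measurable (gradient f) :=
  (InnerProductSpace.toDual ℝ (E d)).symm.continuous.measurable.comp (measurable_fderiv ℝ f)

/-- Compactly supported Lipschitz functions vanishing outside the interior of `ω` are in
`H¹₀(ω)`. -/
lemma mem_H10_of_lipschitz {f : E d → ℝ} {K : NNReal} (hf : LipschitzWith K f)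
    (hfc : HasCompactSupport f) {ω : Set (E d)} (h0 : ∀ x ∉ interior ω, f x = 0) {u : H1Pair d}
    (hu1 : u.fst =ᵐ[volume] f) (hu2 : u.snd =ᵐ[volume] gradient f) : u ∈ H10 ω := by
  let Z := Metric.cthickening 1 (tsupport f)
  have hZc : IsCompact Z := hfc.isCompact.cthickening
  have hZ : MeasurableSet Z := Metric.isClosed_cthickening.measurableSet
  have hfZ : tsupport f ⊆ Z := Metric.self_subset_cthickening _
  let b : L2 d := indicatorConstLp 2 hZ hZc.measure_lt_top.ne (1 : ℝ)
  have hb : b =ᵐ[volume] Z.indicator fun _ => (1 : ℝ) := indicatorConstLp_coeFn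
  obtain ⟨B, hB⟩ := hfc.exists_bound_of_continuous hf.continuous
  -- Smoothness is required of the vector component only: the function component of the
  -- approximations converges in norm, while the gradients converge merely weakly.
  have hD : Dense {ψ : H1Pair d | ∃ g : E d → E d, ψ.snd =ᵐ[volume] g ∧ HasCompactSupport g ∧
      ContDiff ℝ ((⊤ : ℕ∞) : WithTop ℕ∞) g} := by
    refine Metric.dense_iff.2 fun z ε hε => ?_
    obtain ⟨g, hg1, hg2⟩ := Metric.dense_iff.1
      (Lp.dense_hasCompactSupport_contDiff (E := E d) (F := E d) (μ := volume) (p := 2)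
        (by simp)) z.snd ε hε
    refine ⟨WithLp.toLp 2 (z.fst, g), ?_, hg2⟩
    rw [Metric.mem_ball, dist_eq_norm] at hg1 ⊢
    refine lt_of_le_of_lt ?_ hg1
    refine (norm_pair_le _).trans (le_of_eq ?_)
    simp
  refine mem_of_weak_approx (isClosed_H10 ω) hD
    (M := (|B| + 1) * ‖b‖ + K * ‖b‖) ?_
  rintro ψ ⟨g, hg1, hg2, hg3⟩ ε hε
  obtain ⟨D, hDc, hDs, hDi⟩ := exists_integral_gradient_eq hg3 hg2
  have hDint : Integrable D volume := hDc.integrable_of_hasCompactSupport hDs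
  let N : ℝ := ‖b‖ * ‖ψ.fst‖ + ∫ x, |D x|
  have hN : 0 ≤ N := by
    have : 0 ≤ ∫ x, |D x| := integral_nonneg fun x => abs_nonneg _
    positivity
  -- κ is the uniform accuracy of the test function: κ ≤ 1 keeps the norm bound M independent of ε,
  -- and κ N ≤ ε bounds the pairing with ψ.
  obtain ⟨κ, hκ0, hκ1, hκN⟩ : ∃ κ : ℝ, 0 < κ ∧ κ ≤ 1 ∧ κ * N ≤ ε := by
    refine ⟨min 1 (ε / (N + 1)), by positivity, min_le_left _ _, ?_⟩
    calc min 1 (ε / (N + 1)) * N ≤ ε / (N + 1) * (N + 1) :=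
          mul_le_mul (min_le_right _ _) (by linarith) hN (by positivity)
      _ = ε := by field_simp
  obtain ⟨φ, hφ1, hφ2, hφ3, hφ4, hφ5, hφ6⟩ :=
    exists_testFunction_approx hf hfc isOpen_interior h0 hκ0
  obtain ⟨v, hv, hv1, hv2⟩ := exists_testPair hφ1 hφ2 hφ3
  refine ⟨v, testPairs_subset_H10 ω hv, ?_, ?_⟩
  · refine (norm_pair_le v).trans (add_le_add ?_ ?_)
    · refine Lp.norm_le_mul_norm_of_ae_le_mul ?_
      filter_upwards [hv1, hb] with x h1 h2
      rw [h1, h2]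
      by_cases hx : x ∈ Z
      · have h3 := hφ6 x
        have h4 := hB x
        simp only [hx, Set.indicator_of_mem, norm_one, mul_one, Real.norm_eq_abs] at h4 ⊢
        calc |φ x| = |(φ x - f x) + f x| := by ring_nf
          _ ≤ |φ x - f x| + |f x| := abs_add_le _ _
          _ ≤ |B| + 1 := by linarith [le_abs_self B]
      · have h3 : φ x = 0 := image_eq_zero_of_notMem_tsupport fun h => hx (hφ4 h)
        simp [h3, hx]
    · refine Lp.norm_le_mul_norm_of_ae_le_mul ?_
      filter_upwards [hv2, hb] with x h1 h2
      rw [h1, h2]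
      by_cases hx : x ∈ Z
      · simp only [hx, Set.indicator_of_mem, norm_one, mul_one, norm_gradient]
        exact norm_fderiv_le_of_lipschitz ℝ hφ5
      · have h3 : gradient φ x = 0 := gradient_eq_zero_of_notMem_tsupport fun h => hx (hφ4 h)
        simp [h3, hx]
  · have e1 : inner ℝ (v - u) ψ = inner ℝ (v.fst - u.fst) ψ.fst +
        (inner ℝ v.snd ψ.snd - inner ℝ u.snd ψ.snd) := by
      rw [WithLp.prod_inner_apply, ← inner_sub_left]
      rfl
    have e2 : |inner ℝ (v.fst - u.fst) ψ.fst| ≤ κ * (‖b‖ * ‖ψ.fst‖) := by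
      refine (abs_real_inner_le_norm _ _).trans ?_
      rw [← mul_assoc]
      refine mul_le_mul_of_nonneg_right ?_ (norm_nonneg _)
      refine Lp.norm_le_mul_norm_of_ae_le_mul ?_
      filter_upwards [Lp.coeFn_sub v.fst u.fst, hv1, hu1, hb] with x h1 h2 h3 h4
      rw [h1, Pi.sub_apply, h2, h3, h4]
      by_cases hx : x ∈ Z
      · simpa [hx] using hφ6 x
      · have h3 : φ x = 0 := image_eq_zero_of_notMem_tsupport fun h => hx (hφ4 h)
        have h4 : f x = 0 := image_eq_zero_of_notMem_tsupport fun h => hx (hfZ h)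
        simp [h3, hx, h4]
    -- Integration by parts moves the derivative to ψ, after which uniform closeness of φ and f is
    -- enough.
    have e3 : ∀ (w : H1Pair d) (f' : E d → ℝ), w.snd =ᵐ[volume] gradient f' →
        LipschitzWith K f' → inner ℝ w.snd ψ.snd = ∫ x, D x * f' x := by
      intro w f' h1 h2
      rw [← hDi f' K h2, L2.inner_def]
      apply integral_congr_ae
      filter_upwards [h1, hg1] with x h3 h4
      rw [h3, h4]
    have e4 : |inner ℝ v.snd ψ.snd - inner ℝ u.snd ψ.snd| ≤ κ * ∫ x, |D x| := by
      rw [e3 v φ hv2 hφ5, e3 u f hu2 hf, ← integral_sub, ← integral_const_mul,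
        ← Real.norm_eq_abs]
      · refine norm_integral_le_of_norm_le (hDint.abs.const_mul κ) (Eventually.of_forall fun x => ?_)
        rw [← mul_sub, norm_mul, mul_comm, Real.norm_eq_abs, Real.norm_eq_abs]
        exact mul_le_mul_of_nonneg_right (hφ6 x) (abs_nonneg _)
      · exact (hDc.mul hφ5.continuous).integrable_of_hasCompactSupport hDs.mul_right
      · exact (hDc.mul hf.continuous).integrable_of_hasCompactSupport hDs.mul_right
    rw [e1]
    calc _ ≤ κ * (‖b‖ * ‖ψ.fst‖) + κ * ∫ x, |D x| :=
          (abs_add_le _ _).trans (add_le_add e2 e4)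
      _ = κ * N := by simp only [N]; ring
      _ ≤ ε := hκN

/-! ### The reference element -/

/-- The interior of the reference element. -/
def openCube (d : ℕ) : Set (E d) := {y | ∀ i, y i ∈ Set.Ioo (0 : ℝ) 1}

/-- The midpoint of the reference element. -/
def cubeCenter (d : ℕ) : E d := WithLp.toLp 2 fun _ => 1 / 2

lemma refCube_eq (d : ℕ) : refCube d =
    (PiLp.homeomorph 2 fun _ : Fin d => ℝ) ⁻¹' Set.univ.pi fun _ => Set.Icc (0 : ℝ) 1 := by
  ext y; simp only [refCube, Set.mem_preimage, Set.mem_univ_pi]; rfl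

lemma openCube_eq (d : ℕ) : openCube d =
    (PiLp.homeomorph 2 fun _ : Fin d => ℝ) ⁻¹' Set.univ.pi fun _ => Set.Ioo (0 : ℝ) 1 := by
  ext y; simp only [openCube, Set.mem_preimage, Set.mem_univ_pi]; rfl

lemma isCompact_refCube (d : ℕ) : IsCompact (refCube d) := by
  rw [refCube_eq]
  exact (PiLp.homeomorph 2 fun _ : Fin d => ℝ).isCompact_preimage.2
    (isCompact_univ_pi fun _ => isCompact_Icc)

lemma isOpen_openCube (d : ℕ) : IsOpen (openCube d) := by
  rw [openCube_eq]
  exact (isOpen_set_pi Set.finite_univ fun _ _ => isOpen_Ioo).preimage (Homeomorph.continuous _)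

lemma interior_refCube (d : ℕ) : interior (refCube d) = openCube d := by
  rw [refCube_eq, openCube_eq, ← Homeomorph.preimage_interior, interior_pi_set Set.finite_univ]
  simp

lemma closure_openCube (d : ℕ) : closure (openCube d) = refCube d := by
  rw [refCube_eq, openCube_eq, ← Homeomorph.preimage_closure, closure_pi_set]
  simp [closure_Ioo (zero_ne_one' ℝ)]

lemma openCube_subset_refCube (d : ℕ) : openCube d ⊆ refCube d := by
  rw [← closure_openCube]; exact subset_closure

lemma convex_refCube (d : ℕ) : Convex ℝ (refCube d) := by
  intro x hx y hy a b ha hb hab i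
  exact convex_Icc (0 : ℝ) 1 (hx i) (hy i) ha hb hab

lemma volume_refCube_diff_openCube (d : ℕ) : volume (refCube d \ openCube d) = 0 := by
  have h := (convex_refCube d).addHaar_frontier (volume : Measure (E d))
  rwa [frontier, (isCompact_refCube d).isClosed.closure_eq, interior_refCube] at h

lemma ball_cubeCenter_subset (d : ℕ) : Metric.ball (cubeCenter d) (1 / 2) ⊆ openCube d := by
  intro y hy i
  have h1 : |y i - 1 / 2| < 1 / 2 := by
    have h2 := PiLp.norm_apply_le (y - cubeCenter d) i
    rw [Metric.mem_ball, dist_eq_norm] at hy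
    have h3 : (y - cubeCenter d) i = y i - 1 / 2 := rfl
    rw [h3, Real.norm_eq_abs] at h2
    linarith
  rw [abs_lt] at h1
  constructor <;> linarith [h1.1, h1.2]

lemma cubeCenter_mem (d : ℕ) : cubeCenter d ∈ openCube d :=
  ball_cubeCenter_subset d (Metric.mem_ball_self (by norm_num))

/-- The vertex of the reference element with index `v`. -/
def cubeVertex (v : Fin d → Bool) : E d := WithLp.toLp 2 fun i => if v i then 1 else 0

lemma cubeVertex_mem (v : Fin d → Bool) : cubeVertex v ∈ refCube d := by
  intro i
  by_cases h : v i <;> simp [cubeVertex, h]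

lemma refShape_cubeVertex (v w : Fin d → Bool) :
    refShape v (cubeVertex w) = if v = w then 1 else 0 := by
  unfold refShape cubeVertex
  split_ifs with h
  · subst h
    refine Finset.prod_eq_one fun i _ => ?_
    by_cases hi : v i <;> simp [hi]
  · obtain ⟨i, hi⟩ := Function.ne_iff.1 h
    refine Finset.prod_eq_zero (Finset.mem_univ i) ?_
    cases hv : v i <;> cases hw : w i <;> simp_all

lemma multilinearMap_cubeVertex (vert : (Fin d → Bool) → E d) (v : Fin d → Bool) :
    multilinearMap vert (cubeVertex v) = vert v := by
  simp [multilinearMap, refShape_cubeVertex]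

lemma contDiff_refShape (v : Fin d → Bool) :
    ContDiff ℝ ((⊤ : ℕ∞) : WithTop ℕ∞) (refShape v : E d → ℝ) := by
  unfold refShape
  refine contDiff_prod fun i _ => ?_
  have hi : ContDiff ℝ ((⊤ : ℕ∞) : WithTop ℕ∞) fun y : E d => y i :=
    (EuclideanSpace.proj i : E d →L[ℝ] ℝ).contDiff
  split_ifs
  · exact hi
  · exact contDiff_const.sub hi

lemma contDiff_multilinearMap (vert : (Fin d → Bool) → E d) :
    ContDiff ℝ ((⊤ : ℕ∞) : WithTop ℕ∞) (multilinearMap vert) := by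
  unfold multilinearMap
  exact ContDiff.sum fun v _ => (contDiff_refShape v).smul contDiff_const

lemma refShape_mem_Icc (v : Fin d → Bool) {y : E d} (hy : y ∈ refCube d) :
    refShape v y ∈ Set.Icc (0 : ℝ) 1 := by
  have h : ∀ i, 0 ≤ (if v i then y i else 1 - y i) ∧ (if v i then y i else 1 - y i) ≤ 1 := by
    intro i
    have := hy i
    split_ifs <;> constructor <;> linarith [this.1, this.2]
  exact ⟨Finset.prod_nonneg fun i _ => (h i).1,
    Finset.prod_le_one (fun i _ => (h i).1) fun i _ => (h i).2⟩

lemma refShape_pos (v : Fin d → Bool) {y : E d} (hy : y ∈ openCube d) : 0 < refShape v y := by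
  refine Finset.prod_pos fun i _ => ?_
  have := hy i
  split_ifs <;> linarith [this.1, this.2]

lemma nodalCoord_nonneg (vert : (Fin d → Bool) → E d) (z : E d) {y : E d} (hy : y ∈ refCube d) :
    0 ≤ nodalCoord vert z y :=
  Finset.sum_nonneg fun v _ => by split_ifs <;> simp [(refShape_mem_Icc v hy).1]

lemma nodalCoord_le (vert : (Fin d → Bool) → E d) (z : E d) {y : E d} (hy : y ∈ refCube d) :
    nodalCoord vert z y ≤ 2 ^ d := by
  have : nodalCoord vert z y ≤ ∑ _v : Fin d → Bool, (1 : ℝ) :=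
    Finset.sum_le_sum fun v _ => by split_ifs <;> simp [(refShape_mem_Icc v hy).2]
  simpa using this

lemma nodalCoord_eq_zero {vert : (Fin d → Bool) → E d} {z : E d} (h : ∀ v, vert v ≠ z) (y : E d) :
    nodalCoord vert z y = 0 :=
  Finset.sum_eq_zero fun v _ => by simp [h v]

lemma nodalCoord_pos {vert : (Fin d → Bool) → E d} {z : E d} {v : Fin d → Bool} (h : vert v = z)
    {y : E d} (hy : y ∈ openCube d) : 0 < nodalCoord vert z y := by
  refine Finset.sum_pos' (fun w _ => ?_) ⟨v, Finset.mem_univ v, ?_⟩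
  · split_ifs
    · exact (refShape_pos w hy).le
    · exact le_rfl
  · simp [h, refShape_pos v hy]

/-- The nodal functions are Lipschitz on the reference element, uniformly in the vertices. -/
lemma exists_lipschitz_nodalCoord (d : ℕ) : ∃ L : ℝ, 0 ≤ L ∧
    ∀ (vert : (Fin d → Bool) → E d) (z : E d), ∀ x ∈ refCube d, ∀ y ∈ refCube d,
      |nodalCoord vert z x - nodalCoord vert z y| ≤ L * dist x y := by
  have h : ∀ v : Fin d → Bool, ∃ K : NNReal, LipschitzOnWith K (refShape v) (refCube d) := fun v =>
    (((contDiff_refShape v).of_le (m := 1) (by exact_mod_cast le_top)).locallyLipschitz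
      (𝕂 := ℝ)).locallyLipschitzOn.exists_lipschitzOnWith_of_compact (isCompact_refCube d)
  choose K hK using h
  refine ⟨∑ v, (K v : ℝ), by positivity, fun vert z x hx y hy => ?_⟩
  -- A nodal coordinate is a subsum of the shape functions, whatever the vertices are; the sum of
  -- all their Lipschitz constants therefore works for every element.
  rw [nodalCoord, nodalCoord, ← Finset.sum_sub_distrib, Finset.sum_mul]
  refine (Finset.abs_sum_le_sum_abs _ _).trans (Finset.sum_le_sum fun v _ => ?_)
  split_ifs
  · exact (hK v).dist_le_mul x hx y hy
  · simp only [sub_self, abs_zero]; positivity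

/-! ### Expanding maps -/

/-- Along a vector v in the kernel of the derivative the difference quotients tend to 0, yet
expansion keeps them above c ‖v‖. So the derivative is injective, hence surjective in finite
dimension, and F is open at y. -/
lemma map_nhds_eq_of_expanding {F : E d → E d} (hF : ContDiff ℝ 1 F) {c : ℝ} (hc : 0 < c)
    {y : E d} (h : ∀ᶠ x in 𝓝 y, c * dist x y ≤ dist (F x) (F y)) :
    map F (𝓝 y) = 𝓝 (F y) := by
  have hs : HasStrictFDerivAt F (fderiv ℝ F y) y := hF.contDiffAt.hasStrictFDerivAt one_ne_zero
  refine hs.map_nhds_eq_of_surj ?_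
  rw [LinearMap.range_eq_top]
  refine LinearMap.injective_iff_surjective.1 ?_
  rw [injective_iff_map_eq_zero]
  intro v hv
  by_contra hv0
  have hline : HasDerivAt (fun t : ℝ => F (y + t • v)) 0 0 := by
    have h1 : HasDerivAt (fun t : ℝ => y + t • v) v 0 := by
      simpa using ((hasDerivAt_id (0 : ℝ)).smul_const v).const_add y
    have h2 : HasFDerivAt F (fderiv ℝ F y) (y + (0 : ℝ) • v) := by
      simpa using hs.hasFDerivAt
    have h3 := h2.comp_hasDerivAt (0 : ℝ) h1
    have h4 : fderiv ℝ F y v = 0 := hv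
    rwa [h4] at h3
  have h5 := hline.tendsto_slope_zero.norm
  have h6 : ∀ᶠ t : ℝ in 𝓝[≠] 0, c * ‖v‖ ≤ ‖t⁻¹ • (F (y + (0 + t) • v) - F (y + (0 : ℝ) • v))‖ := by
    have h7 : Tendsto (fun t : ℝ => y + t • v) (𝓝[≠] 0) (𝓝 y) := by
      have : Continuous fun t : ℝ => y + t • v := by fun_prop
      simpa using (this.tendsto 0).mono_left nhdsWithin_le_nhds
    filter_upwards [h7.eventually h, self_mem_nhdsWithin] with t ht ht0
    have ht0' : 0 < |t| := abs_pos.2 ht0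
    rw [norm_smul, norm_inv, Real.norm_eq_abs, zero_add, zero_smul, add_zero, ← dist_eq_norm,
      inv_mul_eq_div, le_div_iff₀ ht0']
    refine le_trans (le_of_eq ?_) ht
    rw [dist_eq_norm, add_sub_cancel_left, norm_smul, Real.norm_eq_abs]
    ring
  have h8 := ge_of_tendsto h5 h6
  rw [norm_zero] at h8
  have : 0 < c * ‖v‖ := mul_pos hc (norm_pos_iff.2 hv0)
  linarith

lemma isOpen_image_of_expanding {F : E d → E d} (hF : ContDiff ℝ 1 F) {c : ℝ} (hc : 0 < c)
    {S : Set (E d)} (h : ∀ x ∈ S, ∀ y ∈ S, c * dist x y ≤ dist (F x) (F y)) {U : Set (E d)}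
    (hU : IsOpen U) (hUS : U ⊆ S) : IsOpen (F '' U) := by
  rw [isOpen_iff_mem_nhds]
  rintro _ ⟨y, hy, rfl⟩
  rw [← map_nhds_eq_of_expanding hF hc
    (Filter.mem_of_superset (hU.mem_nhds hy) fun x hx => h x (hUS hx) y (hUS hy))]
  exact image_mem_map (hU.mem_nhds hy)

/-- A connectedness argument: the image of the open ball is open, and it is relatively closed in the
target ball. Indeed a limit point is F w with w in the closed ball, and expansion excludes dist w y
= r, because F w has distance less than c r from F y. -/
lemma ball_subset_image_of_expanding {F : E d → E d} (hF : ContDiff ℝ 1 F) {c : ℝ} (hc : 0 < c)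
    {S : Set (E d)} (h : ∀ x ∈ S, ∀ y ∈ S, c * dist x y ≤ dist (F x) (F y)) {y : E d} {r : ℝ}
    (hr : 0 < r) (hS : Metric.closedBall y r ⊆ S) :
    Metric.ball (F y) (c * r) ⊆ F '' Metric.ball y r := by
  have hbS : Metric.ball y r ⊆ S := Metric.ball_subset_closedBall.trans hS
  have hy : y ∈ S := hbS (Metric.mem_ball_self hr)
  refine (convex_ball _ _).isPreconnected.subset_of_closure_inter_subset
    (isOpen_image_of_expanding hF hc h Metric.isOpen_ball hbS)
    ⟨F y, Metric.mem_ball_self (by positivity), ⟨y, Metric.mem_ball_self hr, rfl⟩⟩ ?_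
  rintro x ⟨hx1, hx2⟩
  have hcomp : IsCompact (F '' Metric.closedBall y r) :=
    (isCompact_closedBall y r).image hF.continuous
  have hx3 : x ∈ F '' Metric.closedBall y r :=
    closure_minimal (Set.image_mono Metric.ball_subset_closedBall) hcomp.isClosed hx1
  obtain ⟨w, hw, rfl⟩ := hx3
  refine ⟨w, ?_, rfl⟩
  have h1 := h w (hS hw) y hy
  have h2 := Metric.mem_ball.1 hx2
  rw [Metric.mem_ball]
  by_contra hcon
  push Not at hcon
  nlinarith

/-- A function on an interval that is Lipschitz on each member of a finite closed cover is
Lipschitz. -/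
lemma le_add_of_lipschitz_on_cover {ι : Type*} [Finite ι] {S : ι → Set ℝ}
    (hS : ∀ i, IsClosed (S i)) (hcov : Set.Icc (0 : ℝ) 1 ⊆ ⋃ i, S i) {g : ℝ → ℝ} {L : ℝ}
    (hg : ∀ i, ∀ x ∈ S i, ∀ y ∈ S i, |g x - g y| ≤ L * |x - y|) : g 1 ≤ g 0 + L := by
  have hcont : ContinuousOn g (Set.Icc 0 1) := by
    refine ContinuousOn.mono ?_ hcov
    refine (locallyFinite_of_finite S).continuousOn_iUnion hS fun i => ?_
    refine (LipschitzOnWith.of_dist_le_mul (K := L.toNNReal) fun x hx y hy => ?_).continuousOn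
    refine (hg i x hx y hy).trans (mul_le_mul_of_nonneg_right (Real.le_coe_toNNReal L)
      (abs_nonneg _))
  have key := image_le_of_liminf_slope_right_le_deriv_boundary hcont
    (B := fun t => g 0 + L * t) (B' := fun _ => L) (by simp) (by fun_prop)
    (fun x _ => by
      have h := ((hasDerivAt_id x).const_mul L).const_add (g 0)
      simpa using h.hasDerivWithinAt)
    (fun x hx r hr => by
      -- Finitely many sets cover a right neighbourhood of x, so one of them accumulates at x from
      -- the right. Being closed it contains x, and the slopes from x within it are at most L.
      have h1 : ∀ᶠ z in 𝓝[>] x, ∃ i, z ∈ S i := by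
        have h2 : Set.Ioo x 1 ∈ 𝓝[>] x := Ioo_mem_nhdsGT hx.2
        filter_upwards [h2] with z hz
        simpa using hcov ⟨hx.1.trans hz.1.le, hz.2.le⟩
      have h2 : ∃ i, ∃ᶠ z in 𝓝[>] x, z ∈ S i := by
        by_contra hcon
        have h3 : ∀ᶠ z in 𝓝[>] x, ∀ i, z ∉ S i :=
          eventually_all.2 fun i => not_frequently.1 fun hi => hcon ⟨i, hi⟩
        obtain ⟨z, ⟨i, hi⟩, hz⟩ := (h1.and h3).exists
        exact hz i hi
      obtain ⟨i, hi⟩ := h2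
      have hxi : x ∈ S i := by
        have : ∃ᶠ z in 𝓝 x, z ∈ S i := hi.filter_mono nhdsWithin_le_nhds
        exact (hS i).closure_eq ▸ mem_closure_iff_frequently.2 this
      refine (hi.and_eventually self_mem_nhdsWithin).mono fun z hz => ?_
      have hzx : 0 < z - x := sub_pos.2 hz.2
      rw [slope_def_field]
      refine lt_of_le_of_lt ?_ hr
      rw [div_le_iff₀ hzx]
      have h4 := hg i z hz.1 x hxi
      rw [abs_of_pos hzx] at h4
      exact (le_abs_self _).trans h4)
  simpa using key (Set.right_mem_Icc.2 zero_le_one)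

lemma abs_sub_le_of_lipschitz_on_cover {ι : Type*} [Finite ι] {S : ι → Set ℝ}
    (hS : ∀ i, IsClosed (S i)) (hcov : Set.Icc (0 : ℝ) 1 ⊆ ⋃ i, S i) {g : ℝ → ℝ} {L : ℝ}
    (hg : ∀ i, ∀ x ∈ S i, ∀ y ∈ S i, |g x - g y| ≤ L * |x - y|) : |g 1 - g 0| ≤ L := by
  have h1 := le_add_of_lipschitz_on_cover hS hcov hg
  have h2 := le_add_of_lipschitz_on_cover hS hcov (g := fun t => -g t) fun i x hx y hy => by
    have := hg i x hx y hy
    rwa [← abs_neg, neg_sub_neg, neg_sub]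
  rw [abs_le]
  constructor <;> linarith

namespace QuadMesh

variable {Ω : Set (E d)} (M : QuadMesh d Ω) {γ : ℝ}

/-! ### Elements -/

lemma isCompact_elem (T : Fin M.N) : IsCompact (M.elem T) :=
  (isCompact_refCube d).image (contDiff_multilinearMap _).continuous

lemma isClosed_elem (T : Fin M.N) : IsClosed (M.elem T) := (M.isCompact_elem T).isClosed

lemma elem_subset (T : Fin M.N) : M.elem T ⊆ closure Ω := by
  rw [← M.cover]; exact Set.subset_iUnion (fun T => M.elem T) T

lemma exists_mem_elem {x : E d} (hx : x ∈ closure Ω) : ∃ T, x ∈ M.elem T := by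
  rw [← M.cover] at hx; exact Set.mem_iUnion.1 hx

lemma vert_mem_elem (T : Fin M.N) (v : Fin d → Bool) : M.vert T v ∈ M.elem T :=
  ⟨cubeVertex v, cubeVertex_mem v, multilinearMap_cubeVertex _ v⟩

lemma diam_le_meshSize (T : Fin M.N) : Metric.diam (M.elem T) ≤ M.meshSize :=
  le_ciSup (f := fun T => Metric.diam (M.elem T)) (Set.finite_range _).bddAbove T

lemma diam_pos (hd : 0 < d) (T : Fin M.N) : 0 < Metric.diam (M.elem T) := by
  have hne : cubeVertex (fun _ : Fin d => true) ≠ cubeVertex fun _ => false := by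
    intro h
    have := congrArg (fun y : E d => y ⟨0, hd⟩) h
    simp [cubeVertex] at this
  have h1 := (M.injOn T).ne (cubeVertex_mem _) (cubeVertex_mem _) hne
  exact (dist_pos.2 h1).trans_le (Metric.dist_le_diam_of_mem (M.isCompact_elem T).isBounded
    ⟨_, cubeVertex_mem _, rfl⟩ ⟨_, cubeVertex_mem _, rfl⟩)

lemma meshSize_pos (hd : 0 < d) (T : Fin M.N) : 0 < M.meshSize :=
  (M.diam_pos hd T).trans_le (M.diam_le_meshSize T)

lemma elem_subset_closedBall {T : Fin M.N} {x : E d} (hx : x ∈ M.elem T) :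
    M.elem T ⊆ Metric.closedBall x M.meshSize := fun _ hy =>
  (Metric.dist_le_diam_of_mem (M.isCompact_elem T).isBounded hy hx).trans (M.diam_le_meshSize T)

variable {M}

/-- Allows γ to be enlarged to a constant that is at least 1. -/
lemma ShapeRegular.mono (h : M.ShapeRegular γ) {γ' : ℝ} (hγ : γ ≤ γ') : M.ShapeRegular γ' :=
  fun T x hx y hy => (h T x hx y hy).trans (mul_le_mul_of_nonneg_right hγ dist_nonneg)

lemma QuasiUniform.mono (h : M.QuasiUniform γ) {γ' : ℝ} (hγ : γ ≤ γ') : M.QuasiUniform γ' :=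
  fun T => (h T).trans (mul_le_mul_of_nonneg_right hγ Metric.diam_nonneg)

/-- The element maps expand distances by a factor proportional to the mesh size. -/
lemma expanding (hs : M.ShapeRegular γ) (hu : M.QuasiUniform γ) (hγ : 1 ≤ γ) (T : Fin M.N) :
    ∀ x ∈ refCube d, ∀ y ∈ refCube d, M.meshSize / γ ^ 2 * dist x y ≤
      dist (multilinearMap (M.vert T) x) (multilinearMap (M.vert T) y) := by
  intro x hx y hy
  rw [div_mul_eq_mul_div, div_le_iff₀ (by positivity)]
  have h1 := hs T x hx y hy
  have h2 := mul_le_mul_of_nonneg_right (hu T) (dist_nonneg (x := x) (y := y))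
  nlinarith

variable (M)

/-- The image of the midpoint of the reference element. -/
def center (T : Fin M.N) : E d := multilinearMap (M.vert T) (cubeCenter d)

lemma center_mem (T : Fin M.N) : M.center T ∈ M.elem T :=
  ⟨_, openCube_subset_refCube d (cubeCenter_mem d), rfl⟩

variable {M}

lemma isOpen_image_openCube (hd : 0 < d) (hs : M.ShapeRegular γ) (hu : M.QuasiUniform γ)
    (hγ : 1 ≤ γ) (T : Fin M.N) : IsOpen (multilinearMap (M.vert T) '' openCube d) := by
  have := M.meshSize_pos hd T
  exact isOpen_image_of_expanding
    ((contDiff_multilinearMap _).of_le (by exact_mod_cast le_top)) (by positivity)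
    (expanding hs hu hγ T) (isOpen_openCube d) (openCube_subset_refCube d)

lemma image_openCube_subset_interior (hd : 0 < d) (hs : M.ShapeRegular γ) (hu : M.QuasiUniform γ)
    (hγ : 1 ≤ γ) (T : Fin M.N) :
    multilinearMap (M.vert T) '' openCube d ⊆ interior (M.elem T) :=
  interior_maximal (Set.image_mono (openCube_subset_refCube d))
    (isOpen_image_openCube hd hs hu hγ T)

/-- The closed ball of radius 1/4 about the midpoint fits into the open reference cube, and the
element map expands by H / γ². Every element thus contains a ball of radius comparable to H, which
feeds both the packing counts and the test functions of the inverse estimate. -/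
lemma ball_center_subset (hd : 0 < d) (hs : M.ShapeRegular γ) (hu : M.QuasiUniform γ)
    (hγ : 1 ≤ γ) (T : Fin M.N) :
    Metric.ball (M.center T) (M.meshSize / (4 * γ ^ 2)) ⊆ interior (M.elem T) := by
  have hpos := M.meshSize_pos hd T
  have hb : Metric.closedBall (cubeCenter d) (1 / 4) ⊆ openCube d :=
    (Metric.closedBall_subset_ball (by norm_num)).trans (ball_cubeCenter_subset d)
  have h := ball_subset_image_of_expanding
    ((contDiff_multilinearMap (M.vert T)).of_le (by exact_mod_cast le_top))
    (by positivity : 0 < M.meshSize / γ ^ 2)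
    (expanding hs hu hγ T) (y := cubeCenter d) (r := 1 / 4) (by norm_num)
    (hb.trans (openCube_subset_refCube d))
  have e : M.meshSize / γ ^ 2 * (1 / 4) = M.meshSize / (4 * γ ^ 2) := by ring
  rw [e] at h
  exact h.trans ((Set.image_mono (Metric.ball_subset_closedBall.trans hb)).trans
    (image_openCube_subset_interior hd hs hu hγ T))

/-- The number of elements near a point. -/
lemma card_le_of_center_mem (hd : 0 < d) (hs : M.ShapeRegular γ) (hu : M.QuasiUniform γ)
    (hγ : 1 ≤ γ) {S : Finset (Fin M.N)} {x : E d} {s : ℝ} (h0 : 0 ≤ s)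
    (hS : ∀ T ∈ S, M.center T ∈ Metric.closedBall x (s * M.meshSize)) :
    (S.card : ℝ) ≤ (1 + 4 * γ ^ 2 * s) ^ d := by
  rcases S.eq_empty_or_nonempty with rfl | ⟨T₀, hT₀⟩
  · simp only [Finset.card_empty, Nat.cast_zero]; positivity
  have hH := M.meshSize_pos hd T₀
  have : Nontrivial (E d) := by
    have : Nonempty (Fin d) := ⟨⟨0, hd⟩⟩
    infer_instance
  let ρ : ℝ := M.meshSize / (4 * γ ^ 2)
  have hρ : 0 < ρ := by positivity
  -- Packing: the inscribed balls are disjoint and lie in one ball of radius s H + ρ, so comparing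
  -- volumes bounds their number.
  have hdisj : (S : Set (Fin M.N)).PairwiseDisjoint fun T => Metric.ball (M.center T) ρ := by
    intro T _ T' _ hTT'
    exact (M.disjoint T T' hTT').mono (ball_center_subset hd hs hu hγ T)
      (ball_center_subset hd hs hu hγ T')
  have h1 := measure_biUnion_finset (μ := (volume : Measure (E d))) hdisj
    fun T _ => Metric.isOpen_ball.measurableSet
  have h2 : ⋃ T ∈ S, Metric.ball (M.center T) ρ ⊆ Metric.ball x (s * M.meshSize + ρ) := by
    refine Set.iUnion₂_subset fun T hT y hy => ?_
    have a1 := Metric.mem_closedBall.1 (hS T hT)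
    have a2 := Metric.mem_ball.1 hy
    rw [Metric.mem_ball]
    linarith [dist_triangle y (M.center T) x]
  have h3 := measure_mono (μ := (volume : Measure (E d))) h2
  rw [h1] at h3
  simp_rw [Measure.addHaar_ball _ _ hρ.le,
    Measure.addHaar_ball (volume : Measure (E d)) x (by positivity : 0 ≤ s * M.meshSize + ρ)] at h3
  rw [Finset.sum_const, nsmul_eq_mul, ← mul_assoc] at h3
  have hv0 : volume (Metric.ball (0 : E d) 1) ≠ 0 :=
    (Metric.isOpen_ball.measure_pos _ ⟨0, by simp⟩).ne'
  have h4 := (ENNReal.mul_le_mul_iff_left hv0 measure_ball_lt_top.ne).1 h3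
  rw [finrank_euclideanSpace_fin, ← ENNReal.ofReal_natCast, ← ENNReal.ofReal_mul (by positivity),
    ENNReal.ofReal_le_ofReal_iff (by positivity)] at h4
  have e : s * M.meshSize + ρ = (1 + 4 * γ ^ 2 * s) * ρ := by
    simp only [ρ]; field_simp; ring
  rw [e, mul_pow] at h4
  exact le_of_mul_le_mul_right h4 (by positivity)

/-- The boundary of the cube is a null set, and smooth maps preserve null sets. -/
lemma ae_mem_interior_elem (hd : 0 < d) (hs : M.ShapeRegular γ) (hu : M.QuasiUniform γ)
    (hγ : 1 ≤ γ) : ∀ᵐ x, x ∈ closure Ω → ∃ T, x ∈ interior (M.elem T) := by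
  have hnull : ∀ T, volume (multilinearMap (M.vert T) '' (refCube d \ openCube d)) = 0 := fun T =>
    addHaar_image_eq_zero_of_differentiableOn_of_addHaar_eq_zero _
      ((contDiff_multilinearMap _).differentiable (by simp)).differentiableOn
      (volume_refCube_diff_openCube d)
  have h := measure_iUnion_null hnull
  filter_upwards [compl_mem_ae_iff.2 h] with x hx hxΩ
  obtain ⟨T, y, hy, rfl⟩ := M.exists_mem_elem hxΩ
  refine ⟨T, image_openCube_subset_interior hd hs hu hγ T ⟨y, ?_, rfl⟩⟩
  by_contra hyo
  exact hx (Set.mem_iUnion.2 ⟨T, y, ⟨hy, hyo⟩, rfl⟩)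

lemma interior_elem_subset (hΩ : interior (closure Ω) = Ω) (T : Fin M.N) :
    interior (M.elem T) ⊆ Ω :=
  (interior_mono (M.elem_subset T)).trans hΩ.subset

/-- The existence of the mesh forces the part of the closure outside Ω to be a null set: almost
every point of the closure is interior to an element, hence interior to the closure. -/
lemma closure_ae_le (hd : 0 < d) (hs : M.ShapeRegular γ) (hu : M.QuasiUniform γ)
    (hγ : 1 ≤ γ) (hΩ : interior (closure Ω) = Ω) : closure Ω ≤ᵐ[volume] Ω := by
  filter_upwards [ae_mem_interior_elem hd hs hu hγ] with x hx hxΩ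
  obtain ⟨T, hT⟩ := hx hxΩ
  exact interior_elem_subset hΩ T hT

/-! ### Patches -/

variable (M)

lemma patch_subset {S : Set (E d)} (hS : S ⊆ closure Ω) (k : ℕ) : M.patch k S ⊆ closure Ω := by
  cases k with
  | zero => exact hS
  | succ k => exact Set.iUnion₂_subset fun T _ => M.elem_subset T

lemma patch_subset_patch_succ {S : Set (E d)} (hS : S ⊆ closure Ω) (k : ℕ) :
    M.patch k S ⊆ M.patch (k + 1) S := by
  intro x hx
  obtain ⟨T, hT⟩ := M.exists_mem_elem (M.patch_subset hS k hx)
  exact Set.mem_iUnion₂.2 ⟨T, ⟨x, hT, hx⟩, hT⟩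

lemma subset_patch {S : Set (E d)} (hS : S ⊆ closure Ω) (k : ℕ) : S ⊆ M.patch k S := by
  induction k with
  | zero => exact le_rfl
  | succ k ih => exact ih.trans (M.patch_subset_patch_succ hS k)

lemma isClosed_patch {S : Set (E d)} (hS : IsClosed S) (k : ℕ) : IsClosed (M.patch k S) := by
  cases k with
  | zero => exact hS
  | succ k => exact (Set.toFinite _).isClosed_biUnion fun T _ => M.isClosed_elem T

lemma patch_subset_closedBall {S : Set (E d)} {c : E d} {R : ℝ} (hS : S ⊆ Metric.closedBall c R)
    (k : ℕ) : M.patch k S ⊆ Metric.closedBall c (R + k * M.meshSize) := by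
  induction k with
  | zero => simpa [patch] using hS
  | succ k ih =>
    refine Set.iUnion₂_subset fun T hT y hy => ?_
    obtain ⟨x, hxT, hx⟩ := hT
    have h1 := Metric.mem_closedBall.1 (ih hx)
    have h2 := Metric.mem_closedBall.1 (M.elem_subset_closedBall hxT hy)
    rw [Metric.mem_closedBall]
    push_cast
    linarith [dist_triangle y x c]

/-! ### Hat functions -/

/-- Conformity makes the element chosen in the definition irrelevant. -/
lemma hat_eq {z : E d} {T : Fin M.N} {y : E d} (hy : y ∈ refCube d) :
    M.hat z (multilinearMap (M.vert T) y) = nodalCoord (M.vert T) z y := by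
  have h : ∃ q : Fin M.N × E d, q.2 ∈ refCube d ∧
      multilinearMap (M.vert q.1) q.2 = multilinearMap (M.vert T) y := ⟨(T, y), hy, rfl⟩
  rw [hat, dif_pos h]
  exact M.conforming _ _ _ h.choose_spec.1 _ hy h.choose_spec.2 z

lemma hat_eq_zero_of_notMem {z x : E d} (hx : x ∉ closure Ω) : M.hat z x = 0 := by
  rw [hat, dif_neg]
  rintro ⟨⟨T, y⟩, hy, rfl⟩
  exact hx (M.elem_subset T ⟨y, hy, rfl⟩)

lemma abs_hat_le (z x : E d) : |M.hat z x| ≤ 2 ^ d := by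
  by_cases hx : x ∈ closure Ω
  · obtain ⟨T, y, hy, rfl⟩ := M.exists_mem_elem hx
    rw [M.hat_eq hy, abs_of_nonneg (nodalCoord_nonneg _ _ hy)]
    exact nodalCoord_le _ _ hy
  · rw [M.hat_eq_zero_of_notMem hx, abs_zero]; positivity

lemma nodeSupp_subset_iUnion (z : E d) :
    M.nodeSupp z ⊆ ⋃ T ∈ {T | ∃ v, M.vert T v = z}, M.elem T := by
  refine closure_minimal (fun x hx => ?_)
    ((Set.toFinite _).isClosed_biUnion fun T _ => M.isClosed_elem T)
  have hxΩ : x ∈ closure Ω := by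
    by_contra h
    exact hx (M.hat_eq_zero_of_notMem h)
  obtain ⟨T, y, hy, rfl⟩ := M.exists_mem_elem hxΩ
  rw [Function.mem_support, M.hat_eq hy] at hx
  refine Set.mem_iUnion₂.2 ⟨T, ?_, y, hy, rfl⟩
  by_contra h
  exact hx (nodalCoord_eq_zero (fun v hv => h ⟨v, hv⟩) y)

lemma nodeSupp_subset (z : E d) : M.nodeSupp z ⊆ closure Ω :=
  (M.nodeSupp_subset_iUnion z).trans (Set.iUnion₂_subset fun T _ => M.elem_subset T)

lemma isClosed_nodeSupp (z : E d) : IsClosed (M.nodeSupp z) := isClosed_tsupport _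

lemma nodeSupp_subset_closedBall (z : E d) :
    M.nodeSupp z ⊆ Metric.closedBall z M.meshSize := by
  refine (M.nodeSupp_subset_iUnion z).trans (Set.iUnion₂_subset fun T hT => ?_)
  obtain ⟨v, rfl⟩ := hT
  exact M.elem_subset_closedBall (M.vert_mem_elem T v)

lemma nodePatch_subset (ℓ : ℕ) (z : E d) : M.nodePatch ℓ z ⊆ closure Ω :=
  M.patch_subset (M.nodeSupp_subset z) ℓ

lemma isClosed_nodePatch (ℓ : ℕ) (z : E d) : IsClosed (M.nodePatch ℓ z) :=
  M.isClosed_patch (M.isClosed_nodeSupp z) ℓ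

lemma nodePatch_subset_closedBall (ℓ : ℕ) (z : E d) :
    M.nodePatch ℓ z ⊆ Metric.closedBall z ((ℓ + 1) * M.meshSize) := by
  refine (M.patch_subset_closedBall (M.nodeSupp_subset_closedBall z) ℓ).trans (le_of_eq ?_)
  congr 1; ring

lemma isClosed_localPatch (ℓ m : ℕ) (z : E d) (T : Fin M.N) : IsClosed (M.localPatch ℓ m z T) :=
  (M.isClosed_patch (M.isClosed_elem T) m).inter (M.isClosed_nodePatch ℓ z)

lemma localPatch_subset_nodePatch (ℓ m : ℕ) (z : E d) (T : Fin M.N) :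
    M.localPatch ℓ m z T ⊆ M.nodePatch ℓ z := Set.inter_subset_right

lemma localPatch_subset_closedBall (ℓ m : ℕ) (z : E d) (T : Fin M.N) :
    M.localPatch ℓ m z T ⊆ Metric.closedBall (M.center T) ((m + 1) * M.meshSize) := by
  refine Set.inter_subset_left.trans ((M.patch_subset_closedBall
    (M.elem_subset_closedBall (M.center_mem T)) m).trans (le_of_eq ?_))
  congr 1; ring

variable {M}

lemma nonempty_interior_nodeSupp (hd : 0 < d) (hs : M.ShapeRegular γ) (hu : M.QuasiUniform γ)
    (hγ : 1 ≤ γ) {z : E d} (hz : z ∈ M.nodes) : (interior (M.nodeSupp z)).Nonempty := by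
  obtain ⟨T, v, hv⟩ := hz
  refine ⟨M.center T, interior_maximal ?_ (isOpen_image_openCube hd hs hu hγ T)
    ⟨_, cubeCenter_mem d, rfl⟩⟩
  rintro _ ⟨y, hy, rfl⟩
  refine subset_tsupport _ ?_
  rw [Function.mem_support, M.hat_eq (openCube_subset_refCube d hy)]
  exact (nodalCoord_pos hv hy).ne'

/-- The hat functions are Lipschitz on each element. -/
lemma hat_lipschitz_elem {L : ℝ} (hL0 : 0 ≤ L) (hL : ∀ (vert : (Fin d → Bool) → E d) (z : E d),
      ∀ x ∈ refCube d, ∀ y ∈ refCube d,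
      |nodalCoord vert z x - nodalCoord vert z y| ≤ L * dist x y)
    (hd : 0 < d) (hs : M.ShapeRegular γ) (hu : M.QuasiUniform γ) (hγ : 1 ≤ γ) (z : E d)
    (T : Fin M.N) : ∀ x ∈ M.elem T, ∀ y ∈ M.elem T,
      |M.hat z x - M.hat z y| ≤ L * γ ^ 2 / M.meshSize * dist x y := by
  rintro _ ⟨x, hx, rfl⟩ _ ⟨y, hy, rfl⟩
  have hH := M.meshSize_pos hd T
  rw [M.hat_eq hx, M.hat_eq hy]
  refine (hL _ z x hx y hy).trans ?_
  have h := expanding hs hu hγ T x hx y hy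
  rw [div_mul_eq_mul_div, div_le_iff₀ (by positivity)] at h
  rw [div_mul_eq_mul_div, le_div_iff₀ hH]
  nlinarith

/-- The closure of Ω need not be convex, so the elementwise Lipschitz bound extends only along
segments inside it; the elements cut such a segment into finitely many closed pieces. -/
lemma hat_lipschitz_segment {z : E d} {L : ℝ} (hL : ∀ T, ∀ x ∈ M.elem T, ∀ y ∈ M.elem T,
      |M.hat z x - M.hat z y| ≤ L * dist x y) {x y : E d}
    (hxy : segment ℝ x y ⊆ closure Ω) : |M.hat z x - M.hat z y| ≤ L * dist x y := by
  let p : ℝ → E d := fun t => y + t • (x - y)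
  have hp : Continuous p := by fun_prop
  have h := abs_sub_le_of_lipschitz_on_cover (S := fun T => p ⁻¹' M.elem T)
    (fun T => (M.isClosed_elem T).preimage hp) (fun t ht => by
      have : p t ∈ segment ℝ x y := by
        rw [segment_symm, segment_eq_image']
        exact ⟨t, ht, rfl⟩
      exact Set.mem_iUnion.2 (M.exists_mem_elem (hxy this)))
    (g := fun t => M.hat z (p t)) (L := L * dist x y) (fun T s hs t ht => by
      refine (hL T _ hs _ ht).trans (le_of_eq ?_)
      have : p s - p t = (s - t) • (x - y) := by simp only [p]; module
      rw [dist_eq_norm, this, norm_smul, Real.norm_eq_abs, dist_eq_norm]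
      ring)
  simpa [p] using h

lemma continuousOn_hat {z : E d} {L : ℝ} (hL : ∀ T, ∀ x ∈ M.elem T, ∀ y ∈ M.elem T,
      |M.hat z x - M.hat z y| ≤ L * dist x y) : ContinuousOn (M.hat z) (closure Ω) := by
  have h : closure Ω = ⋃ T, M.elem T := M.cover.symm
  rw [h]
  refine (locallyFinite_of_finite _).continuousOn_iUnion M.isClosed_elem fun T => ?_
  refine (LipschitzOnWith.of_dist_le_mul (K := L.toNNReal) fun x hx y hy => ?_).continuousOn
  exact (hL T x hx y hy).trans (mul_le_mul_of_nonneg_right (Real.le_coe_toNNReal L) dist_nonneg)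

lemma measurable_hat {z : E d} {L : ℝ} (hL : ∀ T, ∀ x ∈ M.elem T, ∀ y ∈ M.elem T,
      |M.hat z x - M.hat z y| ≤ L * dist x y) : AEStronglyMeasurable (M.hat z) volume := by
  have h1 : AEStronglyMeasurable (M.hat z) (volume.restrict (closure Ω)) :=
    (continuousOn_hat hL).aestronglyMeasurable isClosed_closure.measurableSet
  have h2 := (aestronglyMeasurable_indicator_iff isClosed_closure.measurableSet).2 h1
  refine h2.congr (Eventually.of_forall fun x => ?_)
  by_cases hx : x ∈ closure Ω
  · simp [hx]
  · simp [hx, M.hat_eq_zero_of_notMem hx]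

/-- The product of a hat function with a test function is Lipschitz. -/
lemma exists_lipschitz_hat_mul {z : E d} {L : ℝ} (hL : ∀ T, ∀ x ∈ M.elem T, ∀ y ∈ M.elem T,
      |M.hat z x - M.hat z y| ≤ L * dist x y) (hL0 : 0 ≤ L) (hΩ : IsOpen Ω) {φ : E d → ℝ}
    (hφ : ContDiff ℝ ((⊤ : ℕ∞) : WithTop ℕ∞) φ) (hφc : HasCompactSupport φ)
    (hφΩ : tsupport φ ⊆ Ω) : ∃ K, LipschitzWith K fun x => M.hat z x * φ x := by
  obtain ⟨B, hB⟩ := hφc.exists_bound_of_continuous hφ.continuous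
  obtain ⟨C, hC⟩ := (hφ.of_le (m := 1) (by exact_mod_cast le_top)).lipschitzWith_of_hasCompactSupport
    hφc one_ne_zero
  obtain ⟨δ, hδ, hδΩ⟩ := hφc.isCompact.exists_thickening_subset_open hΩ hφΩ
  have hB0 : 0 ≤ B := (norm_nonneg _).trans (hB 0)
  let f : E d → ℝ := fun x => M.hat z x * φ x
  have hfB : ∀ x, |f x| ≤ 2 ^ d * B := fun x => by
    rw [abs_mul]
    exact mul_le_mul (M.abs_hat_le z x) (hB x) (abs_nonneg _) (by positivity)
  -- The first two terms are the product rule for nearby points. The third handles points at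
  -- distance at least δ, where the sup bound on f is divided by δ.
  let K : ℝ := 2 ^ d * C + B * L + 2 * (2 ^ d * B) / δ
  have hCK : 2 ^ d * C + B * L ≤ K := le_add_of_nonneg_right (by positivity)
  have key : ∀ x y, x ∈ tsupport φ → |f x - f y| ≤ K * dist x y := by
    intro x y hx
    rcases lt_or_ge (dist y x) δ with hxy | hxy
    -- The δ-ball about a point of the support of φ stays in Ω, so the segment does as well.
    · have hball : Metric.ball x δ ⊆ closure Ω := fun w hw =>
        subset_closure (hδΩ (Metric.mem_thickening_iff.2 ⟨x, hx, hw⟩))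
      have hseg : segment ℝ x y ⊆ closure Ω :=
        ((convex_ball x δ).segment_subset (Metric.mem_ball_self hδ) hxy).trans hball
      have h1 := hat_lipschitz_segment hL hseg
      have h2 := hC.dist_le_mul x y
      rw [Real.dist_eq] at h2
      have e : f x - f y = M.hat z y * (φ x - φ y) + φ x * (M.hat z x - M.hat z y) := by
        simp only [f]; ring
      calc |f x - f y| ≤ |M.hat z y| * |φ x - φ y| + |φ x| * |M.hat z x - M.hat z y| := by
            rw [e, ← abs_mul, ← abs_mul]; exact abs_add_le _ _
        _ ≤ 2 ^ d * (C * dist x y) + B * (L * dist x y) :=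
            add_le_add (mul_le_mul (M.abs_hat_le z y) h2 (abs_nonneg _) (by positivity))
              (mul_le_mul (hB x) h1 (abs_nonneg _) hB0)
        _ = (2 ^ d * C + B * L) * dist x y := by ring
        _ ≤ K * dist x y := mul_le_mul_of_nonneg_right hCK dist_nonneg
    · calc |f x - f y| ≤ |f x| + |f y| := abs_sub _ _
        _ ≤ 2 * (2 ^ d * B) := by linarith [hfB x, hfB y]
        _ = 2 * (2 ^ d * B) / δ * δ := by field_simp
        _ ≤ 2 * (2 ^ d * B) / δ * dist x y := by
            rw [dist_comm x y]
            exact mul_le_mul_of_nonneg_left hxy (by positivity)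
        _ ≤ K * dist x y := by
            refine mul_le_mul_of_nonneg_right (le_add_of_nonneg_left (by positivity)) dist_nonneg
  have hK0 : 0 ≤ K := le_trans (by positivity) hCK
  refine ⟨⟨K, hK0⟩, LipschitzWith.of_dist_le_mul fun x y => ?_⟩
  change |f x - f y| ≤ K * dist x y
  by_cases hx : x ∈ tsupport φ
  · exact key x y hx
  · by_cases hy : y ∈ tsupport φ
    · rw [abs_sub_comm, dist_comm]; exact key y x hy
    · simp only [f, image_eq_zero_of_notMem_tsupport hx, image_eq_zero_of_notMem_tsupport hy,
        mul_zero, sub_self, abs_zero]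
      positivity

/-- Multiplication by a hat function maps `H¹₀` functions to `H¹₀(ω_z)`. -/
lemma exists_hatMul (hd : 0 < d) (hs : M.ShapeRegular γ) (hu : M.QuasiUniform γ) (hγ : 1 ≤ γ)
    (hΩ : IsOpen Ω) (hΩr : interior (closure Ω) = Ω) {z : E d} {L : ℝ} (hL0 : 0 ≤ L)
    (hL : ∀ T, ∀ x ∈ M.elem T, ∀ y ∈ M.elem T, |M.hat z x - M.hat z y| ≤ L * dist x y) :
    ∃ Φ : H1Pair d →L[ℝ] H1Pair d,
      (∀ u, ∀ᵐ x, (Φ u).fst x = M.hat z x * u.fst x) ∧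
      (∀ u, (Φ u).snd =ᵐ[volume] M.hatMulGrad z u) ∧
      (∀ u, ‖(Φ u).snd‖ ≤ 2 ^ d * ‖u.snd‖ + L * ‖u.fst‖) ∧
      ∀ D ⊆ closure Ω, ∀ u ∈ H10 D, Φ u ∈ H10 (M.nodeSupp z) := by
  have hgrad : ∀ᵐ x, ‖gradient (M.hat z) x‖ ≤ L := by
    filter_upwards [ae_mem_interior_elem hd hs hu hγ] with x hx
    rw [norm_gradient]
    by_cases hxΩ : x ∈ closure Ω
    · obtain ⟨T, hT⟩ := hx hxΩ
      refine norm_fderiv_le_of_lip' ℝ hL0 ?_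
      filter_upwards [mem_interior_iff_mem_nhds.1 hT] with y hy
      rw [Real.norm_eq_abs, ← dist_eq_norm]
      exact hL T y hy x (interior_subset hT)
    · have : x ∉ tsupport (M.hat z) := fun h => hxΩ (M.nodeSupp_subset z h)
      rw [← norm_gradient, gradient_eq_zero_of_notMem_tsupport this, norm_zero]
      exact hL0
  -- Rademacher's theorem on each element; almost every point of Ω is interior to one.
  have hdiff : ∀ᵐ x, x ∈ Ω → DifferentiableAt ℝ (M.hat z) x := by
    have h1 : ∀ T, ∀ᵐ x, x ∈ M.elem T → DifferentiableWithinAt ℝ (M.hat z) (M.elem T) x := fun T =>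
      (LipschitzOnWith.of_dist_le_mul (K := L.toNNReal) fun x hx y hy =>
        (hL T x hx y hy).trans (mul_le_mul_of_nonneg_right (Real.le_coe_toNNReal L)
          dist_nonneg)).ae_differentiableWithinAt_of_mem
    filter_upwards [ae_all_iff.2 h1, ae_mem_interior_elem hd hs hu hγ] with x hx1 hx2 hxΩ
    obtain ⟨T, hT⟩ := hx2 (subset_closure hxΩ)
    exact (hx1 T (interior_subset hT)).differentiableAt (mem_interior_iff_mem_nhds.1 hT)
  have m1 : MemLp (M.hat z) ∞ volume :=
    memLp_top_of_bound (measurable_hat hL) (2 ^ d) (Eventually.of_forall (M.abs_hat_le z))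
  have m2 : MemLp (gradient (M.hat z)) ∞ volume :=
    memLp_top_of_bound (measurable_gradient _).aestronglyMeasurable L hgrad
  let Φ := mulPair (m1.toLp _) (m2.toLp _)
  have hΦ1 : ∀ u, ∀ᵐ x, (Φ u).fst x = M.hat z x * u.fst x := fun u => by
    filter_upwards [mulPair_fst (m1.toLp _) (m2.toLp _) u, m1.coeFn_toLp] with x h1 h2
    rw [h1, h2]
  have hΦ2 : ∀ u, (Φ u).snd =ᵐ[volume] M.hatMulGrad z u := fun u => by
    filter_upwards [mulPair_snd (m1.toLp _) (m2.toLp _) u, m1.coeFn_toLp, m2.coeFn_toLp]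
      with x h1 h2 h3
    rw [h1, h2, h3, hatMulGrad]
  refine ⟨Φ, hΦ1, hΦ2, fun u => ?_, fun D hD u hu => ?_⟩
  · have e : (Φ u).snd = mulLp (m1.toLp _) u.snd + mulVecLp (m2.toLp _) u.fst := rfl
    rw [e]
    refine (norm_add_le _ _).trans (add_le_add ?_ ?_)
    · refine Lp.norm_le_mul_norm_of_ae_le_mul ?_
      filter_upwards [coeFn_mulLp (m1.toLp _) u.snd, m1.coeFn_toLp] with x h1 h2
      rw [h1, h2, norm_smul]
      exact mul_le_mul_of_nonneg_right (M.abs_hat_le z x) (norm_nonneg _)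
    · refine Lp.norm_le_mul_norm_of_ae_le_mul ?_
      filter_upwards [coeFn_mulVecLp (m2.toLp _) u.fst, m2.coeFn_toLp, hgrad] with x h1 h2 h3
      rw [h1, h2, norm_smul, mul_comm]
      exact mul_le_mul_of_nonneg_right h3 (norm_nonneg _)
  · refine H10_subset_of_isClosed (S := Φ ⁻¹' (H10 (M.nodeSupp z) : Set (H1Pair d)))
      ((isClosed_H10 _).preimage Φ.continuous) ?_ hu
    rintro v ⟨φ, h1, h2, h3, h4, h5⟩
    have hφΩ : tsupport φ ⊆ Ω := by
      rw [← hΩr]; exact h3.trans (interior_mono hD)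
    obtain ⟨K, hK⟩ := exists_lipschitz_hat_mul hL hL0 hΩ h1 h2 hφΩ
    refine mem_H10_of_lipschitz hK h2.mul_left ?_ ?_ ?_
    · intro x hx
      -- The product vanishes off the support of the hat function and is continuous, so it vanishes
      -- on the closure of that complement, which is the complement of the interior.
      have hsub : (M.nodeSupp z)ᶜ ⊆ {x | M.hat z x * φ x = 0} := fun y hy => by
        have : M.hat z y = 0 := image_eq_zero_of_notMem_tsupport hy
        simp [this]
      have := closure_minimal hsub (isClosed_eq hK.continuous continuous_const)
      rw [closure_compl] at this
      exact this hx
    · filter_upwards [hΦ1 v, h4] with x e1 e2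
      rw [e1, e2]
    · filter_upwards [hΦ2 v, h4, h5, hdiff] with x e1 e2 e3 e4
      rw [e1, hatMulGrad, e2, e3]
      by_cases hx : x ∈ tsupport φ
      · rw [gradient_mul (e4 (hφΩ hx)) (h1.differentiable (by simp) x)]
      · have hx' : x ∉ tsupport fun x => M.hat z x * φ x := fun h =>
          hx (closure_mono (fun y hy => right_ne_zero_of_mul hy) h)
        rw [gradient_eq_zero_of_notMem_tsupport hx', gradient_eq_zero_of_notMem_tsupport hx,
          image_eq_zero_of_notMem_tsupport hx]
        simp

end QuadMesh

/-! ### Polynomials -/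

/-- Evaluation of a polynomial at a point of `ℝᵈ`. -/
def polyEval (P : MvPolynomial (Fin d) ℝ) (x : E d) : ℝ := MvPolynomial.eval (fun i => x i) P

lemma polyEval_add (P Q : MvPolynomial (Fin d) ℝ) (x : E d) :
    polyEval (P + Q) x = polyEval P x + polyEval Q x := by simp [polyEval]

lemma polyEval_smul (c : ℝ) (P : MvPolynomial (Fin d) ℝ) (x : E d) :
    polyEval (c • P) x = c * polyEval P x := by simp [polyEval]

lemma contDiff_polyEval (P : MvPolynomial (Fin d) ℝ) :
    ContDiff ℝ ((⊤ : ℕ∞) : WithTop ℕ∞) (polyEval P) := by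
  induction P using MvPolynomial.induction_on with
  | C a =>
    have : polyEval (MvPolynomial.C a) = fun _ : E d => a := by ext; simp [polyEval]
    rw [this]
    exact contDiff_const
  | add P Q hP hQ =>
    rw [show polyEval (P + Q) = fun x : E d => polyEval P x + polyEval Q x from
      funext (polyEval_add P Q)]
    exact hP.add hQ
  | mul_X P i hP =>
    have hi : ContDiff ℝ ((⊤ : ℕ∞) : WithTop ℕ∞) fun y : E d => y i :=
      (EuclideanSpace.proj i : E d →L[ℝ] ℝ).contDiff
    rw [show polyEval (P * MvPolynomial.X i) = fun x : E d => polyEval P x * x i by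
      ext; simp [polyEval]]
    exact hP.mul hi

/-- A sup-norm ball inside U is a product of intervals, and a polynomial vanishing on a product of
infinite sets is zero. -/
lemma eq_zero_of_polyEval_eq_zero {U : Set (E d)} (hU : IsOpen U) (hne : U.Nonempty)
    {P : MvPolynomial (Fin d) ℝ} (h : ∀ x ∈ U, polyEval P x = 0) : P = 0 := by
  obtain ⟨x, hx⟩ := hne
  have hU' : IsOpen ((EuclideanSpace.equiv (Fin d) ℝ).symm ⁻¹' U) :=
    hU.preimage (EuclideanSpace.equiv (Fin d) ℝ).symm.continuous
  have hx' : (EuclideanSpace.equiv (Fin d) ℝ) x ∈ (EuclideanSpace.equiv (Fin d) ℝ).symm ⁻¹' U := by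
    simpa using hx
  obtain ⟨ε, hε, hball⟩ := Metric.isOpen_iff.1 hU' _ hx'
  rw [ball_pi _ hε] at hball
  refine MvPolynomial.funext_set (fun i => Metric.ball ((EuclideanSpace.equiv (Fin d) ℝ) x i) ε)
    (fun i => ?_) fun y hy => ?_
  · rw [Real.ball_eq_Ioo]
    exact Set.Ioo_infinite (by linarith)
  · rw [map_zero]
    exact h _ (hball hy)

/-- The polynomial `y ↦ P (a + r y)`. -/
def rescale (a : E d) (r : ℝ) (P : MvPolynomial (Fin d) ℝ) : MvPolynomial (Fin d) ℝ :=
  MvPolynomial.aeval (fun i => MvPolynomial.C (a i) + MvPolynomial.C r * MvPolynomial.X i) P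

lemma polyEval_rescale (a : E d) (r : ℝ) (P : MvPolynomial (Fin d) ℝ) (y : E d) :
    polyEval (rescale a r P) y = polyEval P (a + r • y) := by
  unfold polyEval rescale
  induction P using MvPolynomial.induction_on with
  | C a => simp
  | add P Q hP hQ => rw [map_add, map_add, map_add, hP, hQ]
  | mul_X P i hP => rw [map_mul, map_mul, map_mul, hP]; simp

/-- The substitution is affine and acts on each variable separately, so coordinate degrees do not
grow. Estimates on the unit ball can thus be transferred to any ball. -/
lemma degreeOf_rescale_le (a : E d) (r : ℝ) {P : MvPolynomial (Fin d) ℝ} {p : ℕ}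
    (hP : ∀ i, P.degreeOf i ≤ p) (j : Fin d) : (rescale a r P).degreeOf j ≤ p := by
  classical
  have hlin : ∀ i, MvPolynomial.degreeOf j
      (MvPolynomial.C (a i) + MvPolynomial.C r * MvPolynomial.X i : MvPolynomial (Fin d) ℝ) ≤
      if i = j then 1 else 0 := by
    intro i
    refine (MvPolynomial.degreeOf_add_le _ _ _).trans ?_
    rw [MvPolynomial.degreeOf_C]
    refine max_le (Nat.zero_le _) ((MvPolynomial.degreeOf_mul_le _ _ _).trans ?_)
    rw [MvPolynomial.degreeOf_C, zero_add, MvPolynomial.degreeOf_X]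
    simp [eq_comm]
  rw [rescale, MvPolynomial.aeval_def, MvPolynomial.eval₂_eq']
  refine (MvPolynomial.degreeOf_sum_le _ _ _).trans (Finset.sup_le fun s hs => ?_)
  refine (MvPolynomial.degreeOf_mul_le _ _ _).trans ?_
  rw [MvPolynomial.algebraMap_eq, MvPolynomial.degreeOf_C, zero_add]
  refine (MvPolynomial.degreeOf_prod_le _ _ _).trans ?_
  calc _ ≤ ∑ i, s i * (if i = j then 1 else 0) :=
        Finset.sum_le_sum fun i _ => (MvPolynomial.degreeOf_pow_le _ _ _).trans
          (Nat.mul_le_mul_left _ (hlin i))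
    _ = s j := by simp
    _ ≤ p := (MvPolynomial.degreeOf_le_iff.1 (hP j)) s hs

/-! ### Norm equivalence -/

/-- The source of the constants in the inverse estimates: S ∘ T⁻¹ is bounded on the
finite-dimensional range of T. -/
lemma exists_norm_le_of_injective {V W₁ W₂ : Type*} [AddCommGroup V] [Module ℝ V]
    [FiniteDimensional ℝ V] [NormedAddCommGroup W₁] [NormedSpace ℝ W₁] [NormedAddCommGroup W₂]
    [NormedSpace ℝ W₂] (S : V →ₗ[ℝ] W₁) (T : V →ₗ[ℝ] W₂) (hT : Function.Injective T) :
    ∃ C : ℝ, 0 ≤ C ∧ ∀ v, ‖S v‖ ≤ C * ‖T v‖ := by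
  let e := LinearEquiv.ofInjective T hT
  let R : LinearMap.range T →L[ℝ] W₁ := LinearMap.toContinuousLinearMap (S ∘ₗ e.symm.toLinearMap)
  refine ⟨‖R‖, R.opNorm_nonneg, fun v => ?_⟩
  have h := R.le_opNorm (e v)
  have h1 : R (e v) = S v := by simp [R]
  rwa [h1] at h

/-- A pointwise linear family of `L²` functions as a linear map to `L²`. -/
def toLpLinear {V F : Type*} [AddCommGroup V] [Module ℝ V] [NormedAddCommGroup F]
    [NormedSpace ℝ F] (f : V → E d → F) (hf : ∀ v, MemLp (f v) 2 volume)
    (hadd : ∀ v w, f (v + w) = f v + f w) (hsmul : ∀ (c : ℝ) v, f (c • v) = c • f v) :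
    V →ₗ[ℝ] Lp F 2 (volume : Measure (E d)) where
  toFun v := (hf v).toLp
  map_add' v w := by
    rw [← MemLp.toLp_add]
    exact MemLp.toLp_congr _ _ (by rw [hadd])
  map_smul' c v := by
    rw [RingHom.id_apply, ← MemLp.toLp_const_smul]
    exact MemLp.toLp_congr _ _ (by rw [hsmul])

lemma norm_sq_toLp {F : Type*} [NormedAddCommGroup F] [InnerProductSpace ℝ F] {f : E d → F}
    (hf : MemLp f 2 volume) : ‖hf.toLp f‖ ^ 2 = ∫ x, ‖f x‖ ^ 2 := by
  rw [norm_sq_eq_integral]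
  apply integral_congr_ae
  filter_upwards [hf.coeFn_toLp] with x hx
  rw [hx]

lemma cutoff_mul_polyEval_injective {χ : E d → ℝ} (hχ : Continuous χ) (hne : ∃ x, χ x ≠ 0)
    {P : MvPolynomial (Fin d) ℝ} (h : (fun x => χ x * polyEval P x) =ᵐ[volume] 0) : P = 0 := by
  have h0 : (fun x => χ x * polyEval P x) = 0 :=
    (Continuous.ae_eq_iff_eq volume (hχ.mul (contDiff_polyEval P).continuous)
      continuous_const).1 h
  refine eq_zero_of_polyEval_eq_zero (U := {x | χ x ≠ 0})
    (isOpen_ne_fun hχ continuous_const) hne fun x hx => ?_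
  exact (mul_eq_zero.1 (congrFun h0 x)).resolve_left hx

instance (p : ℕ) : FiniteDimensional ℝ (MvPolynomial.restrictDegree (Fin d) ℝ p) := by
  have : Finite {n : Fin d →₀ ℕ | ∀ i, n i ≤ p} := by
    refine Set.Finite.to_subtype ((Set.finite_Iic (Finsupp.equivFunOnFinite.symm
      fun _ : Fin d => p)).subset fun n hn i => ?_)
    simpa using hn i
  exact Module.Finite.of_basis (MvPolynomial.basisRestrictSupport ℝ _)

/-- Inverse estimates with a cut-off function on the unit ball. -/
lemma exists_cutoff_estimate_unit (d p : ℕ) {η : E d → ℝ}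
    (hη : ContDiff ℝ ((⊤ : ℕ∞) : WithTop ℕ∞) η) (hηc : HasCompactSupport η)
    (hne : ∃ x, η x ≠ 0) :
    ∃ C : ℝ, 0 ≤ C ∧ ∀ P : MvPolynomial (Fin d) ℝ, (∀ i, P.degreeOf i ≤ p) →
      ∫ x in Metric.closedBall 0 1, polyEval P x ^ 2 ≤ C * ∫ x, (η x * polyEval P x) ^ 2 ∧
      ∫ x, ‖gradient (fun x => η x ^ 2 * polyEval P x) x‖ ^ 2 ≤
        C * ∫ x, (η x * polyEval P x) ^ 2 := by
  let V := MvPolynomial.restrictDegree (Fin d) ℝ p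
  have hs : ∀ P : MvPolynomial (Fin d) ℝ, ContDiff ℝ ((⊤ : ℕ∞) : WithTop ℕ∞)
      fun x => η x ^ 2 * polyEval P x := fun P => (hη.pow 2).mul (contDiff_polyEval P)
  have hsc : ∀ P : MvPolynomial (Fin d) ℝ, HasCompactSupport fun x => η x ^ 2 * polyEval P x :=
    fun P => (hηc.comp_left (g := fun t => t ^ 2) (by simp)).mul_right
  have m1 : ∀ P : V, MemLp ((Metric.closedBall (0 : E d) 1).indicator (polyEval P.1)) 2 volume :=
    fun P => by
    rw [memLp_indicator_iff_restrict Metric.isClosed_closedBall.measurableSet]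
    obtain ⟨B, hB⟩ := (isCompact_closedBall (0 : E d) 1).exists_bound_of_continuousOn
      (contDiff_polyEval P.1).continuous.continuousOn
    have : IsFiniteMeasure (volume.restrict (Metric.closedBall (0 : E d) 1)) :=
      ⟨by simpa using (isCompact_closedBall (0 : E d) 1).measure_lt_top⟩
    exact MemLp.of_bound (contDiff_polyEval P.1).continuous.aestronglyMeasurable B
      (ae_restrict_of_forall_mem Metric.isClosed_closedBall.measurableSet hB)
  have m2 : ∀ P : V, MemLp (fun x => η x * polyEval P.1 x) 2 volume := fun P =>
    (hη.continuous.mul (contDiff_polyEval P.1).continuous).memLp_of_hasCompactSupport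
      hηc.mul_right
  have m3 : ∀ P : V, MemLp (gradient fun x => η x ^ 2 * polyEval P.1 x) 2 volume := fun P =>
    (testFunction_memLp (hs P.1) (hsc P.1)).2
  let L1 := toLpLinear (fun (P : V) => (Metric.closedBall (0 : E d) 1).indicator (polyEval P.1)) m1
    (fun P Q => by
      rw [← Set.indicator_add']; congr 1; ext x; exact polyEval_add _ _ _)
    (fun c P => by
      ext x
      by_cases hx : x ∈ Metric.closedBall (0 : E d) 1
      · simp only [Set.indicator_of_mem hx, Pi.smul_apply]; exact polyEval_smul _ _ _
      · simp only [Set.indicator_of_notMem hx, Pi.smul_apply, smul_zero])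
  let L2' := toLpLinear (fun (P : V) x => η x * polyEval P.1 x) m2
    (fun P Q => by
      ext x; simp [polyEval_add]; ring)
    (fun c P => by
      ext x; simp [polyEval_smul]; ring)
  let L3 := toLpLinear (fun (P : V) => gradient fun x => η x ^ 2 * polyEval P.1 x) m3
    (fun P Q => by
      ext1 x
      rw [Pi.add_apply, ← gradient_add ((hs P.1).differentiable (by simp) x)
        ((hs Q.1).differentiable (by simp) x)]
      congr 1
      ext y
      simp [polyEval_add]; ring)
    (fun c P => by
      ext1 x
      rw [Pi.smul_apply, ← gradient_const_smul c ((hs P.1).differentiable (by simp) x)]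
      congr 1
      ext y
      simp [polyEval_smul]; ring)
  -- Injectivity of P ↦ η P lets its norm dominate both the norm on the unit ball and that of ∇(η²
  -- P). The weight η² occurs because η² P, paired with P, gives ∫ (η P)².
  have hinj : Function.Injective L2' := by
    rw [injective_iff_map_eq_zero]
    intro P hP
    have h1 : (m2 P).toLp _ = 0 := hP
    have h2 : (fun x => η x * polyEval P.1 x) =ᵐ[volume] 0 := by
      have h3 := (m2 P).coeFn_toLp
      rw [h1] at h3
      exact h3.symm.trans (Lp.coeFn_zero _ _ _)
    exact Subtype.ext (cutoff_mul_polyEval_injective hη.continuous hne h2)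
  obtain ⟨C1, hC1, h1⟩ := exists_norm_le_of_injective L1 L2' hinj
  obtain ⟨C3, hC3, h3⟩ := exists_norm_le_of_injective L3 L2' hinj
  refine ⟨C1 ^ 2 + C3 ^ 2, by positivity, fun P hP => ?_⟩
  let P' : V := ⟨P, (MvPolynomial.mem_restrictDegree _ _ _).2 fun s hs i =>
    MvPolynomial.degreeOf_le_iff.1 (hP i) s hs⟩
  have e1 : ‖L1 P'‖ ^ 2 = ∫ x in Metric.closedBall 0 1, polyEval P x ^ 2 := by
    refine (norm_sq_toLp (m1 P')).trans ?_
    rw [← integral_indicator Metric.isClosed_closedBall.measurableSet]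
    congr 1
    ext x
    by_cases hx : x ∈ Metric.closedBall (0 : E d) 1
    · simp only [Set.indicator_of_mem hx, Real.norm_eq_abs, sq_abs]; rfl
    · simp [Set.indicator_of_notMem hx]
  have e2 : ‖L2' P'‖ ^ 2 = ∫ x, (η x * polyEval P x) ^ 2 := by
    refine (norm_sq_toLp (m2 P')).trans ?_
    simp only [Real.norm_eq_abs, sq_abs]
    rfl
  have e3 : ‖L3 P'‖ ^ 2 = ∫ x, ‖gradient (fun x => η x ^ 2 * polyEval P x) x‖ ^ 2 :=
    norm_sq_toLp (m3 P')
  rw [← e1, ← e2, ← e3]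
  have i1 := pow_le_pow_left₀ (norm_nonneg _) (h1 P') 2
  have i3 := pow_le_pow_left₀ (norm_nonneg _) (h3 P') 2
  rw [mul_pow] at i1 i3
  have hn := sq_nonneg ‖L2' P'‖
  constructor <;> nlinarith [mul_nonneg (sq_nonneg C1) hn, mul_nonneg (sq_nonneg C3) hn]

lemma integral_comp_scale (f : E d → ℝ) (a : E d) {r : ℝ} (hr : 0 < r) :
    ∫ x, f (r⁻¹ • (x - a)) = r ^ d * ∫ x, f x := by
  rw [integral_sub_right_eq_self (fun x => f (r⁻¹ • x)) a, Measure.integral_comp_inv_smul,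
    finrank_euclideanSpace_fin, abs_of_pos (by positivity), smul_eq_mul]

lemma gradient_comp_scale {f : E d → ℝ} (hf : Differentiable ℝ f) (a : E d) (r : ℝ) (x : E d) :
    gradient (fun x => f (r⁻¹ • (x - a))) x = r⁻¹ • gradient f (r⁻¹ • (x - a)) := by
  have h1 : HasFDerivAt (fun x : E d => r⁻¹ • (x - a)) (r⁻¹ • ContinuousLinearMap.id ℝ (E d)) x :=
    ((hasFDerivAt_id x).sub_const a).const_smul r⁻¹
  have h2 := (hf (r⁻¹ • (x - a))).hasFDerivAt.comp x h1
  have h3 : fderiv ℝ (fun x => f (r⁻¹ • (x - a))) x =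
      r⁻¹ • fderiv ℝ f (r⁻¹ • (x - a)) := by
    refine h2.fderiv.trans ?_
    ext v
    simp
  simp only [gradient]
  rw [h3, map_smul]

/-- Inverse estimates for polynomials on balls, with a test function supported in a smaller
ball. -/
lemma exists_cutoff_estimate (d p : ℕ) {c : ℝ} (hc : 0 < c) :
    ∃ C : ℝ, 0 ≤ C ∧ ∀ (a : E d) (r : ℝ), 0 < r → ∀ P : MvPolynomial (Fin d) ℝ,
      (∀ i, P.degreeOf i ≤ p) → ∃ w : E d → ℝ, ContDiff ℝ ((⊤ : ℕ∞) : WithTop ℕ∞) w ∧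
        HasCompactSupport w ∧ tsupport w ⊆ Metric.ball a (c * r) ∧
        ∫ x in Metric.closedBall a r, polyEval P x ^ 2 ≤ C * ∫ x, w x * polyEval P x ∧
        ∫ x, ‖gradient w x‖ ^ 2 ≤ C * (r⁻¹) ^ 2 * ∫ x, w x * polyEval P x := by
  -- Outer radius c / 2, so that after scaling the closed support still lies in the open ball of
  -- radius c r.
  let b : ContDiffBump (0 : E d) := ⟨c / 4, c / 2, by positivity, by linarith⟩
  let η : E d → ℝ := b
  have hη : ContDiff ℝ ((⊤ : ℕ∞) : WithTop ℕ∞) η := b.contDiff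
  have hηc : HasCompactSupport η := b.hasCompactSupport
  have hne : ∃ x, η x ≠ 0 := ⟨0, by
    rw [show η 0 = 1 from b.one_of_mem_closedBall (Metric.mem_closedBall_self (by positivity))]
    exact one_ne_zero⟩
  obtain ⟨C, hC, hest⟩ := exists_cutoff_estimate_unit d p hη hηc hne
  refine ⟨C, hC, fun a r hr P hP => ?_⟩
  let Q := rescale a r P
  obtain ⟨h1, h2⟩ := hest Q (degreeOf_rescale_le a r hP)
  have hback : ∀ x, polyEval P x = polyEval Q (r⁻¹ • (x - a)) := fun x => by
    rw [polyEval_rescale, smul_smul, mul_inv_cancel₀ hr.ne', one_smul, add_sub_cancel]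
  let W : E d → ℝ := fun y => η y ^ 2 * polyEval Q y
  have hW : ContDiff ℝ ((⊤ : ℕ∞) : WithTop ℕ∞) W := (hη.pow 2).mul (contDiff_polyEval Q)
  let w : E d → ℝ := fun x => W (r⁻¹ • (x - a))
  have hsupp : tsupport w ⊆ Metric.closedBall a (c / 2 * r) := by
    refine closure_minimal (fun x hx => ?_) Metric.isClosed_closedBall
    have h3 : η (r⁻¹ • (x - a)) ≠ 0 := fun h => hx (by simp [w, W, h])
    have h4 : r⁻¹ • (x - a) ∈ Metric.ball (0 : E d) (c / 2) := by
      rw [← b.support_eq]; exact h3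
    rw [mem_ball_zero_iff, norm_smul, norm_inv, Real.norm_of_nonneg hr.le, inv_mul_lt_iff₀ hr] at h4
    rw [mem_closedBall_iff_norm]
    linarith
  have hint : ∫ x, w x * polyEval P x = r ^ d * ∫ x, (η x * polyEval Q x) ^ 2 := by
    rw [← integral_comp_scale _ a hr]
    congr 1
    ext x
    rw [hback]
    simp only [w, W]
    ring
  refine ⟨w, hW.comp ((contDiff_id.sub contDiff_const).const_smul r⁻¹),
    (isCompact_closedBall a (c / 2 * r)).of_isClosed_subset (isClosed_tsupport _) hsupp,
    hsupp.trans (Metric.closedBall_subset_ball (by nlinarith)), ?_, ?_⟩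
  · have e : ∫ x in Metric.closedBall a r, polyEval P x ^ 2 =
        r ^ d * ∫ x in Metric.closedBall 0 1, polyEval Q x ^ 2 := by
      rw [← integral_indicator Metric.isClosed_closedBall.measurableSet,
        ← integral_indicator Metric.isClosed_closedBall.measurableSet,
        ← integral_comp_scale _ a hr]
      congr 1
      ext x
      have hiff : x ∈ Metric.closedBall a r ↔ r⁻¹ • (x - a) ∈ Metric.closedBall (0 : E d) 1 := by
        rw [mem_closedBall_zero_iff, mem_closedBall_iff_norm, norm_smul, norm_inv,
          Real.norm_of_nonneg hr.le, inv_mul_le_iff₀ hr, mul_one]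
      by_cases hx : x ∈ Metric.closedBall a r
      · rw [Set.indicator_of_mem hx, Set.indicator_of_mem (hiff.1 hx), hback]
      · rw [Set.indicator_of_notMem hx, Set.indicator_of_notMem fun h => hx (hiff.2 h)]
    rw [e, hint]
    calc _ ≤ r ^ d * (C * ∫ x, (η x * polyEval Q x) ^ 2) :=
          mul_le_mul_of_nonneg_left h1 (by positivity)
      _ = _ := by ring
  · have e : ∫ x, ‖gradient w x‖ ^ 2 = (r⁻¹) ^ 2 * (r ^ d * ∫ x, ‖gradient W x‖ ^ 2) := by
      rw [← integral_comp_scale _ a hr, ← integral_const_mul]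
      congr 1
      ext x
      rw [gradient_comp_scale (hW.differentiable (by simp)), norm_smul, mul_pow, norm_inv,
        Real.norm_of_nonneg hr.le]
    rw [e, hint]
    calc _ ≤ (r⁻¹) ^ 2 * (r ^ d * (C * ∫ x, (η x * polyEval Q x) ^ 2)) :=
          mul_le_mul_of_nonneg_left (mul_le_mul_of_nonneg_left h2 (by positivity)) (by positivity)
      _ = _ := by ring

/-! ### Subspaces of `H¹₀` of prescribed dimension -/

/-- Multiplication by a bump function embeds all polynomials into the function components. -/
lemma not_finiteDimensional_H10 (hd : 0 < d) {ω : Set (E d)} (hω : (interior ω).Nonempty) :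
    ¬ FiniteDimensional ℝ (H10 ω) := by
  intro hfin
  obtain ⟨a, ha⟩ := hω
  obtain ⟨r, hr, hball⟩ := Metric.isOpen_iff.1 isOpen_interior a ha
  let b : ContDiffBump a := ⟨r / 4, r / 2, by positivity, by linarith⟩
  let η : E d → ℝ := b
  have hη : ContDiff ℝ ((⊤ : ℕ∞) : WithTop ℕ∞) η := b.contDiff
  have hηc : HasCompactSupport η := b.hasCompactSupport
  have hs : ∀ P : MvPolynomial (Fin d) ℝ, ContDiff ℝ ((⊤ : ℕ∞) : WithTop ℕ∞)
      fun x => η x * polyEval P x := fun P => hη.mul (contDiff_polyEval P)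
  have hts : ∀ P : MvPolynomial (Fin d) ℝ, tsupport (fun x => η x * polyEval P x) ⊆
      interior ω := fun P => by
    refine Set.Subset.trans ?_ (Set.Subset.trans (Metric.closedBall_subset_ball (ε₁ := r / 2)
      (by linarith)) hball)
    exact (tsupport_mul_subset_left).trans b.tsupport_eq.subset
  have m : ∀ P : MvPolynomial (Fin d) ℝ, MemLp (fun x => η x * polyEval P x) 2 volume := fun P =>
    (testFunction_memLp (hs P) hηc.mul_right).1
  let L := toLpLinear (fun (P : MvPolynomial (Fin d) ℝ) x => η x * polyEval P x) m
    (fun P Q => by ext x; simp [polyEval_add]; ring)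
    (fun c P => by ext x; simp [polyEval_smul]; ring)
  have hinj : Function.Injective L := by
    rw [injective_iff_map_eq_zero]
    intro P hP
    have h1 : (m P).toLp _ = 0 := hP
    have h2 : (fun x => η x * polyEval P x) =ᵐ[volume] 0 := by
      have h3 := (m P).coeFn_toLp
      rw [h1] at h3
      exact h3.symm.trans (Lp.coeFn_zero _ _ _)
    refine cutoff_mul_polyEval_injective hη.continuous ⟨a, ?_⟩ h2
    rw [show η a = 1 from b.one_of_mem_closedBall (Metric.mem_closedBall_self (by positivity))]
    exact one_ne_zero
  have hle : LinearMap.range L ≤ (H10 ω).map (WithLp.fstL 2 ℝ (L2 d)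
      (Lp (E d) 2 (volume : Measure (E d)))).toLinearMap := by
    rintro _ ⟨P, rfl⟩
    obtain ⟨u, hu, hu1, -⟩ := exists_testPair (hs P) hηc.mul_right (hts P)
    exact ⟨u, testPairs_subset_H10 ω hu, Lp.ext (hu1.trans (m P).coeFn_toLp.symm)⟩
  have hfin2 : FiniteDimensional ℝ (LinearMap.range L) :=
    Submodule.finiteDimensional_of_le hle
  have hfin3 : Module.Finite ℝ (MvPolynomial (Fin d) ℝ) :=
    Module.Finite.equiv (LinearEquiv.ofInjective L hinj).symm
  have : Finite (Fin d →₀ ℕ) := Module.Finite.finite_basis (MvPolynomial.basisMonomials (Fin d) ℝ)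
  have : Nonempty (Fin d) := ⟨⟨0, hd⟩⟩
  exact not_finite (Fin d →₀ ℕ)

/-- The width asks for spaces of dimension exactly n, so a smaller approximation space has to be
enlarged. -/
lemma exists_finrank_eq {V : Type*} [AddCommGroup V] [Module ℝ V] {S : Submodule ℝ V}
    (hS : ¬ FiniteDimensional ℝ S) {Q₀ : Submodule ℝ V} [FiniteDimensional ℝ Q₀] (hQ₀ : Q₀ ≤ S)
    {n : ℕ} (hn : Module.finrank ℝ Q₀ ≤ n) :
    ∃ Q : Submodule ℝ V, Q₀ ≤ Q ∧ Q ≤ S ∧ FiniteDimensional ℝ Q ∧ Module.finrank ℝ Q = n := by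
  induction n, hn using Nat.le_induction with
  | base => exact ⟨Q₀, le_rfl, hQ₀, inferInstance, rfl⟩
  | succ n _ ih =>
    obtain ⟨Q, h1, h2, h3, h4⟩ := ih
    have hne : ¬ S ≤ Q := fun h => hS (Submodule.finiteDimensional_of_le h)
    obtain ⟨v, hvS, hvQ⟩ := SetLike.not_le_iff_exists.1 hne
    refine ⟨Q ⊔ Submodule.span ℝ {v}, h1.trans le_sup_left,
      sup_le h2 ((Submodule.span_singleton_le_iff_mem v S).2 hvS), inferInstance, ?_⟩
    have hv0 : v ≠ 0 := fun h => hvQ (h ▸ Q.zero_mem)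
    have hdisj : Q ⊓ Submodule.span ℝ {v} = ⊥ :=
      disjoint_iff.1 ((Submodule.disjoint_span_singleton' hv0).2 hvQ)
    have := Submodule.finrank_sup_add_finrank_inf_eq Q (Submodule.span ℝ {v})
    rw [hdisj, finrank_bot, add_zero, finrank_span_singleton hv0, h4] at this
    exact this

/-! ### Pairings, overlapping restrictions and localized solutions -/

lemma setIntegral_mul_eq_inner {ω : Set (E d)} {g : L2 d} (hg : ∀ᵐ x, x ∉ ω → g x = 0)
    (f : L2 d) : ∫ x in ω, g x * f x = inner ℝ g f := by
  rw [L2.inner_def, setIntegral_eq_integral_of_ae_compl_eq_zero]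
  · simp [mul_comm]
  · filter_upwards [hg] with x hx hxω
    rw [hx hxω, zero_mul]

/-- Overlap of restrictions. -/
lemma sum_norm_sq_restrictPair_le {ι : Type*} (S : Finset ι) {ω : ι → Set (E d)}
    (hω : ∀ i, MeasurableSet (ω i)) {N : ℝ}
    (hN : ∀ x, ∀ S' ⊆ S, (∀ i ∈ S', x ∈ ω i) → (S'.card : ℝ) ≤ N) (u : H1Pair d) :
    ∑ i ∈ S, ‖restrictPair (ω i) u‖ ^ 2 ≤ N * ‖u‖ ^ 2 := by
  classical
  let f : E d → ℝ := fun x => ‖u.fst x‖ ^ 2 + ‖u.snd x‖ ^ 2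
  have hf : Integrable f volume := (integrable_norm_sq u.fst).add (integrable_norm_sq u.snd)
  have hf0 : ∀ x, 0 ≤ f x := fun x => by positivity
  have hnorm : ‖u‖ ^ 2 = ∫ x, f x := by
    rw [WithLp.prod_norm_sq_eq_of_L2, norm_sq_eq_integral, norm_sq_eq_integral]
    exact (integral_add (integrable_norm_sq u.fst) (integrable_norm_sq u.snd)).symm
  have hres : ∀ i, ‖restrictPair (ω i) u‖ ^ 2 = ∫ x, (ω i).indicator f x := by
    intro i
    rw [WithLp.prod_norm_sq_eq_of_L2, norm_sq_eq_integral, norm_sq_eq_integral,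
      ← integral_add (integrable_norm_sq _) (integrable_norm_sq _)]
    obtain ⟨h1, h2⟩ := restrictPair_spec (hω i) u
    apply integral_congr_ae
    filter_upwards [h1, h2] with x e1 e2
    rw [e1, e2]
    by_cases hx : x ∈ ω i <;> simp [hx, f]
  simp_rw [hres, hnorm]
  rw [← integral_finsetSum _ fun i _ => hf.indicator (hω i), ← integral_const_mul]
  refine integral_mono (integrable_finsetSum _ fun i _ => hf.indicator (hω i))
    (hf.const_mul N) fun x => ?_
  -- Pointwise, the sum of the restrictions counts the sets that contain x.
  have e : ∑ i ∈ S, (ω i).indicator f x = ((S.filter fun i => x ∈ ω i).card : ℝ) * f x := by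
    simp only [Set.indicator_apply]
    rw [← Finset.sum_filter, Finset.sum_const, nsmul_eq_mul]
  simp only
  rw [e]
  exact mul_le_mul_of_nonneg_right (hN x _ (Finset.filter_subset _ _)
    fun i hi => (Finset.mem_filter.1 hi).2) (hf0 x)

/-- The effect of localizing the solution operator: the error is a pairing of the source with a
harmonic function. -/
lemma energyForm_localized {D ω : Set (E d)} {α β : ℝ} {A : E d → Matrix (Fin d) (Fin d) ℝ}
    (hA : IsCoefficient D α β A) (hα : 0 < α) (hβ : 0 ≤ β) (hD : MeasurableSet D)
    (hω : MeasurableSet ω) (hωD : ω ⊆ D)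
    {g : L2 d} (hg : ∀ᵐ x, x ∉ ω → g x = 0) {φ : H1Pair d} (hφ : IsSolution A ω g φ)
    {u y : H1Pair d} (hy : IsHarmonicExtension A ω (restrictPair ω u) y) :
    energyForm A D φ.snd u.snd = inner ℝ g u.fst - inner ℝ g y.fst := by
  have hAω : IsCoefficient ω α β A := hA.mono (Eventually.of_forall hωD)
  obtain ⟨hr1, hr2⟩ := restrictPair_spec hω u
  set r := restrictPair ω u
  have h1 : energyForm A D φ.snd u.snd = energyForm A ω φ.snd r.snd := by
    have e1 : energyForm A D φ.snd u.snd = energyForm A ω φ.snd u.snd := by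
      refine setIntegral_eq_of_subset_of_ae_sdiff_eq_zero hD.nullMeasurableSet hωD ?_
      filter_upwards [snd_eq_zero_of_mem_H10 hφ.1] with x hx hxD
      rw [hx hxD.2, map_zero, inner_zero_left]
    rw [e1]
    apply setIntegral_congr_ae hω
    filter_upwards [hr2] with x hx hxω
    rw [hx, Set.indicator_of_mem hxω]
  have h2 : energyForm A ω φ.snd y.snd = 0 := by
    rw [hAω.energyForm_symm]; exact hy.2 φ hφ.1
  -- The difference y - r is admissible in the equation of φ; as y is harmonic, a(φ, y) = 0, and
  -- only -a(φ, r) is left of the energy.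
  have h3 := hφ.2 _ hy.1
  rw [setIntegral_mul_eq_inner hg, ← hAω.energyL_apply hα.le hβ, WithLp.sub_snd, map_sub,
    hAω.energyL_apply, hAω.energyL_apply, h2, WithLp.sub_fst, inner_sub_right] at h3
  have h4 : inner ℝ g r.fst = inner ℝ g u.fst := by
    rw [L2.inner_def, L2.inner_def]
    apply integral_congr_ae
    filter_upwards [hr1, hg] with x e1 e2
    by_cases hx : x ∈ ω
    · rw [e1, Set.indicator_of_mem hx]
    · rw [e2 hx, inner_zero_left, inner_zero_left]
  rw [h1]
  linarith

/-! ### The inverse estimate for piecewise polynomial sources -/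

namespace QuadMesh

/-- Inverse estimate: the source of a solution is controlled by its energy. -/
lemma exists_inverse_estimate (hd : 0 < d) (p : ℕ) {γ : ℝ} (hγ : 1 ≤ γ) :
    ∃ C : ℝ, 0 ≤ C ∧ ∀ {Ω : Set (E d)} (M : QuadMesh d Ω), M.ShapeRegular γ → M.QuasiUniform γ →
      ∀ {α β : ℝ} {A : E d → Matrix (Fin d) (Fin d) ℝ} {D : Set (E d)}, 0 ≤ α → 0 ≤ β →
      IsCoefficient D α β A → (D ⊆ ⋃ T ∈ M.elemsIn D, M.elem T) → ∀ q ∈ M.polySpace p D,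
      ∀ u, IsSolution A D q u → ‖q‖ ≤ C * β * M.meshSize⁻¹ * ‖u.snd‖ := by
  have hc : (0 : ℝ) < 1 / (4 * γ ^ 2) := by positivity
  obtain ⟨C, hC, hcut⟩ := exists_cutoff_estimate d p hc
  refine ⟨C, hC, fun {Ω} M hs hu {α β A D} hα hβ hA hD q hq u hsol => ?_⟩
  -- Without elements the supremum H is 0 by convention, but then D is empty and q = 0.
  rcases isEmpty_or_nonempty (Fin M.N) with hN | ⟨⟨T₀⟩⟩
  · have hDe : D = ∅ := by
      refine Set.eq_empty_of_subset_empty (hD.trans ?_)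
      simp
    have : q = 0 := by
      refine Lp.ext ?_
      have h1 := hq.2
      rw [hDe, Set.compl_empty, Measure.restrict_univ] at h1
      exact h1.trans (Lp.coeFn_zero _ _ _).symm
    rw [this, norm_zero]
    have : 0 ≤ M.meshSize := by
      rw [meshSize, Real.iSup_of_isEmpty]
    positivity
  have hH := M.meshSize_pos hd T₀
  set H := M.meshSize
  choose P hPdeg hPq using hq.1
  -- Each w T is supported in the ball inscribed in T, while its pairing with the polynomial
  -- controls that polynomial on the ball of radius H about the centre, hence on all of T.
  choose w hw1 hw2 hw3 hw4 hw5 using fun T => hcut (M.center T) H hH (P T) (hPdeg T)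
  have hball : ∀ T, tsupport (w T) ⊆ interior (M.elem T) := fun T => by
    refine (hw3 T).trans (Set.Subset.trans (le_of_eq ?_) (ball_center_subset hd hs hu hγ T))
    congr 1
    simp only [H]
    ring
  choose W hW hWfst hWsnd using fun T => exists_testPair (hw1 T) (hw2 T) (hball T)
  let S := M.elemsIn D
  have hSD : ∀ T ∈ S, M.elem T ⊆ D := fun T hT => by
    simpa [S, elemsIn] using hT
  have hWD : ∀ T ∈ S, W T ∈ H10 D := fun T hT =>
    H10_mono (hSD T hT) (testPairs_subset_H10 _ (hW T))
  have hnull : ∀ᵐ x, x ∉ D → q x = 0 := by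
    have h1 := hq.2
    rw [Filter.EventuallyEq, ae_restrict_iff'₀] at h1
    · exact h1
    · have hDm : NullMeasurableSet D volume := by
        have : D = ⋃ T ∈ S, M.elem T :=
          hD.antisymm (Set.iUnion₂_subset fun T hT => hSD T hT)
        rw [this]
        exact (S.measurableSet_biUnion fun T _ => (M.isClosed_elem T).measurableSet).nullMeasurableSet
      exact hDm.compl
  have hPq' : ∀ T, ∀ᵐ x, x ∈ M.elem T → q x = polyEval (P T) x := fun T =>
    (ae_restrict_iff' (M.isClosed_elem T).measurableSet).1 (hPq T)
  let X : Fin M.N → ℝ := fun T => ∫ x, w T x * polyEval (P T) x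
  have hpair : ∀ T ∈ S, ∫ x in D, q x * (W T).fst x = X T := by
    intro T hT
    rw [setIntegral_mul_eq_inner hnull, L2.inner_def]
    apply integral_congr_ae
    filter_upwards [hPq' T, hWfst T] with x e1 e2
    rw [e2]
    by_cases hx : x ∈ M.elem T
    · rw [e1 hx]; simp
    · have : w T x = 0 := image_eq_zero_of_notMem_tsupport fun h => hx (interior_subset (hball T h))
      simp [this]
  let s := ∑ T ∈ S, (W T).snd
  have horth : ∀ T T', T ≠ T' → inner ℝ (W T).snd (W T').snd = 0 := by
    intro T T' hTT'
    rw [L2.inner_def]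
    refine integral_eq_zero_of_ae ?_
    filter_upwards [hWsnd T, hWsnd T'] with x e1 e2
    rw [e1, e2]
    by_cases hx : x ∈ tsupport (w T)
    · have hx' : x ∉ tsupport (w T') := fun h =>
        (Set.disjoint_left.1 (M.disjoint T T' hTT')) (hball T hx) (hball T' h)
      rw [gradient_eq_zero_of_notMem_tsupport hx', inner_zero_right]; rfl
    · rw [gradient_eq_zero_of_notMem_tsupport hx, inner_zero_left]; rfl
  have hs1 : ‖s‖ ^ 2 ≤ C * H⁻¹ ^ 2 * ∑ T ∈ S, X T := by
    rw [← real_inner_self_eq_norm_sq, sum_inner, Finset.mul_sum]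
    refine Finset.sum_le_sum fun T hT => ?_
    rw [inner_sum, Finset.sum_eq_single T (fun T' _ h => horth T T' h.symm)
      (fun h => absurd hT h), real_inner_self_eq_norm_sq, norm_sq_eq_integral]
    refine le_trans (le_of_eq (integral_congr_ae ?_)) (hw5 T)
    filter_upwards [hWsnd T] with x hx
    rw [hx]
  -- The sum of the X T is the pairing of q with ∑ w T, which the equation turns into the energy
  -- pairing of u with that sum.
  have hs2 : ∑ T ∈ S, X T ≤ β * ‖u.snd‖ * ‖s‖ := by
    have e : ∑ T ∈ S, X T = hA.energyL hα hβ u.snd s := by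
      rw [map_sum]
      refine Finset.sum_congr rfl fun T hT => ?_
      rw [hA.energyL_apply, hsol.2 _ (hWD T hT), hpair T hT]
    rw [e]
    exact (le_abs_self _).trans (hA.abs_energyForm_le hα hβ _ _)
  have hq2 : ‖q‖ ^ 2 ≤ C * ∑ T ∈ S, X T := by
    rw [norm_sq_eq_integral, Finset.mul_sum]
    have hmeas : ∀ T, MeasurableSet (M.elem T) := fun T => (M.isClosed_elem T).measurableSet
    calc ∫ x, ‖q x‖ ^ 2 ≤ ∫ x, ∑ T ∈ S, (M.elem T).indicator (fun x => ‖q x‖ ^ 2) x := by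
          refine integral_mono_ae (integrable_norm_sq q) (integrable_finsetSum _ fun T _ =>
            (integrable_norm_sq q).indicator (hmeas T)) ?_
          filter_upwards [hnull] with x hx
          have hnn : ∀ T ∈ S, 0 ≤ (M.elem T).indicator (fun x => ‖q x‖ ^ 2) x := fun T _ =>
            Set.indicator_nonneg (fun _ _ => by positivity) _
          by_cases hxD : x ∈ D
          · obtain ⟨T, hT, hxT⟩ := Set.mem_iUnion₂.1 (hD hxD)
            refine le_trans (le_of_eq ?_) (Finset.single_le_sum hnn hT)
            rw [Set.indicator_of_mem hxT]
          · rw [hx hxD]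
            simpa using Finset.sum_nonneg hnn
      _ = ∑ T ∈ S, ∫ x in M.elem T, ‖q x‖ ^ 2 := by
          rw [integral_finsetSum _ fun T _ => (integrable_norm_sq q).indicator (hmeas T)]
          exact Finset.sum_congr rfl fun T _ => integral_indicator (hmeas T)
      _ ≤ ∑ T ∈ S, C * X T := by
          refine Finset.sum_le_sum fun T _ => le_trans ?_ (hw4 T)
          have e : ∫ x in M.elem T, ‖q x‖ ^ 2 = ∫ x in M.elem T, polyEval (P T) x ^ 2 := by
            refine setIntegral_congr_ae (hmeas T) ?_
            filter_upwards [hPq' T] with x hx hxT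
            rw [hx hxT, Real.norm_eq_abs, sq_abs]
          rw [e]
          refine setIntegral_mono_set ?_ (Eventually.of_forall fun x => sq_nonneg _)
            (LE.le.eventuallyLE (M.elem_subset_closedBall (M.center_mem T)))
          exact ((contDiff_polyEval (P T)).continuous.pow 2).continuousOn.integrableOn_compact
            (isCompact_closedBall _ _)
  have hHi : 0 < H⁻¹ := inv_pos.2 hH
  have hU := norm_nonneg u.snd
  -- The bound of ‖s‖² by ∑ X T and the bound of ∑ X T by ‖s‖ close up; one factor ‖s‖ cancels.
  have hs3 : ‖s‖ ≤ C * H⁻¹ ^ 2 * (β * ‖u.snd‖) := by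
    rcases (norm_nonneg s).eq_or_lt with h0 | h0
    · rw [← h0]; positivity
    · have h1 : ‖s‖ ^ 2 ≤ C * H⁻¹ ^ 2 * (β * ‖u.snd‖ * ‖s‖) :=
        hs1.trans (mul_le_mul_of_nonneg_left hs2 (by positivity))
      by_contra hcon
      push Not at hcon
      nlinarith
  refine abs_le_of_sq_le_sq' ?_ (by positivity) |>.2
  calc ‖q‖ ^ 2 ≤ C * (β * ‖u.snd‖ * ‖s‖) := hq2.trans (mul_le_mul_of_nonneg_left hs2 hC)
    _ ≤ C * (β * ‖u.snd‖ * (C * H⁻¹ ^ 2 * (β * ‖u.snd‖))) := by gcongr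
    _ = (C * β * H⁻¹ * ‖u.snd‖) ^ 2 := by ring

/-! ### Singular value decompositions -/

variable {Ω : Set (E d)} {M : QuadMesh d Ω}

lemma polySpace_mono {p : ℕ} {ω ω' : Set (E d)} (h : ω ⊆ ω') :
    M.polySpace p ω ⊆ M.polySpace p ω' := fun _ hq =>
  ⟨hq.1, ae_restrict_of_ae_restrict_of_subset (Set.compl_subset_compl.2 h) hq.2⟩

lemma ae_eq_zero_of_mem_polySpace {p : ℕ} {ω : Set (E d)} (hω : MeasurableSet ω) {q : L2 d}
    (hq : q ∈ M.polySpace p ω) : ∀ᵐ x, x ∉ ω → q x = 0 :=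
  (ae_restrict_iff' hω.compl).1 hq.2

/-- T belongs to its own patch; hence the natural-number subtraction K - J is a genuine one. -/
lemma polyDim_le_svdRank {p ℓ m : ℕ} {z : E d} {T : Fin M.N}
    (hT : T ∈ M.elemsIn (M.nodePatch ℓ z)) : polyDim d p ≤ M.svdRank p ℓ m z T := by
  have h : T ∈ M.elemsIn (M.localPatch ℓ m z T) := by
    simp only [elemsIn, Finset.mem_filter, Finset.mem_univ, true_and] at hT ⊢
    exact Set.subset_inter (M.subset_patch (M.elem_subset T) m) hT
  exact Nat.le_mul_of_pos_right _ (Finset.card_pos.2 ⟨T, h⟩)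

lemma polyDim_pos (d p : ℕ) : 0 < polyDim d p := Nat.pow_pos (Nat.succ_pos p)

/-- As q_k is piecewise polynomial, y may be replaced by its projection; orthonormality in the
expansion leaves σ_k (y, w_k). Source terms have index k ≥ K - J, and the singular values decrease.
-/
lemma IsLocalSVD.abs_inner_le {A : E d → Matrix (Fin d) (Fin d) ℝ} {p ℓ m : ℕ} {z : E d}
    {T : Fin M.N} {σ : ℕ → ℝ} {q : ℕ → L2 d} {w : ℕ → H1Pair d}
    (h : M.IsLocalSVD A p ℓ m z T σ q w) (hT : T ∈ M.elemsIn (M.nodePatch ℓ z)) {j : ℕ}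
    (hj : j < polyDim d p) {y : H1Pair d}
    (hy : y ∈ harmonicSpace A (M.nodePatch ℓ z) (M.localPatch ℓ m z T)) :
    |inner ℝ (M.sourceTerm p ℓ m z T q j) y.fst| ≤
      σ (M.svdRank p ℓ m z T - polyDim d p) * ‖y‖ := by
  have hK := polyDim_le_svdRank (p := p) (m := m) hT
  set K := M.svdRank p ℓ m z T
  have hk : K - polyDim d p + j < K := by omega
  set k := K - polyDim d p + j with hkdef
  have hmem : q k ∈ M.polySpace p (closure Ω) :=
    polySpace_mono ((M.localPatch_subset_nodePatch ℓ m z T).trans (M.nodePatch_subset ℓ z))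
      (h.left_mem k hk)
  have h1 := (h.expansion y hy).2 (q k) hmem
  rw [sum_inner, Finset.sum_eq_single k] at h1
  · rw [inner_smul_left, h.left_orthonormal k hk k hk, if_pos rfl, mul_one,
      RCLike.conj_to_real] at h1
    have h2 : M.sourceTerm p ℓ m z T q j = q k := rfl
    rw [h2, real_inner_comm, ← h1, abs_mul, abs_of_nonneg (h.nonneg k hk)]
    -- The right singular vector is normalized only when σ_k ≠ 0.
    by_cases h0 : σ k = 0
    · rw [h0, zero_mul]
      exact mul_nonneg (h.nonneg _ (by omega)) (norm_nonneg _)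
    · have h3 : ‖w k‖ = 1 := by
        have h4 := h.right_orthonormal k hk k hk h0 h0
        rw [if_pos rfl, real_inner_self_eq_norm_sq] at h4
        nlinarith [norm_nonneg (w k)]
      have h5 := abs_real_inner_le_norm y (w k)
      rw [h3, mul_one] at h5
      exact mul_le_mul (h.antitone _ _ (by omega) hk) h5 (abs_nonneg _) (h.nonneg _ (by omega))
  · intro i hi hik
    rw [inner_smul_left, h.left_orthonormal i (Finset.mem_range.1 hi) k hk, if_neg hik, mul_zero]
  · intro hcon
    exact absurd (Finset.mem_range.2 hk) hcon

/-- A real supremum dominates its members only for sets bounded above; here the set is finite, since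
nodes and elements are. -/
lemma le_sigmaTilde {p ℓ m : ℕ} (σ : E d → Fin M.N → ℕ → ℝ) {z : E d} (hz : z ∈ M.nodes)
    {T : Fin M.N} (hT : T ∈ M.elemsIn (M.nodePatch ℓ z)) :
    σ z T (M.svdRank p ℓ m z T - polyDim d p) ≤ M.sigmaTilde p ℓ m σ := by
  refine le_csSup (Set.Finite.bddAbove ?_) ⟨z, hz, T, hT, rfl⟩
  have hnodes : M.nodes.Finite := by
    refine (Set.finite_range fun a : Fin M.N × (Fin d → Bool) => M.vert a.1 a.2).subset ?_
    rintro _ ⟨T, v, rfl⟩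
    exact ⟨(T, v), rfl⟩
  refine ((hnodes.prod (Set.finite_univ (α := Fin M.N))).image
    fun a => σ a.1 a.2 (M.svdRank p ℓ m a.1 a.2 - polyDim d p)).subset ?_
  rintro s ⟨z, hz, T, -, rfl⟩
  exact ⟨(z, T), ⟨hz, Set.mem_univ _⟩, rfl⟩

/-- Holds also when there are no nodes, because the supremum of the empty set of reals is 0. -/
lemma sigmaTilde_nonneg {A : E d → Matrix (Fin d) (Fin d) ℝ} {p ℓ m : ℕ}
    {σ : E d → Fin M.N → ℕ → ℝ} {q : E d → Fin M.N → ℕ → L2 d} {w : E d → Fin M.N → ℕ → H1Pair d}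
    (h : ∀ z ∈ M.nodes, ∀ T ∈ M.elemsIn (M.nodePatch ℓ z),
      M.IsLocalSVD A p ℓ m z T (σ z T) (q z T) (w z T)) : 0 ≤ M.sigmaTilde p ℓ m σ := by
  refine Real.sSup_nonneg ?_
  rintro s ⟨z, hz, T, hT, rfl⟩
  refine (h z hz T hT).nonneg _ ?_
  have := polyDim_le_svdRank (p := p) (m := m) hT
  have := polyDim_pos d p
  omega

/-- Coefficients indexed by pairs, as in the Riesz inequality, even if some of the vectors coincide.
-/
lemma exists_coeff_of_mem_span {ι V : Type*} [AddCommGroup V] [Module ℝ V]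
    {S : Finset ι} {J : ℕ} {g : ι → ℕ → V} {x : V}
    (hx : x ∈ Submodule.span ℝ {v | ∃ i ∈ S, ∃ j < J, v = g i j}) :
    ∃ c : ι → ℕ → ℝ, x = ∑ i ∈ S, ∑ j ∈ Finset.range J, c i j • g i j := by
  classical
  induction hx using Submodule.span_induction with
  | mem v hv =>
    obtain ⟨i, hi, j, hj, rfl⟩ := hv
    refine ⟨fun i' j' => if i' = i ∧ j' = j then 1 else 0, ?_⟩
    rw [Finset.sum_eq_single i, Finset.sum_eq_single j]
    · simp
    · intro j' _ hj'; simp [hj']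
    · intro h; exact absurd (Finset.mem_range.2 hj) h
    · intro i' _ hi'; simp [hi']
    · intro h; exact absurd hi h
  | zero => exact ⟨0, by simp⟩
  | add u v _ _ hu hv =>
    obtain ⟨c, rfl⟩ := hu
    obtain ⟨c', rfl⟩ := hv
    exact ⟨c + c', by simp [add_smul, Finset.sum_add_distrib]⟩
  | smul a u _ hu =>
    obtain ⟨c, rfl⟩ := hu
    exact ⟨a • c, by simp [Finset.smul_sum, smul_smul]⟩

/-- The elements of `𝒱_{H,z}^ℓ` are solutions with piecewise polynomial sources. -/
lemma exists_source_of_mem_localSpace {A : E d → Matrix (Fin d) (Fin d) ℝ} {p ℓ : ℕ} {z : E d}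
    {α β : ℝ} (hA : IsCoefficient (M.nodePatch ℓ z) α β A) (hα : 0 ≤ α) (hβ : 0 ≤ β)
    {S : Submodule ℝ (L2 d)} (hS : (S : Set (L2 d)) = M.polySpace p (M.nodePatch ℓ z))
    {v : H1Pair d} (hv : v ∈ M.localSpace A p ℓ z) :
    ∃ q ∈ S, IsSolution A (M.nodePatch ℓ z) q v := by
  have hzero : ∀ q ∈ S, ∀ᵐ x, x ∉ M.nodePatch ℓ z → q x = 0 := fun q hq =>
    ae_eq_zero_of_mem_polySpace (p := p) (M.isClosed_nodePatch ℓ z).measurableSet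
      (by rw [← hS]; exact hq)
  have hiff : ∀ q ∈ S, ∀ u, IsSolution A (M.nodePatch ℓ z) q u ↔ u ∈ H10 (M.nodePatch ℓ z) ∧
      ∀ t ∈ H10 (M.nodePatch ℓ z), hA.energyL hα hβ u.snd t.snd = inner ℝ q t.fst := by
    intro q hq u
    refine and_congr Iff.rfl (forall₂_congr fun t _ => ?_)
    rw [setIntegral_mul_eq_inner (hzero q hq), hA.energyL_apply]
  induction hv using Submodule.span_induction with
  | mem u hu =>
    obtain ⟨q, hq, hsol⟩ := hu
    exact ⟨q, by rw [← hS] at hq; exact hq, hsol⟩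
  | zero =>
    refine ⟨0, S.zero_mem, (hiff 0 S.zero_mem 0).2 ⟨Submodule.zero_mem _, fun t _ => ?_⟩⟩
    rw [inner_zero_left, WithLp.zero_snd, map_zero]
    rfl
  | add u v _ _ hu hv =>
    obtain ⟨q, hq, hqu⟩ := hu
    obtain ⟨q', hq', hqv⟩ := hv
    rw [hiff q hq] at hqu
    rw [hiff q' hq'] at hqv
    refine ⟨q + q', S.add_mem hq hq', (hiff _ (S.add_mem hq hq') _).2
      ⟨Submodule.add_mem _ hqu.1 hqv.1, fun t ht => ?_⟩⟩
    rw [inner_add_left, WithLp.add_snd, map_add, add_apply, hqu.2 t ht, hqv.2 t ht]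
  | smul a u _ hu =>
    obtain ⟨q, hq, hqu⟩ := hu
    rw [hiff q hq] at hqu
    refine ⟨a • q, S.smul_mem a hq, (hiff _ (S.smul_mem a hq) _).2
      ⟨Submodule.smul_mem _ a hqu.1, fun t ht => ?_⟩⟩
    rw [real_inner_smul_left, WithLp.smul_snd, map_smul, smul_apply, hqu.2 t ht, smul_eq_mul]

end QuadMesh

/-! ### The localization error and the count of contributing patches -/

namespace QuadMesh

variable {Ω : Set (E d)} {M : QuadMesh d Ω} {γ α β : ℝ} {A : E d → Matrix (Fin d) (Fin d) ℝ}

/-- For ℓ > 0 the patch is a union of elements by construction, whereas the zeroth patch is given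
only as a topological support. -/
lemma nodePatch_subset_iUnion_elemsIn {ℓ : ℕ} (hℓ : 0 < ℓ) (z : E d) :
    M.nodePatch ℓ z ⊆ ⋃ T ∈ M.elemsIn (M.nodePatch ℓ z), M.elem T := by
  obtain ⟨k, rfl⟩ := Nat.exists_eq_succ_of_ne_zero hℓ.ne'
  refine Set.iUnion₂_subset fun T hT => ?_
  refine Set.subset_iUnion₂_of_subset T ?_ le_rfl
  simp only [elemsIn, Finset.mem_filter, Finset.mem_univ, true_and]
  exact Set.subset_iUnion₂_of_subset T hT le_rfl

/-- Cauchy–Schwarz over pairs; each r i occurs J times. -/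
lemma sum_sum_abs_mul_le {ι : Type*} (S : Finset ι) (J : ℕ) (c : ι → ℕ → ℝ) (r : ι → ℝ) :
    ∑ i ∈ S, ∑ j ∈ Finset.range J, |c i j| * r i ≤
      √(∑ i ∈ S, ∑ j ∈ Finset.range J, c i j ^ 2) * √(J * ∑ i ∈ S, r i ^ 2) := by
  have h := Real.sum_mul_le_sqrt_mul_sqrt (S ×ˢ Finset.range J) (fun a => |c a.1 a.2|)
    fun a => r a.1
  simp only [Finset.sum_product, sq_abs] at h
  refine h.trans (le_of_eq ?_)
  congr 2
  simp [Finset.mul_sum]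

/-- The localization error of the source terms in the energy norm. -/
lemma localization_error_le (hd : 0 < d) (hs : M.ShapeRegular γ) (hu : M.QuasiUniform γ)
    (hγ : 1 ≤ γ) {p ℓ m : ℕ} {z : E d} (hα : 0 < α) (hβ : 0 ≤ β)
    (hA : IsCoefficient (M.nodePatch ℓ z) α β A)
    {R : ℝ} (hR : 0 ≤ R) (hΩR : closure Ω ⊆ Metric.closedBall 0 R)
    {σ : Fin M.N → ℕ → ℝ} {q : Fin M.N → ℕ → L2 d} {w : Fin M.N → ℕ → H1Pair d}
    (hsvd : ∀ T ∈ M.elemsIn (M.nodePatch ℓ z), M.IsLocalSVD A p ℓ m z T (σ T) (q T) (w T))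
    {s : ℝ} (hs0 : 0 ≤ s) (hσ : ∀ T ∈ M.elemsIn (M.nodePatch ℓ z),
      σ T (M.svdRank p ℓ m z T - polyDim d p) ≤ s)
    {φ : Fin M.N → ℕ → H1Pair d} (hφ : ∀ T j, IsSolution A (M.localPatch ℓ m z T)
      (M.sourceTerm p ℓ m z T (q T) j) (φ T j)) (c : Fin M.N → ℕ → ℝ)
    (hQ : ∑ T ∈ M.elemsIn (M.nodePatch ℓ z), ∑ j ∈ Finset.range (polyDim d p),
      c T j • M.sourceTerm p ℓ m z T (q T) j ∈ M.polySpace p (M.nodePatch ℓ z)) {v : H1Pair d}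
    (hv : IsSolution A (M.nodePatch ℓ z) (∑ T ∈ M.elemsIn (M.nodePatch ℓ z),
      ∑ j ∈ Finset.range (polyDim d p), c T j • M.sourceTerm p ℓ m z T (q T) j) v)
    {e : H1Pair d} (he : e = v - ∑ T ∈ M.elemsIn (M.nodePatch ℓ z),
      ∑ j ∈ Finset.range (polyDim d p), c T j • φ T j) :
    e ∈ H10 (M.nodePatch ℓ z) ∧ ‖e.snd‖ ≤ α⁻¹ * (s * (1 + (2 * R + 1) * (β / α)) *
      √(polyDim d p * (1 + 4 * γ ^ 2 * (m + 1)) ^ d) * (2 * R + 1) *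
      √(∑ T ∈ M.elemsIn (M.nodePatch ℓ z), ∑ j ∈ Finset.range (polyDim d p), c T j ^ 2)) := by
  set D := M.nodePatch ℓ z
  set S := M.elemsIn D
  set J := polyDim d p
  let ω : Fin M.N → Set (E d) := fun T => M.localPatch ℓ m z T
  let g : Fin M.N → ℕ → L2 d := fun T j => M.sourceTerm p ℓ m z T (q T) j
  have hDm : MeasurableSet D := (M.isClosed_nodePatch ℓ z).measurableSet
  have hωm : ∀ T, MeasurableSet (ω T) := fun T => (M.isClosed_localPatch ℓ m z T).measurableSet
  have hωD : ∀ T, ω T ⊆ D := fun T => M.localPatch_subset_nodePatch ℓ m z T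
  have hDR : D ⊆ Metric.closedBall 0 R := (M.nodePatch_subset ℓ z).trans hΩR
  have hg : ∀ T ∈ S, ∀ j < J, ∀ᵐ x, x ∉ ω T → g T j x = 0 := fun T hT j hj =>
    ae_eq_zero_of_mem_polySpace (hωm T) ((hsvd T hT).left_mem _ (by
      have := polyDim_le_svdRank (p := p) (m := m) hT
      omega))
  have heD : e ∈ H10 D := by
    rw [he]
    refine Submodule.sub_mem _ hv.1 (Submodule.sum_mem _ fun T _ => Submodule.sum_mem _ fun j _ =>
      Submodule.smul_mem _ _ (H10_mono (hωD T) (hφ T j).1))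
  refine ⟨heD, ?_⟩
  have hAω : ∀ T, IsCoefficient (ω T) α β A := fun T => hA.mono (Eventually.of_forall (hωD T))
  -- Here y T is the harmonic function on the patch of T with the trace of the error e, so it
  -- belongs to the space on which the singular value decomposition acts.
  choose y hy hynorm using fun T => (hAω T).exists_isHarmonicExtension hd hα hβ hR
    ((hωD T).trans hDR) (restrictPair (ω T) e)
  set C1 := 1 + (2 * R + 1) * (β / α)
  have hC1 : 0 ≤ C1 := by positivity
  let Q : L2 d := ∑ T ∈ S, ∑ j ∈ Finset.range J, c T j • g T j
  have hQ0 : ∀ᵐ x, x ∉ D → Q x = 0 := ae_eq_zero_of_mem_polySpace hDm hQ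
  -- a(v, e) equals the pairing of the full source with e and cancels the first term of each
  -- localized energy; only pairings with harmonic functions survive.
  have henergy : energyForm A D e.snd e.snd =
      ∑ T ∈ S, ∑ j ∈ Finset.range J, c T j * inner ℝ (g T j) (y T).fst := by
    have h1 : energyForm A D v.snd e.snd = inner ℝ Q e.fst := by
      rw [hv.2 e heD, setIntegral_mul_eq_inner hQ0]
    let ψ : H1Pair d →L[ℝ] ℝ := (hA.energyL hα.le hβ).flip e.snd ∘L WithLp.sndL 2 ℝ _ _
    have hψ : ∀ t : H1Pair d, ψ t = energyForm A D t.snd e.snd := fun _ => rfl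
    have h2 : energyForm A D e.snd e.snd = ψ v -
        ∑ T ∈ S, ∑ j ∈ Finset.range J, c T j * ψ (φ T j) := by
      rw [← hψ]
      conv_lhs => rw [he]
      rw [map_sub, map_sum]
      congr 1
      refine Finset.sum_congr rfl fun T _ => ?_
      rw [map_sum]
      exact Finset.sum_congr rfl fun j _ => by rw [map_smul, smul_eq_mul]
    rw [h2, hψ, h1, sum_inner, ← Finset.sum_sub_distrib]
    refine Finset.sum_congr rfl fun T hT => ?_
    rw [sum_inner, ← Finset.sum_sub_distrib]
    refine Finset.sum_congr rfl fun j hj => ?_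
    rw [real_inner_smul_left, hψ, energyForm_localized hA hα hβ hDm (hωm T) (hωD T)
      (hg T hT j (Finset.mem_range.1 hj)) (hφ T j) (hy T)]
    ring
  have hyb : ∀ T ∈ S, ∀ j < J, |inner ℝ (g T j) (y T).fst| ≤
      s * C1 * ‖restrictPair (ω T) e‖ := fun T hT j hj => by
    have h1 := (hsvd T hT).abs_inner_le hT hj
      ⟨e, heD, _, restrictPair_spec (hωm T) e, hy T⟩
    refine h1.trans ?_
    rw [mul_assoc]
    exact mul_le_mul (hσ T hT) (hynorm T) (norm_nonneg _) hs0
  -- A point x in the patch of T is within (m + 1) H of the centre of T, so the packing bound limits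
  -- how many patches contain x.
  have hoverlap : ∑ T ∈ S, ‖restrictPair (ω T) e‖ ^ 2 ≤
      (1 + 4 * γ ^ 2 * (m + 1)) ^ d * ‖e‖ ^ 2 := by
    refine sum_norm_sq_restrictPair_le S hωm (fun x S' _ hS' => ?_) e
    refine card_le_of_center_mem hd hs hu hγ (x := x) (by positivity) fun T hT => ?_
    have h1 := M.localPatch_subset_closedBall ℓ m z T (hS' T hT)
    rw [Metric.mem_closedBall, dist_comm] at h1
    exact h1
  have hen : ‖e‖ ≤ (2 * R + 1) * ‖e.snd‖ := norm_le_of_mem_H10 hd hDR heD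
  set N : ℝ := (1 + 4 * γ ^ 2 * (m + 1)) ^ d
  have hN : 0 ≤ N := by positivity
  set c2 := ∑ T ∈ S, ∑ j ∈ Finset.range J, c T j ^ 2
  have hmain : α * ‖e.snd‖ ^ 2 ≤ s * C1 * (√c2 * (√(J * N) * ((2 * R + 1) * ‖e.snd‖))) := by
    calc α * ‖e.snd‖ ^ 2 ≤ energyForm A D e.snd e.snd :=
          hA.le_energyForm_self hα.le hβ _ (snd_eq_zero_of_mem_H10 heD)
      _ ≤ ∑ T ∈ S, ∑ j ∈ Finset.range J, |c T j| * (s * C1 * ‖restrictPair (ω T) e‖) := by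
          rw [henergy]
          refine Finset.sum_le_sum fun T hT => Finset.sum_le_sum fun j hj => ?_
          refine (le_abs_self _).trans ?_
          rw [abs_mul]
          exact mul_le_mul_of_nonneg_left (hyb T hT j (Finset.mem_range.1 hj)) (abs_nonneg _)
      _ = s * C1 * ∑ T ∈ S, ∑ j ∈ Finset.range J, |c T j| * ‖restrictPair (ω T) e‖ := by
          simp only [Finset.mul_sum]
          exact Finset.sum_congr rfl fun T _ => Finset.sum_congr rfl fun j _ => by ring
      _ ≤ s * C1 * (√c2 * √(J * ∑ T ∈ S, ‖restrictPair (ω T) e‖ ^ 2)) :=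
          mul_le_mul_of_nonneg_left (sum_sum_abs_mul_le S J c _) (by positivity)
      _ ≤ s * C1 * (√c2 * (√(J * N) * ((2 * R + 1) * ‖e.snd‖))) := by
          refine mul_le_mul_of_nonneg_left (mul_le_mul_of_nonneg_left ?_ (Real.sqrt_nonneg _))
            (by positivity)
          refine le_trans (Real.sqrt_le_sqrt (mul_le_mul_of_nonneg_left hoverlap
            (Nat.cast_nonneg J))) ?_
          rw [← mul_assoc, Real.sqrt_mul (by positivity), Real.sqrt_sq (norm_nonneg _)]
          exact mul_le_mul_of_nonneg_left hen (Real.sqrt_nonneg _)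
  rw [inv_mul_eq_div, le_div_iff₀ hα]
  rcases (norm_nonneg e.snd).eq_or_lt with h0 | h0
  · rw [← h0, zero_mul]; positivity
  · refine le_of_mul_le_mul_right ?_ h0
    calc ‖e.snd‖ * α * ‖e.snd‖ = α * ‖e.snd‖ ^ 2 := by ring
      _ ≤ _ := hmain
      _ = _ := by ring

lemma sqrt_mul_pow_le {J : ℕ} {a b x : ℝ} (ha : 0 ≤ a) (hx : 0 ≤ x) (hb : 0 ≤ b)
    (h : b ≤ a * x) : √(J * b ^ d) ≤ √(J * a ^ d) * x ^ ((d : ℝ) / 2) := by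
  have h1 : x ^ ((d : ℝ) / 2) = √(x ^ d) := by
    rw [Real.sqrt_eq_rpow, ← Real.rpow_natCast, ← Real.rpow_mul hx]
    congr 1
    ring
  rw [h1, ← Real.sqrt_mul (by positivity)]
  apply Real.sqrt_le_sqrt
  rw [mul_assoc, ← mul_pow]
  exact mul_le_mul_of_nonneg_left (pow_le_pow_left₀ hb h d) (Nat.cast_nonneg J)

/-- Products of hat functions with local responses away from the node vanish. -/
lemma hatMul_eq_zero {z : E d} {Φ : H1Pair d →L[ℝ] H1Pair d}
    (h1 : ∀ u, ∀ᵐ x, (Φ u).fst x = M.hat z x * u.fst x)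
    (h2 : ∀ u, (Φ u).snd =ᵐ[volume] M.hatMulGrad z u) {ω : Set (E d)}
    (hω : ¬ (ω ∩ M.nodeSupp z).Nonempty) {u : H1Pair d} (hu : u ∈ H10 ω) : Φ u = 0 := by
  have hhat : ∀ x ∈ ω, M.hat z x = 0 ∧ gradient (M.hat z) x = 0 := fun x hx => by
    have hx' : x ∉ tsupport (M.hat z) := fun h => hω ⟨x, hx, h⟩
    exact ⟨image_eq_zero_of_notMem_tsupport hx', gradient_eq_zero_of_notMem_tsupport hx'⟩
  apply pair_ext
  · filter_upwards [h1 u, fst_eq_zero_of_mem_H10 hu, ae_pair_zero.1] with x e1 e2 e3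
    rw [e1, e3]
    by_cases hx : x ∈ ω
    · rw [(hhat x hx).1, zero_mul]
    · rw [e2 hx, mul_zero]
  · filter_upwards [h2 u, fst_eq_zero_of_mem_H10 hu, snd_eq_zero_of_mem_H10 hu, ae_pair_zero.2]
      with x e1 e2 e3 e4
    rw [e1, e4, hatMulGrad]
    by_cases hx : x ∈ ω
    · rw [(hhat x hx).1, (hhat x hx).2, zero_smul, smul_zero, add_zero]
    · rw [e2 hx, e3 hx, zero_smul, smul_zero, add_zero]

/-- The number of local patches that meet the support of a hat function. -/
lemma card_localPatch_le (hd : 0 < d) (hs : M.ShapeRegular γ) (hu : M.QuasiUniform γ)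
    (hγ : 1 ≤ γ) {ℓ m : ℕ} (hm : 1 ≤ m) {z : E d} {S : Finset (Fin M.N)}
    (hS : ∀ T ∈ S, (M.localPatch ℓ m z T ∩ M.nodeSupp z).Nonempty) :
    (S.card : ℝ) ≤ (13 * γ ^ 2) ^ d * (m : ℝ) ^ d := by
  have hm' : (1 : ℝ) ≤ m := by exact_mod_cast hm
  -- The centre of T is within (m + 1) H of a common point of patch and support, and that point is
  -- within H of z.
  have h1 := card_le_of_center_mem hd hs hu hγ (S := S) (x := z) (s := m + 2) (by positivity)
    fun T hT => by
      obtain ⟨x, hx1, hx2⟩ := hS T hT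
      have e1 := Metric.mem_closedBall.1 (M.localPatch_subset_closedBall ℓ m z T hx1)
      have e2 := Metric.mem_closedBall.1 (M.nodeSupp_subset_closedBall z hx2)
      rw [dist_comm] at e1
      rw [Metric.mem_closedBall]
      linarith [dist_triangle (M.center T) x z]
  refine h1.trans ?_
  rw [← mul_pow]
  refine pow_le_pow_left₀ (by positivity) ?_ d
  have hγ2 : 1 ≤ γ ^ 2 := one_le_pow₀ hγ
  -- 1 + 4 γ² (m + 2) ≤ 13 γ² m, as γ² ≥ 1 and m ≥ 1.
  nlinarith

end QuadMesh

/-! ### The bound of the local width -/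

namespace QuadMesh

variable {Ω : Set (E d)} {M : QuadMesh d Ω} {γ α β : ℝ} {A : E d → Matrix (Fin d) (Fin d) ℝ}

/-- The bound of the local width at a node. -/
lemma localWidth_le (hd : 0 < d) (hs : M.ShapeRegular γ) (hu : M.QuasiUniform γ) (hγ : 1 ≤ γ)
    (hΩ : IsOpen Ω) (hΩr : interior (closure Ω) = Ω) {p ℓ m : ℕ} (hm : 1 ≤ m) (hmℓ : m < ℓ)
    {z : E d} (hz : z ∈ M.nodes) (hα : 0 < α) (hβ : 0 ≤ β) (hA : IsCoefficient Ω α β A)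
    {R : ℝ} (hR : 0 ≤ R) (hΩR : closure Ω ⊆ Metric.closedBall 0 R)
    {L₀ : ℝ} (hL₀ : 0 ≤ L₀) (hL : ∀ (vert : (Fin d → Bool) → E d) (z : E d),
      ∀ x ∈ refCube d, ∀ y ∈ refCube d,
      |nodalCoord vert z x - nodalCoord vert z y| ≤ L₀ * dist x y)
    {Ci : ℝ} (hCi : 0 ≤ Ci) (hinv : ∀ q ∈ M.polySpace p (M.nodePatch ℓ z), ∀ u,
      IsSolution A (M.nodePatch ℓ z) q u → ‖q‖ ≤ Ci * β * M.meshSize⁻¹ * ‖u.snd‖)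
    {σ : Fin M.N → ℕ → ℝ} {q : Fin M.N → ℕ → L2 d} {w : Fin M.N → ℕ → H1Pair d}
    (hsvd : ∀ T ∈ M.elemsIn (M.nodePatch ℓ z), M.IsLocalSVD A p ℓ m z T (σ T) (q T) (w T))
    {s : ℝ} (hs0 : 0 ≤ s) (hσ : ∀ T ∈ M.elemsIn (M.nodePatch ℓ z),
      σ T (M.svdRank p ℓ m z T - polyDim d p) ≤ s) {Cr : ℝ} (hCr : 0 < Cr)
    (hspan : (Submodule.span ℝ {g | ∃ T ∈ M.elemsIn (M.nodePatch ℓ z), ∃ j < polyDim d p,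
        g = M.sourceTerm p ℓ m z T (q T) j} : Set (L2 d)) = M.polySpace p (M.nodePatch ℓ z))
    (hriesz : ∀ c : Fin M.N → ℕ → ℝ,
      Cr⁻¹ * ∑ T ∈ M.elemsIn (M.nodePatch ℓ z), ∑ j ∈ Finset.range (polyDim d p), c T j ^ 2 ≤
        ‖∑ T ∈ M.elemsIn (M.nodePatch ℓ z), ∑ j ∈ Finset.range (polyDim d p),
          c T j • M.sourceTerm p ℓ m z T (q T) j‖ ^ 2)
    {n : ℕ} (hn : (polyDim d p * (13 * γ ^ 2) ^ d) * (m : ℝ) ^ d ≤ n) :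
    M.localWidth A p n ℓ z ≤ ENNReal.ofReal
      ((√β * (2 ^ d + 4 * L₀ * γ ^ 2) * (α⁻¹ * (1 + (2 * R + 1) * (β / α)) *
        √(polyDim d p * (9 * γ ^ 2) ^ d) * (2 * R + 1)) * (Ci * β) * (√α)⁻¹) *
        ℓ * (m : ℝ) ^ ((d : ℝ) / 2) * M.meshSize⁻¹ * Cr ^ (1 / 2 : ℝ) * s) := by
  classical
  have hH : 0 < M.meshSize := by
    obtain ⟨T, -⟩ := hz
    exact M.meshSize_pos hd T
  have hAcl : IsCoefficient (closure Ω) α β A := hA.mono (closure_ae_le hd hs hu hγ hΩr)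
  have hAD : IsCoefficient (M.nodePatch ℓ z) α β A :=
    hAcl.mono (Eventually.of_forall (M.nodePatch_subset ℓ z))
  have hAz : IsCoefficient (M.nodeSupp z) α β A :=
    hAcl.mono (Eventually.of_forall (M.nodeSupp_subset z))
  have hLz : ∀ T, ∀ x ∈ M.elem T, ∀ y ∈ M.elem T,
      |M.hat z x - M.hat z y| ≤ L₀ * γ ^ 2 / M.meshSize * dist x y :=
    fun T => hat_lipschitz_elem hL₀ hL hd hs hu hγ z T
  obtain ⟨Φ, hΦ1, hΦ2, hΦ3, hΦ4⟩ :=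
    exists_hatMul hd hs hu hγ hΩ hΩr (by positivity : 0 ≤ L₀ * γ ^ 2 / M.meshSize) hLz
  have hloc : ∀ T, M.localPatch ℓ m z T ⊆ closure Ω := fun T =>
    (M.localPatch_subset_nodePatch ℓ m z T).trans (M.nodePatch_subset ℓ z)
  have hex : ∀ T j, ∃ φ, IsSolution A (M.localPatch ℓ m z T)
      (M.sourceTerm p ℓ m z T (q T) j) φ := fun T j =>
    (hAcl.mono (Eventually.of_forall (hloc T))).exists_isSolution hd hα hβ hR
      ((hloc T).trans hΩR) _
  choose φ hφ using hex
  set S := M.elemsIn (M.nodePatch ℓ z)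
  set J := polyDim d p
  -- Only patches meeting the support of the hat function give nonzero products, which keeps the
  -- dimension of order m^d independently of ℓ.
  let S' := S.filter fun T => (M.localPatch ℓ m z T ∩ M.nodeSupp z).Nonempty
  let Q₀ : Submodule ℝ (H1Pair d) :=
    Submodule.span ℝ (((S' ×ˢ Finset.range J).image fun a => Φ (φ a.1 a.2) : Finset (H1Pair d)) :
      Set (H1Pair d))
  have hQ₀ : Q₀ ≤ H10 (M.nodeSupp z) := by
    refine Submodule.span_le.2 fun x hx => ?_
    rw [Finset.mem_coe] at hx
    obtain ⟨a, -, rfl⟩ := Finset.mem_image.1 hx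
    exact hΦ4 _ (hloc a.1) _ (hφ a.1 a.2).1
  have hfin : Module.finrank ℝ Q₀ ≤ n := by
    have h1 : Module.finrank ℝ Q₀ ≤ S'.card * J :=
      (finrank_span_finset_le_card _).trans (Finset.card_image_le.trans
        (by rw [Finset.card_product, Finset.card_range]))
    have h2 := card_localPatch_le hd hs hu hγ hm (S := S') fun T hT => (Finset.mem_filter.1 hT).2
    have h3 : ((S'.card * J : ℕ) : ℝ) ≤ n := by
      push_cast
      calc (S'.card : ℝ) * J ≤ ((13 * γ ^ 2) ^ d * (m : ℝ) ^ d) * J :=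
            mul_le_mul_of_nonneg_right h2 (Nat.cast_nonneg J)
        _ = J * (13 * γ ^ 2) ^ d * (m : ℝ) ^ d := by ring
        _ ≤ n := hn
    exact h1.trans (by exact_mod_cast h3)
  obtain ⟨Q, hQ1, hQ2, hQ3, hQ4⟩ := exists_finrank_eq
    (not_finiteDimensional_H10 hd (nonempty_interior_nodeSupp hd hs hu hγ hz)) hQ₀ hfin
  refine iInf₂_le_of_le Q ⟨hQ2, hQ3, hQ4⟩ (iSup₂_le fun v hv => ?_)
  obtain ⟨f, hf, hvsol⟩ := exists_source_of_mem_localSpace hAD hα.le hβ hspan hv.1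
  have hfp : f ∈ M.polySpace p (M.nodePatch ℓ z) := by rw [← hspan]; exact hf
  obtain ⟨c, rfl⟩ := exists_coeff_of_mem_span hf
  have hfinv := hinv _ hfp v hvsol
  set e := v - ∑ T ∈ S, ∑ j ∈ Finset.range J, c T j • φ T j with he
  obtain ⟨heD, hebound⟩ := localization_error_le hd hs hu hγ hα hβ hAD hR hΩR hsvd hs0 hσ hφ c
    hfp hvsol he
  let W : H1Pair d := Φ (∑ T ∈ S, ∑ j ∈ Finset.range J, c T j • φ T j)
  have hWQ : W ∈ Q := by
    simp only [W, map_sum, map_smul]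
    refine Submodule.sum_mem _ fun T hT => Submodule.sum_mem _ fun j hj =>
      Submodule.smul_mem _ _ ?_
    by_cases hne : (M.localPatch ℓ m z T ∩ M.nodeSupp z).Nonempty
    · refine hQ1 (Submodule.subset_span ?_)
      exact Finset.mem_coe.2 (Finset.mem_image.2 ⟨(T, j), Finset.mem_product.2
        ⟨Finset.mem_filter.2 ⟨hT, hne⟩, hj⟩, rfl⟩)
    · rw [hatMul_eq_zero hΦ1 hΦ2 hne (hφ T j).1]
      exact Q.zero_mem
  refine iInf₂_le_of_le W hWQ (ENNReal.ofReal_le_ofReal ?_)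
  have hnum : energyNorm A (M.nodeSupp z) (fun x => M.hatMulGrad z v x - W.snd x) =
      energyNorm A (M.nodeSupp z) (Φ e).snd := by
    have h1 : (fun x => M.hatMulGrad z v x - W.snd x) =ᵐ[volume] (Φ e).snd := by
      have h2 : Φ e = Φ v - W := by rw [he, map_sub]
      rw [h2]
      filter_upwards [(ae_pair_sub (Φ v) W).2, hΦ2 v] with x e1 e2
      rw [e1, e2]
    rw [energyNorm, energyNorm, energyForm_congr h1 h1]
  rw [hnum]
  have hℓ : (1 : ℝ) ≤ ℓ := by exact_mod_cast (by omega : 1 ≤ ℓ)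
  have hm' : (1 : ℝ) ≤ m := by exact_mod_cast hm
  have hγ2 : 1 ≤ γ ^ 2 := one_le_pow₀ hγ
  have hnum2 : energyNorm A (M.nodeSupp z) (Φ e).snd ≤
      √β * (2 ^ d + 4 * L₀ * γ ^ 2) * ℓ * ‖e.snd‖ := by
    -- The patch lies in a ball of radius (ℓ + 1) H about z. This H cancels the 1 / H from the
    -- gradient of the hat function and leaves the factor ℓ.
    have h1 := friedrichs hd (M.nodePatch_subset_closedBall ℓ z) heD
    have h2 : L₀ * γ ^ 2 / M.meshSize * ‖e.fst‖ ≤ 4 * L₀ * γ ^ 2 * ℓ * ‖e.snd‖ := by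
      calc L₀ * γ ^ 2 / M.meshSize * ‖e.fst‖
          ≤ L₀ * γ ^ 2 / M.meshSize * (2 * ((ℓ + 1) * M.meshSize) * ‖e.snd‖) :=
            mul_le_mul_of_nonneg_left h1 (by positivity)
        _ = L₀ * γ ^ 2 * (2 * (ℓ + 1)) * ‖e.snd‖ := by field_simp
        _ ≤ L₀ * γ ^ 2 * (4 * ℓ) * ‖e.snd‖ := by
            refine mul_le_mul_of_nonneg_right (mul_le_mul_of_nonneg_left (by linarith)
              (by positivity)) (norm_nonneg _)
        _ = _ := by ring
    have h3 : (2 : ℝ) ^ d * ‖e.snd‖ ≤ 2 ^ d * ℓ * ‖e.snd‖ :=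
      mul_le_mul_of_nonneg_right (le_mul_of_one_le_right (by positivity) hℓ) (norm_nonneg _)
    calc energyNorm A (M.nodeSupp z) (Φ e).snd ≤ √β * ‖(Φ e).snd‖ :=
          hAz.energyNorm_le hα.le hβ _
      _ ≤ √β * ((2 ^ d + 4 * L₀ * γ ^ 2) * ℓ * ‖e.snd‖) := by
          refine mul_le_mul_of_nonneg_left ?_ (Real.sqrt_nonneg _)
          linarith [hΦ3 e]
      _ = _ := by ring
  -- The lower Riesz inequality bounds the coefficients by the source, and the inverse estimate
  -- bounds the source by H⁻¹ ‖∇v‖.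
  have hc : √(∑ T ∈ S, ∑ j ∈ Finset.range J, c T j ^ 2) ≤
      Cr ^ (1 / 2 : ℝ) * (Ci * β * M.meshSize⁻¹ * ‖v.snd‖) := by
    have h1 := hriesz c
    rw [inv_mul_le_iff₀ hCr] at h1
    rw [← Real.sqrt_eq_rpow]
    refine (Real.sqrt_le_sqrt h1).trans ?_
    rw [Real.sqrt_mul hCr.le, Real.sqrt_sq (norm_nonneg _)]
    exact mul_le_mul_of_nonneg_left hfinv (Real.sqrt_nonneg _)
  -- The overlap bound is simplified by 1 + 4 γ² (m + 1) ≤ 9 γ² m; its square root gives m^{d/2}.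
  have hJ : √(J * (1 + 4 * γ ^ 2 * (m + 1)) ^ d) ≤
      √(J * (9 * γ ^ 2) ^ d) * (m : ℝ) ^ ((d : ℝ) / 2) :=
    sqrt_mul_pow_le (by positivity) (by positivity) (by positivity) (by nlinarith)
  have hden : ‖v.snd‖ ≤ (√α)⁻¹ * energyNorm A (M.nodePatch ℓ z) v.snd := by
    rw [inv_mul_eq_div, le_div_iff₀ (Real.sqrt_pos.2 hα), mul_comm]
    exact hAD.norm_le_energyNorm hα.le hβ _ (snd_eq_zero_of_mem_H10 hvsol.1)
  have hCrp : 0 ≤ Cr ^ (1 / 2 : ℝ) := Real.rpow_nonneg hCr.le _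
  have hmp : 0 ≤ (m : ℝ) ^ ((d : ℝ) / 2) := by positivity
  -- A vanishing denominator is harmless, since the quotient is then 0.
  refine div_le_of_le_mul₀ (Real.sqrt_nonneg _) (by positivity) ?_
  have hR1 : 0 ≤ 2 * R + 1 := by positivity
  have hC1 : 0 ≤ 1 + (2 * R + 1) * (β / α) := by positivity
  calc energyNorm A (M.nodeSupp z) (Φ e).snd
      ≤ √β * (2 ^ d + 4 * L₀ * γ ^ 2) * ℓ * ‖e.snd‖ := hnum2
    _ ≤ √β * (2 ^ d + 4 * L₀ * γ ^ 2) * ℓ * (α⁻¹ * (s * (1 + (2 * R + 1) * (β / α)) *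
        (√(J * (9 * γ ^ 2) ^ d) * (m : ℝ) ^ ((d : ℝ) / 2)) * (2 * R + 1) *
        (Cr ^ (1 / 2 : ℝ) * (Ci * β * M.meshSize⁻¹ *
          ((√α)⁻¹ * energyNorm A (M.nodePatch ℓ z) v.snd))))) := by
        refine mul_le_mul_of_nonneg_left (hebound.trans ?_) (by positivity)
        refine mul_le_mul_of_nonneg_left ?_ (by positivity)
        refine mul_le_mul ?_ (hc.trans ?_) (Real.sqrt_nonneg _) (by positivity)
        · refine mul_le_mul_of_nonneg_right ?_ hR1
          exact mul_le_mul_of_nonneg_left hJ (mul_nonneg hs0 hC1)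
        · refine mul_le_mul_of_nonneg_left ?_ hCrp
          exact mul_le_mul_of_nonneg_left hden (by positivity)
    _ = _ := by ring

end QuadMesh

end SLGFEM

end

/-! ### Choice of the constants -/

theorem mainTheorem2 (d : ℕ) (hd : d = 2 ∨ d = 3) (p : ℕ) (γ α β : ℝ) (hα : 0 < α) (hαβ : α ≤ β)
    (Ω : Set (SLGFEM.E d)) (hΩ_open : IsOpen Ω) (hΩ_bdd : Bornology.IsBounded Ω)
    (hΩ_reg : interior (closure Ω) = Ω) :
    ∃ C : ℝ, 0 < C ∧ ∃ K : ℕ, 0 < K ∧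
      ∀ (A : SLGFEM.E d → Matrix (Fin d) (Fin d) ℝ) (_hA : SLGFEM.IsCoefficient Ω α β A)
        (M : SLGFEM.QuadMesh d Ω) (_hM_shape : M.ShapeRegular γ) (_hM_unif : M.QuasiUniform γ)
        (ℓ m : ℕ) (_hm : 1 ≤ m) (_hmℓ : m < ℓ)
        (σ : SLGFEM.E d → Fin M.N → ℕ → ℝ) (q : SLGFEM.E d → Fin M.N → ℕ → SLGFEM.L2 d)
        (w : SLGFEM.E d → Fin M.N → ℕ → SLGFEM.H1Pair d)
        (_hsvd : ∀ z ∈ M.nodes, ∀ T ∈ M.elemsIn (M.nodePatch ℓ z),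
          M.IsLocalSVD A p ℓ m z T (σ z T) (q z T) (w z T))
        (Cr : ℝ) (_hCr : 0 < Cr) (_hriesz : M.LocalRieszStable p ℓ m q Cr)
        (n : ℕ) (_hn : K * m ^ d ≤ n),
        M.width A p n ℓ ≤ ENNReal.ofReal
          (C * ℓ * (m : ℝ) ^ ((d : ℝ) / 2) * M.meshSize⁻¹ * Cr ^ (1 / 2 : ℝ) *
            M.sigmaTilde p ℓ m σ) := by
  have hd0 : 0 < d := by omega
  have hβ : 0 ≤ β := hα.le.trans hαβ
  -- No lower bound on γ is assumed; enlarging it to at least 1 preserves regularity of the mesh.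
  obtain ⟨Γ, hγΓ, hΓ⟩ : ∃ Γ : ℝ, γ ≤ Γ ∧ 1 ≤ Γ := ⟨max γ 1, le_max_left _ _, le_max_right _ _⟩
  obtain ⟨L₀, hL₀, hL⟩ := SLGFEM.exists_lipschitz_nodalCoord d
  obtain ⟨Ci, hCi, hinv⟩ := SLGFEM.QuadMesh.exists_inverse_estimate hd0 p hΓ
  obtain ⟨R, hR, hΩR⟩ : ∃ R : ℝ, 0 ≤ R ∧ closure Ω ⊆ Metric.closedBall 0 R := by
    obtain ⟨r, hr⟩ := hΩ_bdd.closure.subset_closedBall (0 : SLGFEM.E d)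
    exact ⟨max r 0, le_max_right _ _,
      hr.trans (Metric.closedBall_subset_closedBall (le_max_left _ _))⟩
  let C : ℝ := √β * (2 ^ d + 4 * L₀ * Γ ^ 2) * (α⁻¹ * (1 + (2 * R + 1) * (β / α)) *
    √(SLGFEM.QuadMesh.polyDim d p * (9 * Γ ^ 2) ^ d) * (2 * R + 1)) * (Ci * β) * (√α)⁻¹
  have hC : 0 ≤ C := by positivity
  let K : ℕ := ⌈SLGFEM.QuadMesh.polyDim d p * (13 * Γ ^ 2) ^ d⌉₊ + 1
  refine ⟨C + 1, by linarith, K, Nat.succ_pos _, ?_⟩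
  intro A hA M hs hu ℓ m hm hmℓ σ q w hsvd Cr hCr hriesz n hn
  have hs' := hs.mono hγΓ
  have hu' := hu.mono hγΓ
  have hσ0 := SLGFEM.QuadMesh.sigmaTilde_nonneg hsvd
  refine iSup₂_le fun z hz => ?_
  -- A node belongs to an element, so H > 0. For a mesh without elements the width is a supremum
  -- over no nodes.
  have hH : 0 < M.meshSize := by
    obtain ⟨T, -⟩ := hz
    exact M.meshSize_pos hd0 T
  have hAcl : SLGFEM.IsCoefficient (closure Ω) α β A :=
    hA.mono (SLGFEM.QuadMesh.closure_ae_le hd0 hs' hu' hΓ hΩ_reg)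
  have hAD : SLGFEM.IsCoefficient (M.nodePatch ℓ z) α β A :=
    hAcl.mono (Filter.Eventually.of_forall (M.nodePatch_subset ℓ z))
  have hn' : (SLGFEM.QuadMesh.polyDim d p * (13 * Γ ^ 2) ^ d) * (m : ℝ) ^ d ≤ n := by
    have h1 : ((K * m ^ d : ℕ) : ℝ) ≤ n := by exact_mod_cast hn
    refine le_trans ?_ h1
    push_cast [K]
    refine mul_le_mul_of_nonneg_right ?_ (by positivity)
    exact (Nat.le_ceil _).trans (by linarith)
  refine (SLGFEM.QuadMesh.localWidth_le hd0 hs' hu' hΓ hΩ_open hΩ_reg hm hmℓ hz hα hβ hA hR hΩR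
    hL₀ hL hCi (hinv M hs' hu' hα.le hβ hAD
      (SLGFEM.QuadMesh.nodePatch_subset_iUnion_elemsIn (by omega) z)) (hsvd z hz) hσ0
    (fun T hT => SLGFEM.QuadMesh.le_sigmaTilde σ hz hT) hCr (hriesz z hz).1
    (fun c => ((hriesz z hz).2 c).1) hn').trans (ENNReal.ofReal_le_ofReal ?_)
  have h2 : 0 ≤ Cr ^ (1 / 2 : ℝ) := Real.rpow_nonneg hCr.le _
  refine mul_le_mul_of_nonneg_right ?_ hσ0
  refine mul_le_mul_of_nonneg_right ?_ h2
  refine mul_le_mul_of_nonneg_right ?_ (inv_pos.2 hH).le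
  refine mul_le_mul_of_nonneg_right ?_ (by positivity)
  exact mul_le_mul_of_nonneg_right (by linarith) (Nat.cast_nonneg ℓ)
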